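/- Fix an infinite set $\Sigma$ of labels, namely all words over $\{0,1\}$, and consider finite, nonempty, ordered, unranked trees $t$ whose vertices $v$ carry labels $\mathrm{lab}_t(v)\in\Sigma$; the root of $t$ is denoted by $\varepsilon$. A DTD $d$ consists of a finite set $\Sigma_d\subseteq\Sigma$, a start symbol $S_d\in\Sigma_d$ and a mapping, also called $d$, from $\Sigma_d$ to the regular expressions over $\Sigma_d$. A tree $t$ matches $d$ if $\mathrm{lab}_t(\varepsilon)=S_d$ and every vertex $u$ of $t$, with children $u_1,\dots,u_n$ from left to right, satisfies $\mathrm{lab}_t(u)\in\Sigma_d$ and $\mathrm{lab}_t(u_1)\cdots\mathrm{lab}_t(u_n)\in L(d(\mathrm{lab}_t(u)))$. The expressions of the fragment $\mathrm{XP}(/,[\,])$ are generated by the rules $$p ::= \mathit{axis}::a\,[p_1]\cdots[p_k]\ (k\ge 0)\ \mid\ p/p,\qquad \mathit{axis} ::= \mathrm{self}\mid\mathrm{child},\qquad a\in\Sigma .$$ On a tree $t$, an expression $p$ defines a binary relation $[\![p]\!]_t$ on the vertices of $t$. A pair $(u,v)$ is in $[\![\mathit{axis}::a[p_1]\cdots[p_k]]\!]_t$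 if $v=u$ (for the axis self) or $v$ is a child of $u$ (for the axis child), $\mathrm{lab}_t(v)=a$, and for each $i\le k$ there is a vertex $w$ with $(v,w)\in[\![p_i]\!]_t$. Moreover, $[\![p/q]\!]_t$ is the composition $[\![p]\!]_t\circ[\![q]\!]_t$, that is, the set of all $(u,w)$ such that $(u,v)\in[\![p]\!]_t$ and $(v,w)\in[\![q]\!]_t$ for some $v$. The tree $t$ matches $p$, written $t\models p$, if $(\varepsilon,v)\in[\![p]\!]_t$ for some vertex $v$. For a DTD $d$ and expressions $p,q$ write $p\subseteq_d q$ if $t\models p$ implies $t\models q$ for all trees $t$ that match $d$. **Theorem.** The problem to decide, for a given DTD $d$ and two given expressions $p,q$ from $\mathrm{XP}(/,[\,])$, whether $p\subseteq_d q$, is in coNP. That is, the complement of the language of all (standard) encodings, as words over a finite alphabet, of triples $(d,p,q)$ with $p\subseteq_d q$ is in NP. -/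

import Mathlib

namespace XPathDTD

/-! ## The class coNP

Polynomial time is Mathlib's notion for multi-stack Turing machines. -/

/-- A language `L` over a finite alphabet `A` is in NP if there are a polynomial `c` and a
polynomial-time decidable relation `V` such that a word `x` is in `L` if and only if `V x y` holds
for some bit string `y` of length at most `c |x|`. The pair `(x, y)` is given to the machine as the
word `x` followed by the word `y`, over the disjoint union of the two alphabets. -/
def InNP {A : Type} [Fintype A] (L : Set (List A)) : Prop :=
  ∃ (c : Polynomial ℕ) (V : List A × List Bool → Bool),
    Nonempty (Turing.TM2ComputableInPolyTime
      (Computability.encodingProd (Computability.encodingList A)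
        (Computability.encodingList Bool)).encode
      Computability.encodingBoolBool.encode V) ∧
    ∀ x : List A, x ∈ L ↔ ∃ y : List Bool, y.length ≤ c.eval x.length ∧ V (x, y) = true

/-- A language is in coNP if its complement is in NP. -/
def InCoNP {A : Type} [Fintype A] (L : Set (List A)) : Prop := InNP Lᶜ

/-! ## XML trees -/

/-- The infinite set of labels: all words over `{0, 1}`. -/
abbrev Label : Type := List Bool

/-- A vertex is the sequence of child numbers on the path from the root; `[]` is the root and
`v ++ [i]` is the `i`-th child of `v`, where the numbering starts at `0`. -/
abbrev Vertex : Type := List ℕ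

/-- A finite, nonempty, ordered, unranked tree with labelled vertices, given by a tree domain.
Only the values of `lab` on `dom` matter. (Attributes play no role for the expressions
considered here, nor for DTDs.) -/
structure XMLTree where
  /-- the tree domain -/
  dom : Finset Vertex
  /-- the labelling -/
  lab : Vertex → Label
  root_mem : [] ∈ dom
  parent_mem : ∀ (v : Vertex) (i : ℕ), v ++ [i] ∈ dom → v ∈ dom
  sibling_mem : ∀ (v : Vertex) (i : ℕ), v ++ [i + 1] ∈ dom → v ++ [i] ∈ dom

/-- The vertex `u` has exactly `n` children in `t`. -/
def XMLTree.HasArity (t : XMLTree) (u : Vertex) (n : ℕ) : Prop :=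
  ∀ i : ℕ, u ++ [i] ∈ t.dom ↔ i < n

/-- The word formed by the labels of the first `n` children of `u`, from left to right. -/
def XMLTree.childWord (t : XMLTree) (u : Vertex) (n : ℕ) : List Label :=
  (List.range n).map fun i => t.lab (u ++ [i])

/-! ## DTDs -/

/-- The labels that occur in a regular expression. -/
def letters : RegularExpression Label → List Label
  | .zero => []
  | .epsilon => []
  | .char a => [a]
  | .plus r s => letters r ++ letters s
  | .comp r s => letters r ++ letters s
  | .star r => letters r

/-- A DTD: a finite mapping from a finite set of labels to regular expressions over this same set,
given as a list of rules with exactly one rule per label, with a start symbol from this set. -/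
structure DTD where
  /-- the start symbol -/
  start : Label
  /-- the rules `a → r` -/
  rules : List (Label × RegularExpression Label)
  nodup : (rules.map Prod.fst).Nodup
  start_mem : start ∈ rules.map Prod.fst
  closed : ∀ ρ ∈ rules, ∀ b ∈ letters ρ.2, b ∈ rules.map Prod.fst

/-- The tree `t` matches the DTD `d`: the root carries the start symbol, and at every vertex the
word of the labels of its children is in the language of the regular expression that `d` assigns to
the label of the vertex. -/
def XMLTree.Conforms (t : XMLTree) (d : DTD) : Prop :=
  t.lab [] = d.start ∧
    ∀ u ∈ t.dom, ∃ n, t.HasArity u n ∧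
      ∃ r, (t.lab u, r) ∈ d.rules ∧ t.childWord u n ∈ r.matches'

/-! ## XPath expressions with child axis and filters -/

/-- The axes. The self axis is always available; the only other axis of the fragment is child. -/
inductive Axis
  | self
  | child

/-- The location paths of `XP(/, [])`: either a location step `ax :: a [e₁] ⋯ [eₖ]` with a label
as node test and location paths as filters, or a composition `p / q`. There are no wildcards, no
descendant axis and no disjunction. -/
inductive XPath
  | step (ax : Axis) (a : Label) (filters : List XPath)
  | comp (p q : XPath)

/-- `ax.Rel u v`: the vertex `v` is reached from `u` along the axis `ax`. -/
def Axis.Rel : Axis → Vertex → Vertex → Prop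
  | .self, u, v => v = u
  | .child, u, v => ∃ i : ℕ, v = u ++ [i]

mutual
/-- The binary relation on the vertices of `t` that a location path defines. -/
def XPath.Sem (t : XMLTree) : XPath → Vertex → Vertex → Prop
  | .step ax a es, u, v =>
      u ∈ t.dom ∧ v ∈ t.dom ∧ ax.Rel u v ∧ t.lab v = a ∧ XPath.AllHold t es v
  | .comp p q, u, w => ∃ v, XPath.Sem t p u v ∧ XPath.Sem t q v w
/-- Every filter of the list is true at `v`, that is, selects some vertex from `v`. -/
def XPath.AllHold (t : XMLTree) : List XPath → Vertex → Prop
  | [], _ => True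
  | e :: es, v => (∃ w, XPath.Sem t e v w) ∧ XPath.AllHold t es v
end

/-- The tree `t` matches the expression `p` as a Boolean query. -/
def XMLTree.Models (t : XMLTree) (p : XPath) : Prop := ∃ v, p.Sem t [] v

/-- Containment relative to a DTD: every tree that matches `d` and `p` also matches `q`. -/
def ContainedIn (d : DTD) (p q : XPath) : Prop :=
  ∀ t : XMLTree, t.Conforms d → t.Models p → t.Models q

/-! ## Encoding of the instances as words -/

/-- The symbols used to write down instances. -/
inductive Sym
  | bit (b : Bool)
  | sep
  | zero | epsilon | char | plus | cat | star
  | self | child | slash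
  | more | done
  deriving DecidableEq, Fintype

/-- A label is written as its word, followed by an end marker. -/
def encLabel (a : Label) : List Sym := a.map Sym.bit ++ [Sym.sep]

/-- Regular expressions are written in prefix notation. -/
def encRegex : RegularExpression Label → List Sym
  | .zero => [Sym.zero]
  | .epsilon => [Sym.epsilon]
  | .char a => Sym.char :: encLabel a
  | .plus r s => Sym.plus :: (encRegex r ++ encRegex s)
  | .comp r s => Sym.cat :: (encRegex r ++ encRegex s)
  | .star r => Sym.star :: encRegex r

/-- The symbol for an axis. -/
def encAxis : Axis → Sym
  | .self => Sym.self
  | .child => Sym.child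

mutual
/-- Location paths are written in prefix notation; a step is its axis, its label and its filters. -/
def encXPath : XPath → List Sym
  | .step ax a es => encAxis ax :: (encLabel a ++ encFilters es)
  | .comp p q => Sym.slash :: (encXPath p ++ encXPath q)
/-- A list of filters: each one is preceded by `more`, and the list is closed by `done`. -/
def encFilters : List XPath → List Sym
  | [] => [Sym.done]
  | e :: es => Sym.more :: (encXPath e ++ encFilters es)
end

/-- A list of rules: each one is preceded by `more`, and the list is closed by `done`. -/
def encRules : List (Label × RegularExpression Label) → List Sym
  | [] => [Sym.done]
  | ρ :: ρs => Sym.more :: (encLabel ρ.1 ++ encRegex ρ.2 ++ encRules ρs)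

/-- The word for an instance, which consists of a DTD and two expressions. -/
def encInstance (d : DTD) (p q : XPath) : List Sym :=
  encLabel d.start ++ encRules d.rules ++ encXPath p ++ encXPath q

/-- The containment problem relative to a DTD for `XP(/, [])`, as a language: the set of all words
that encode a DTD `d` and two expressions `p` and `q` such that `p` is contained in `q` relative to
`d`. -/
def dtdContainment : Set (List Sym) :=
  {w | ∃ (d : DTD) (p q : XPath), w = encInstance d p q ∧ ContainedIn d p q}

/-! ## Instances can be read back from their encodings -/

theorem encLabel_inj : ∀ {a b : Label} {x y : List Sym},
    encLabel a ++ x = encLabel b ++ y → a = b ∧ x = y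
  | [], [], x, y, h => by simpa [encLabel] using h
  | [], _ :: _, x, y, h => by simp [encLabel] at h
  | _ :: _, [], x, y, h => by simp [encLabel] at h
  | c :: a, c' :: b, x, y, h => by
    simp only [encLabel, List.map_cons, List.cons_append, List.cons.injEq, Sym.bit.injEq] at h
    obtain ⟨h1, h2⟩ := encLabel_inj (a := a) (b := b) (x := x) (y := y) h.2
    exact ⟨by rw [h.1, h1], h2⟩

theorem encRegex_inj : ∀ {r s : RegularExpression Label} {x y : List Sym},
    encRegex r ++ x = encRegex s ++ y → r = s ∧ x = y := by
  intro r
  induction r with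
  | zero => intro s x y h; cases s <;> simp_all [encRegex]
  | epsilon => intro s x y h; cases s <;> simp_all [encRegex]
  | char a =>
    intro s x y h
    cases s <;> simp [encRegex] at h
    replace h := encLabel_inj h
    obtain ⟨rfl, rfl⟩ := h
    exact ⟨rfl, rfl⟩
  | plus r₁ r₂ h₁ h₂ =>
    intro s x y h
    cases s <;> simp only [encRegex, List.cons_append, List.append_assoc, List.cons.injEq,
      reduceCtorEq, false_and, true_and, List.nil_append] at h
    replace h := h₁ h
    obtain ⟨rfl, h⟩ := h
    replace h := h₂ h
    obtain ⟨rfl, rfl⟩ := h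
    exact ⟨rfl, rfl⟩
  | comp r₁ r₂ h₁ h₂ =>
    intro s x y h
    cases s <;> simp only [encRegex, List.cons_append, List.append_assoc, List.cons.injEq,
      reduceCtorEq, false_and, true_and, List.nil_append] at h
    replace h := h₁ h
    obtain ⟨rfl, h⟩ := h
    replace h := h₂ h
    obtain ⟨rfl, rfl⟩ := h
    exact ⟨rfl, rfl⟩
  | star r h₁ =>
    intro s x y h
    cases s <;> simp only [encRegex, List.cons_append, List.cons.injEq,
      reduceCtorEq, false_and, true_and, List.nil_append] at h
    replace h := h₁ h
    obtain ⟨rfl, rfl⟩ := h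
    exact ⟨rfl, rfl⟩

mutual
theorem encXPath_inj : ∀ {p q : XPath} {x y : List Sym},
    encXPath p ++ x = encXPath q ++ y → p = q ∧ x = y
  | .step ax a es, .step ax' a' es', x, y, h => by
    simp only [encXPath, List.cons_append, List.append_assoc, List.cons.injEq] at h
    obtain ⟨h0, h⟩ := h
    replace h := encLabel_inj h
    obtain ⟨rfl, h⟩ := h
    replace h := encFilters_inj h
    obtain ⟨rfl, rfl⟩ := h
    cases ax <;> cases ax' <;> simp_all [encAxis]
  | .step ax _ _, .comp _ _, x, y, h => by cases ax <;> simp [encXPath, encAxis] at h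
  | .comp _ _, .step ax _ _, x, y, h => by cases ax <;> simp [encXPath, encAxis] at h
  | .comp p q, .comp p' q', x, y, h => by
    simp only [encXPath, List.cons_append, List.append_assoc, List.cons.injEq, true_and] at h
    replace h := encXPath_inj h
    obtain ⟨rfl, h⟩ := h
    replace h := encXPath_inj h
    obtain ⟨rfl, rfl⟩ := h
    exact ⟨rfl, rfl⟩
theorem encFilters_inj : ∀ {es fs : List XPath} {x y : List Sym},
    encFilters es ++ x = encFilters fs ++ y → es = fs ∧ x = y
  | [], [], x, y, h => by simpa [encFilters] using h
  | [], _ :: _, x, y, h => by simp [encFilters] at h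
  | _ :: _, [], x, y, h => by simp [encFilters] at h
  | e :: es, f :: fs, x, y, h => by
    simp only [encFilters, List.cons_append, List.append_assoc, List.cons.injEq, true_and] at h
    replace h := encXPath_inj h
    obtain ⟨rfl, h⟩ := h
    replace h := encFilters_inj h
    obtain ⟨rfl, rfl⟩ := h
    exact ⟨rfl, rfl⟩
end

theorem encRules_inj : ∀ {ρs σs : List (Label × RegularExpression Label)} {x y : List Sym},
    encRules ρs ++ x = encRules σs ++ y → ρs = σs ∧ x = y
  | [], [], x, y, h => by simpa [encRules] using h
  | [], _ :: _, x, y, h => by simp [encRules] at h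
  | _ :: _, [], x, y, h => by simp [encRules] at h
  | (a, r) :: ρs, (b, s) :: σs, x, y, h => by
    simp only [encRules, List.cons_append, List.append_assoc, List.cons.injEq, true_and] at h
    replace h := encLabel_inj h
    obtain ⟨rfl, h⟩ := h
    replace h := encRegex_inj h
    obtain ⟨rfl, h⟩ := h
    replace h := encRules_inj h
    obtain ⟨rfl, rfl⟩ := h
    exact ⟨rfl, rfl⟩

/-- Different instances have different encodings. -/
theorem encInstance_inj {d d' : DTD} {p p' q q' : XPath}
    (h : encInstance d p q = encInstance d' p' q') : d = d' ∧ p = p' ∧ q = q' := by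
  simp only [encInstance, List.append_assoc] at h
  replace h := encLabel_inj h
  obtain ⟨h1, h⟩ := h
  replace h := encRules_inj h
  obtain ⟨h2, h⟩ := h
  replace h := encXPath_inj h
  obtain ⟨rfl, h⟩ := h
  obtain ⟨rfl, -⟩ := encXPath_inj (x := []) (y := []) (by simpa using h)
  refine ⟨?_, rfl, rfl⟩
  cases d; cases d'
  simp_all

end XPathDTD

/-!
# Containment of `XP(/, [])`-expressions relative to a DTD is in coNP

* Nondeterministic programs with procedures over finitely many stacks are compiled to Turing machines
  with several stacks, which read the outcomes of the choices from the witness. So it suffices to give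
  such a program that needs polynomially many calls (`StackMachine.inNP_of_exec`).
* A counterexample to the containment of `p` in `q` is a tree that matches the DTD and `p`, but not
  `q`. It is described by a database of polynomially many records (`XPathDTD.Rec`), where the subtrees
  that do not matter for `p` are shared. A record has a label, a goal that fails at the vertex, and the
  numbers of the records of the children. As a goal that fails at a vertex gives rise to only one goal
  that has to fail at all its children (`XPathDTD.Red`), only polynomially many goals occur
  (`XPathDTD.IsGoal`).
* The program guesses the database record by record, and then evaluates `p` on it.
-/

/-! ## Nondeterministic stack machines with subroutine calls -/

namespace StackMachine

open Turing StateTransition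

-- A counterexample to containment is a tree that matches the DTD and `p` but not `q`. Such trees
-- may have to be exponentially large, already because of the DTD, so they are guessed in compressed
-- form, as an acyclic graph of records in which subtrees are shared.
--
-- Failure of `q`. A path is a conjunction of a label test, filters and a remaining path. If it
-- fails at a vertex, one conjunct can be blamed, and following the blame through the self steps
-- ends either at a wrong label or at a child step that no child satisfies. In the second case one
-- and the same goal, the child step turned into a self step, has to fail at all children (`Red`,
-- `Red.childSat`, `exists_red`). So a vertex needs only one failing goal as annotation. In prefix
-- notation all goals are suffixes of the word for `q`, up to a change of the first symbol, or the
-- dummy goal, so there are linearly many (`Red.isGoal`, `goalList`).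
--
-- Sharing. A subtree with root label `a` in which the goal `g` fails may be exchanged for any other
-- such subtree without affecting conformity or failure above it. Hence one record for each
-- realisable pair of a label and a goal suffices (`exists_covers`). Its list of children can be
-- short, because superfluous iterations of stars can be deleted from a word of a regular language
-- (`exists_regGen`).
--
-- Satisfaction of `p`. What has to hold at a vertex is distributed to children while the total
-- weight decreases (`exists_child_goals`). Only vertices that carry positive weight get records of
-- their own, at most `weight p` in number, and all other children refer to shared records
-- (`Covers.exists_model`). This gives a polynomial database (`exists_valid_of_not_containedIn`).
-- Conversely, every database that passes the local checks unfolds to a conforming tree in which the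
-- goal of the root record fails (`Valid.conf_failS`, `not_containedIn_of_valid`).
--
-- Machines. The procedure is written as a nondeterministic recursive program on stacks. Time is
-- controlled by counting calls alone: a call is resolved by boundedly many choice bits, and a
-- potential shows that the running time is linear in the length of the input and the number of bits
-- (`inNP_of_exec`). Words that encode no instance also belong to the complement; the program has a
-- branch for each way in which a word can fail to be an encoding.

/-- Elementary operations on a family of stacks indexed by `K` over the alphabet `A`. -/
inductive Op (K A : Type)
  | pop (k : K) (a : A)
  | push (k : K) (a : A)
  | empty (k : K)

/-- Execute an operation: `pop k a` requires `a` on top of stack `k`, and `empty k` is a test. -/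
def Op.run {K A : Type} [DecidableEq K] [DecidableEq A] :
    Op K A → (K → List A) → Option (K → List A)
  | .pop k a, s => if (s k).head? = some a then some (Function.update s k (s k).tail) else none
  | .push k a, s => some (Function.update s k (a :: s k))
  | .empty k, s => if s k = [] then some s else none

/-- The instruction at a node of a flow graph with subroutine calls and binary choices. -/
inductive Code (K A N : Type)
  | ret
  | fail
  | op (o : Op K A) (n : N)
  | call (n₁ n₂ : N)
  | choose (n₁ n₂ : N)

/-- A configuration: the current node, the return addresses, the bits that resolve the remaining
choices, and the stacks. -/
structure Conf (K A N : Type) where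
  cur : N
  rets : List N
  bits : List Bool
  stk : K → List A

variable {K A N : Type} [DecidableEq K] [DecidableEq A]

/-- One step of a flow graph: the next configuration, or the verdict. -/
def next (code : N → Code K A N) (c : Conf K A N) : Conf K A N ⊕ Bool :=
  match code c.cur with
  -- A return with no pending address is the only way to accept.
  | .ret => match c.rets with
    | [] => .inr true
    | n :: r => .inl { c with cur := n, rets := r }
  | .fail => .inr false
  | .op o n => match o.run c.stk with
    | none => .inr false
    | some s => .inl { c with cur := n, stk := s }
  | .call n₁ n₂ => .inl { c with cur := n₁, rets := n₂ :: c.rets }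
  | .choose n₁ n₂ => match c.bits with
    | [] => .inr false
    | b :: bs => .inl { c with cur := if b then n₁ else n₂, bits := bs }

/-- The computation from a configuration ends with the verdict `true`. -/
inductive Accepts (code : N → Code K A N) : Conf K A N → Prop
  | halt {c} : next code c = .inr true → Accepts code c
  | step {c c'} : next code c = .inl c' → Accepts code c' → Accepts code c

theorem accepts_iff_of_next_inl {code : N → Code K A N} {c c' : Conf K A N}
    (h : next code c = .inl c') : Accepts code c ↔ Accepts code c' := by
  refine ⟨fun H => ?_, .step h⟩
  cases H with
  | halt h' => simp [h] at h'
  | step h' H => rw [h] at h'; cases h'; exact H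

theorem accepts_iff_of_next_inr {code : N → Code K A N} {c : Conf K A N} {b : Bool}
    (h : next code c = .inr b) : Accepts code c ↔ b = true := by
  refine ⟨fun H => ?_, fun hb => .halt (hb ▸ h)⟩
  cases H with
  | halt h' => rw [h] at h'; cases h'; rfl
  | step h' H => exact absurd (h.symm.trans h') (by simp)

/-! ### Compilation to `TM2` -/

/-- The stacks of the compiled machine. -/
inductive Stk (K : Type)
  | input
  | ctrl
  | output
  | data (k : K)
  deriving DecidableEq, Fintype

/-- The stack alphabets of the compiled machine. -/
abbrev Alph (K A N : Type) : Stk K → Type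
  | .input => A ⊕ Bool
  | .ctrl => N
  | .output => Bool
  | .data _ => A

/-- The function labels of the compiled machine. -/
inductive Lab (N : Type)
  | load
  | exec (n : N)
  | clean (b : Bool)
  deriving Fintype

/-- The internal state of the compiled machine: the last input symbol, the last return address,
and a flag. -/
abbrev Var (A N : Type) : Type := Option (A ⊕ Bool) × Option N × Bool

/-- The initial internal state. -/
def var₀ : Var A N := (none, none, true)

/-- Pop every stack of a list once, and record in the flag whether they were all empty. -/
def popAll (q : TM2.Stmt (Alph K A N) (Lab N) (Var A N)) :
    List (Stk K) → TM2.Stmt (Alph K A N) (Lab N) (Var A N)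
  | [] => q
  | k :: ks => .pop k (fun v o => (v.1, v.2.1, v.2.2 && o.isNone)) (popAll q ks)

variable [Fintype K] [Inhabited A]

/-- The label to go on with after an operation that sets the flag. -/
def contIf (n : N) (v : Var A N) : Lab N := if v.2.2 then .exec n else .clean false

/-- The compiled machine. The part of the input over `A` is loaded to the stack `k₀`. -/
noncomputable def machine (code : N → Code K A N) (k₀ : K) (n₀ : N) :
    Lab N → TM2.Stmt (Alph K A N) (Lab N) (Var A N)
  -- The symbol is only peeked at: if it is a bit, it must stay on the input stack, where it will
  -- resolve the first choice.
  | .load => .peek .input (fun v o => (o, v.2)) <|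
      .branch (fun v => (v.1.bind Sum.getLeft?).isSome)
        (.pop .input (fun v _ => v) <|
          .push (.data k₀) (fun v => ((v.1.bind Sum.getLeft?).getD default : A)) <|
          .goto fun _ => .load)
        (.goto fun _ => .exec n₀)
  | .exec n => match code n with
    | .ret => .pop .ctrl (fun v o => (v.1, o, true)) <|
        .goto fun v => match v.2.1 with
          | none => .clean true
          | some n => .exec n
    | .fail => .goto fun _ => .clean false
    | .op (.pop k a) n' => .pop (.data k) (fun v o => (v.1, v.2.1, decide (o = some a))) <|
        .goto (contIf n')
    | .op (.push k a) n' => .push (.data k) (fun _ => a) <| .goto fun _ => .exec n'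
    | .op (.empty k) n' => .peek (.data k) (fun v o => (v.1, v.2.1, o.isNone)) <|
        .goto (contIf n')
    | .call n₁ n₂ => .push .ctrl (fun _ => n₂) <| .goto fun _ => .exec n₁
    | .choose n₁ n₂ => .pop .input (fun v o => (o, v.2)) <|
        .goto fun v => match v.1 with
          | some (.inr true) => .exec n₁
          | some (.inr false) => .exec n₂
          | _ => .clean false
  -- A halting configuration must have all stacks empty except for the output. Each round pops every
  -- stack once, and the verdict is written only in a round that finds all of them empty already.
  | .clean b => .load (fun v => (v.1, v.2.1, true)) <|
      popAll (.branch (fun v => v.2.2)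
        (.load (fun _ => var₀) <| .push .output (fun _ => b) .halt)
        (.goto fun _ => .clean b)) Finset.univ.toList

/-- The contents of the stacks of the compiled machine. -/
def contents (w : List (A ⊕ Bool)) (r : List N) (s : K → List A) : ∀ k, List (Alph K A N k)
  | .input => w
  | .ctrl => r
  | .output => []
  | .data k => s k

section Stacks

omit [DecidableEq A] [Fintype K] [Inhabited A]

@[simp] theorem update_contents_input (w w' : List (A ⊕ Bool)) (r : List N) (s : K → List A) :
    Function.update (contents w r s) .input w' = contents w' r s := by
  funext k; cases k <;> simp [contents, Function.update]

@[simp] theorem update_contents_ctrl (w : List (A ⊕ Bool)) (r r' : List N) (s : K → List A) :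
    Function.update (contents w r s) .ctrl r' = contents w r' s := by
  funext k; cases k <;> simp [contents, Function.update]

@[simp] theorem update_contents_data (w : List (A ⊕ Bool)) (r : List N) (s : K → List A) (k : K)
    (l : List A) :
    Function.update (contents w r s) (.data k) l = contents w r (Function.update s k l) := by
  funext k'; cases k' with
  | data k' => by_cases h : k' = k
               · subst h; simp [contents]
               · simp [contents, Function.update, h]
  | _ => simp [contents, Function.update]

end Stacks

-- Step-by-step simulation of the flow graph.

/-- Running the machine for `n` steps leads from one configuration to another. -/
def RunsTo (M : Lab N → TM2.Stmt (Alph K A N) (Lab N) (Var A N)) (n : ℕ)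
    (c c' : TM2.Cfg (Alph K A N) (Lab N) (Var A N)) : Prop :=
  (flip bind (TM2.step M))^[n] (some c) = some c'

section Runs

omit [DecidableEq A] [Fintype K] [Inhabited A]

theorem RunsTo.step {M : Lab N → TM2.Stmt (Alph K A N) (Lab N) (Var A N)} {n : ℕ}
    {c c₁ c' : TM2.Cfg (Alph K A N) (Lab N) (Var A N)} (h : TM2.step M c = some c₁)
    (H : RunsTo M n c₁ c') : RunsTo M (n + 1) c c' := by
  unfold RunsTo at *
  rw [Function.iterate_succ_apply]
  have : flip bind (TM2.step M) (some c) = some c₁ := h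
  rw [this, H]

/-- As the stacks in the list are distinct, none is popped twice, so the flag and the result can be
read off from the original stacks. -/
theorem stepAux_popAll (q : TM2.Stmt (Alph K A N) (Lab N) (Var A N)) (ks : List (Stk K))
    (v : Var A N) (S : ∀ k, List (Alph K A N k)) (hks : ks.Nodup) :
    TM2.stepAux (popAll q ks) v S =
      TM2.stepAux q (v.1, v.2.1, v.2.2 && ks.all fun k => (S k).isEmpty)
        (fun k => if k ∈ ks then (S k).tail else S k) := by
  induction ks generalizing v S with
  | nil => simp [popAll]
  | cons k ks ih =>
    rw [List.nodup_cons] at hks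
    rw [popAll, TM2.stepAux, ih _ _ hks.2]
    congr 1
    · have : (ks.all fun k' => (Function.update S k (S k).tail k').isEmpty)
          = ks.all fun k' => (S k').isEmpty := by
        rw [Bool.eq_iff_iff, List.all_eq_true, List.all_eq_true]
        refine forall₂_congr fun a ha => ?_
        rw [Function.update_of_ne (by rintro rfl; exact hks.1 ha)]
      simp only [List.all_cons, this, Bool.and_assoc]
      cases S k <;> simp
    · funext k'
      by_cases h : k' = k
      · subst h; simp [hks.1]
      · simp [h]

end Runs

variable (code : N → Code K A N) (k₀ : K) (n₀ : N)

/-- A round that does not succeed shortens every nonempty stack, so there are at most `m` such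
rounds, followed by one in which all stacks are empty. -/
theorem runsTo_clean (b : Bool) (m : ℕ) (v : Var A N) (S : ∀ k, List (Alph K A N k))
    (hS : ∀ k, (S k).length ≤ m) :
    ∃ n ≤ m + 1, RunsTo (machine code k₀ n₀) n ⟨some (.clean b), v, S⟩
      ⟨none, var₀, Function.update (fun _ => []) .output [b]⟩ := by
  induction m generalizing v S with
  | zero =>
    refine ⟨1, le_rfl, ?_⟩
    have hS' : S = fun _ => [] := by
      funext k; exact List.length_eq_zero_iff.1 (Nat.le_zero.1 (hS k))
    subst hS'
    change some _ = some _
    have htrue : ((Finset.univ : Finset (Stk K)).toList.all fun _ => true) = true := by simp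
    rw [machine, TM2.stepAux, stepAux_popAll _ _ _ _ (Finset.nodup_toList _)]
    simp [htrue]
  | succ m ih =>
    by_cases hall : ∀ k, S k = []
    · have hS' : S = fun _ => [] := funext hall
      obtain ⟨n, hn, H⟩ := ih v S (by simp [hall])
      exact ⟨n, by omega, H⟩
    · obtain ⟨n, hn, H⟩ := ih (v.1, v.2.1, false) (fun k => (S k).tail) (fun k => by
        have := hS k; simp only [List.length_tail]; omega)
      refine ⟨n + 1, by omega, RunsTo.step ?_ H⟩
      push Not at hall
      obtain ⟨k, hk⟩ := hall
      have hfalse : ((Finset.univ : Finset (Stk K)).toList.all fun k => (S k).isEmpty) = false := by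
        rw [List.all_eq_false]
        exact ⟨k, by simp, by simpa using hk⟩
      rw [TM2.step, machine, TM2.stepAux, stepAux_popAll _ _ _ _ (Finset.nodup_toList _), hfalse]
      simp

/-- The total height of the stacks of a configuration. -/
def Conf.size (c : Conf K A N) : ℕ := c.rets.length + c.bits.length + ∑ k, (c.stk k).length

/-- The configuration of the compiled machine. -/
def Conf.toCfg (c : Conf K A N) (v : Var A N) : TM2.Cfg (Alph K A N) (Lab N) (Var A N) :=
  ⟨some (.exec c.cur), v, contents (c.bits.map .inr) c.rets c.stk⟩

omit [Inhabited A] [DecidableEq A] in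
theorem sum_length_update_le (s : K → List A) (k : K) (l : List A) {m : ℕ}
    (hl : l.length ≤ (s k).length + m) :
    ∑ k', (Function.update s k l k').length ≤ (∑ k', (s k').length) + m := by
  have h1 := Finset.add_sum_erase Finset.univ (fun k' => (Function.update s k l k').length)
    (Finset.mem_univ k)
  have h2 := Finset.add_sum_erase Finset.univ (fun k' => (s k').length) (Finset.mem_univ k)
  have h3 : ∑ k' ∈ Finset.univ.erase k, (Function.update s k l k').length
      = ∑ k' ∈ Finset.univ.erase k, (s k').length :=
    Finset.sum_congr rfl fun x hx => by rw [Function.update_of_ne (Finset.ne_of_mem_erase hx)]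
  simp only [Function.update_self] at h1
  omega

omit [DecidableEq K] [DecidableEq A] [Inhabited A] in
theorem length_contents_le (w : List (A ⊕ Bool)) (r : List N) (s : K → List A) (k : Stk K) :
    (contents w r s k).length ≤ r.length + w.length + ∑ k, (s k).length := by
  cases k with
  | input => simp only [contents]; omega
  | ctrl => simp only [contents]; omega
  | output => simp [contents]
  | data k =>
    have := Finset.single_le_sum (f := fun k => (s k).length) (fun _ _ => Nat.zero_le _)
      (Finset.mem_univ k)
    simp only [contents]; omega

/-- The internal state is mere scratch space: every instruction sets what it reads, so the
simulation works from any state. -/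
theorem step_machine_inl {c c' : Conf K A N} (h : next code c = .inl c') (v : Var A N) :
    ∃ v', TM2.step (machine code k₀ n₀) (c.toCfg v) = some (c'.toCfg v') := by
  unfold next at h
  simp only [Conf.toCfg, TM2.step, machine]
  cases hc : code c.cur with
  | ret =>
    rw [hc] at h
    cases hr : c.rets <;> simp only [hr] at h
    · simp at h
    · cases h; simp [contents]
  | fail => simp [hc] at h
  | op o n =>
    rw [hc] at h
    cases o with
    | pop k a =>
      by_cases ha : (c.stk k).head? = some a
      · simp [Op.run, ha] at h; subst h
        simp [contents, ha, contIf]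
      · simp [Op.run, ha] at h
    | push k a => simp [Op.run] at h; subst h; simp [contents]
    | empty k =>
      by_cases ha : c.stk k = []
      · simp [Op.run, ha] at h; subst h
        simp [contents, ha, contIf]
      · simp [Op.run, ha] at h
  | call n₁ n₂ => rw [hc] at h; cases h; simp [contents]
  | choose n₁ n₂ =>
    rw [hc] at h
    cases hr : c.bits with
    | nil => simp [hr] at h
    | cons b bs => simp only [hr] at h; cases h; cases b <;> simp [contents]

theorem step_machine_inr {c : Conf K A N} {b : Bool} (h : next code c = .inr b) (v : Var A N) :
    ∃ v' S', TM2.step (machine code k₀ n₀) (c.toCfg v) = some ⟨some (.clean b), v', S'⟩ ∧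
      ∀ k, (S' k).length ≤ c.size := by
  have hlen := length_contents_le (c.bits.map .inr) c.rets c.stk
  rw [List.length_map] at hlen
  unfold next at h
  simp only [Conf.toCfg, TM2.step, machine]
  cases hc : code c.cur with
  | ret =>
    rw [hc] at h
    cases hr : c.rets <;> simp only [hr] at h
    · cases h; rw [hr] at hlen; simpa [contents, Conf.size, hr] using hlen
    · simp at h
  | fail => rw [hc] at h; cases h; simpa [contents, Conf.size] using hlen
  | op o n =>
    rw [hc] at h
    cases o with
    | pop k a =>
      by_cases ha : (c.stk k).head? = some a
      · simp [Op.run, ha] at h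
      · simp [Op.run, ha] at h; subst h
        simp only [TM2.stepAux, contents, ha, contIf, update_contents_data, Option.some.injEq]
        refine ⟨_, _, rfl, fun k' => (length_contents_le _ _ _ _).trans ?_⟩
        have := sum_length_update_le c.stk k (c.stk k).tail (m := 0) (by simp)
        simp only [List.length_map, Conf.size]
        omega
    | push k a => simp [Op.run] at h
    | empty k =>
      by_cases ha : c.stk k = []
      · simp [Op.run, ha] at h
      · simp [Op.run, ha] at h; subst h
        simpa [contents, ha, contIf, Conf.size] using hlen
  | call n₁ n₂ => rw [hc] at h; cases h
  | choose n₁ n₂ =>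
    rw [hc] at h
    cases hr : c.bits with
    | nil => simp only [hr] at h; cases h; rw [hr] at hlen; simpa [contents, Conf.size,
        hr] using hlen
    | cons b bs => simp [hr] at h

omit [Inhabited A] in
theorem size_next_le {c c' : Conf K A N} (h : next code c = .inl c') : c'.size ≤ c.size + 1 := by
  unfold next at h
  cases hc : code c.cur with
  | ret =>
    rw [hc] at h
    cases hr : c.rets <;> simp only [hr] at h
    · simp at h
    · cases h; simp [Conf.size, hr]; omega
  | fail => simp [hc] at h
  | op o n =>
    rw [hc] at h
    cases o with
    | pop k a =>
      by_cases ha : (c.stk k).head? = some a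
      · simp [Op.run, ha] at h; subst h
        have := sum_length_update_le c.stk k (c.stk k).tail (m := 1) (by simp; omega)
        simp only [Conf.size]; omega
      · simp [Op.run, ha] at h
    | push k a =>
      simp [Op.run] at h; subst h
      have := sum_length_update_le c.stk k (a :: c.stk k) (m := 1) (by simp)
      simp only [Conf.size]; omega
    | empty k =>
      by_cases ha : c.stk k = []
      · simp [Op.run, ha] at h; subst h; simp [Conf.size]
      · simp [Op.run, ha] at h
  | call n₁ n₂ => rw [hc] at h; cases h; simp [Conf.size]; omega
  | choose n₁ n₂ =>
    rw [hc] at h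
    cases hr : c.bits with
    | nil => simp [hr] at h
    | cons b bs => simp only [hr] at h; cases h; simp [Conf.size, hr]; omega

-- Termination by a potential.

/-- A rank function witnesses that the flow graph cannot run for long without using up choice
bits. -/
structure Rank (code : N → Code K A N) where
  rank : N → ℕ
  max : ℕ
  le_max : ∀ n, rank n ≤ max
  ret : ∀ n, code n = .ret → 1 ≤ rank n
  op : ∀ n o n', code n = .op o n' → rank n' < rank n
  -- The return address is paid for at the moment of the call. Nothing is required at choices, as
  -- these are paid for by the bits they consume.
  call : ∀ n n₁ n₂, code n = .call n₁ n₂ → rank n₁ + rank n₂ < rank n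

variable {code}

/-- The potential of a configuration with respect to a rank function. -/
def Rank.pot (ρ : Rank code) (c : Conf K A N) : ℕ :=
  -- The factor exceeds every rank, so the loss of one bit outweighs a jump to an arbitrary node.
  (ρ.max + 1) * c.bits.length + ρ.rank c.cur + (c.rets.map ρ.rank).sum

omit [Fintype K] [Inhabited A] in
theorem Rank.pot_next_lt (ρ : Rank code) {c c' : Conf K A N} (h : next code c = .inl c') :
    ρ.pot c' < ρ.pot c := by
  unfold next at h
  cases hc : code c.cur with
  | ret =>
    rw [hc] at h
    have := ρ.ret _ hc
    cases hr : c.rets <;> simp only [hr] at h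
    · simp at h
    · cases h; simp [Rank.pot, hr]; omega
  | fail => simp [hc] at h
  | op o n =>
    rw [hc] at h
    have := ρ.op _ _ _ hc
    cases ho : o.run c.stk with
    | none => simp [ho] at h
    | some s => simp only [ho] at h; cases h; simp [Rank.pot]; omega
  | call n₁ n₂ =>
    have := ρ.call _ _ _ hc
    rw [hc] at h; cases h; simp [Rank.pot]; omega
  | choose n₁ n₂ =>
    rw [hc] at h
    cases hr : c.bits with
    | nil => simp [hr] at h
    | cons b bs =>
      simp only [hr] at h; cases h
      have := ρ.le_max (if b then n₁ else n₂)
      simp only [Rank.pot, hr, List.length_cons, mul_add]; omega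

/-- At most `p` steps of the flow graph are simulated, each of which raises the total height by at
most one. Cleaning then costs at most one step per unit of the final height, which explains the
factor 2. -/
theorem runsTo_verdict (ρ : Rank code) (p : ℕ) (c : Conf K A N) (v : Var A N)
    (hp : ρ.pot c ≤ p) : ∃ n ≤ 2 * p + c.size + 2, ∃ b : Bool, (b = true ↔ Accepts code c) ∧
      RunsTo (machine code k₀ n₀) n (c.toCfg v)
        ⟨none, var₀, Function.update (fun _ => []) .output [b]⟩ := by
  induction p using Nat.strong_induction_on generalizing c v with
  | _ p ih =>
    cases h : next code c with
    | inl c' =>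
      have hlt := ρ.pot_next_lt h
      obtain ⟨v', hv'⟩ := step_machine_inl code k₀ n₀ h v
      obtain ⟨n, hn, b, hb, H⟩ := ih (ρ.pot c') (by omega) c' v' le_rfl
      have hs := size_next_le code h
      exact ⟨n + 1, by omega, b, by rw [hb, accepts_iff_of_next_inl h], .step hv' H⟩
    | inr b =>
      obtain ⟨v', S', hv', hS'⟩ := step_machine_inr code k₀ n₀ h v
      obtain ⟨n, hn, H⟩ := runsTo_clean code k₀ n₀ b c.size v' S' hS'
      exact ⟨n + 1, by omega, b, by rw [accepts_iff_of_next_inr h], .step hv' H⟩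

/-- The initial configuration on the input `x` with the choice bits `y`. -/
def initConf (k₀ : K) (n₀ : N) (x : List A) (y : List Bool) : Conf K A N :=
  ⟨n₀, [], y, Function.update (fun _ => []) k₀ x.reverse⟩

/-- The accumulator `l` makes the induction work. The loop takes one step per letter, and a last one
that notices the first bit or the end of the input. -/
theorem runsTo_load (x : List A) (y : List Bool) (l : List A) (v : Var A N) :
    ∃ v', RunsTo (machine code k₀ n₀) (x.length + 1)
      ⟨some .load, v, contents (x.map .inl ++ y.map .inr) [] (Function.update (fun _ => []) k₀ l)⟩
      (Conf.toCfg ⟨n₀, [], y, Function.update (fun _ => []) k₀ (x.reverse ++ l)⟩ v') := by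
  induction x generalizing l v with
  | nil =>
    cases y with
    | nil => exact ⟨_, RunsTo.step (n := 0) (by simp [machine, contents, TM2.step]; rfl) rfl⟩
    | cons b y =>
      exact ⟨_, RunsTo.step (n := 0) (by simp [machine, contents, TM2.step]; rfl) rfl⟩
  | cons a x ih =>
    obtain ⟨v', H⟩ := ih (a :: l) (some (.inl a), v.2)
    refine ⟨v', RunsTo.step (c₁ := _) ?_ (by simpa using H)⟩
    simp [machine, contents, TM2.step]

-- Loading, simulation and cleaning together are linear in the length of the input and the witness,
-- because the initial potential is at most `(ρ.max + 1) * y.length + ρ.max`. So every flow graph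
-- with a rank function runs in polynomial time, whatever it computes.
open Classical in
theorem nonempty_computableInPolyTime [Fintype A] [Fintype N] (ρ : Rank code) (k₀ : K) (n₀ : N) :
    Nonempty (TM2ComputableInPolyTime
      (Computability.encodingProd (Computability.encodingList A)
        (Computability.encodingList Bool)).encode
      Computability.encodingBoolBool.encode
      fun xy : List A × List Bool => decide (Accepts code (initConf k₀ n₀ xy.1 xy.2))) := by
  let tm : FinTM2 :=
    { K := Stk K, k₀ := .input, k₁ := .output, Γ := Alph K A N, Λ := Lab N, main := .load
      σ := Var A N, initialState := var₀
      Γk₀Fin := inferInstanceAs (Fintype (A ⊕ Bool))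
      m := machine code k₀ n₀ }
  have key : ∀ (x : List A) (y : List Bool), ∃ n ≤ (2 * ρ.max + 5) * (x.length + y.length) +
      2 * ρ.max + 3,
      (flip bind tm.step)^[n] (some (initList tm (x.map .inl ++ y.map .inr))) =
        some (haltList tm [decide (Accepts code (initConf k₀ n₀ x y))]) := by
    intro x y
    obtain ⟨v', H⟩ := runsTo_load (code := code) k₀ n₀ x y [] var₀
    rw [List.append_nil] at H
    obtain ⟨n, hn, b, hb, H'⟩ := runsTo_verdict k₀ n₀ ρ _ (initConf k₀ n₀ x y) v' le_rfl
    have hb' : b = decide (Accepts code (initConf k₀ n₀ x y)) := by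
      rw [Bool.eq_iff_iff, hb, decide_eq_true_iff]
    have hsize : (initConf (N := N) k₀ n₀ x y).size ≤ x.length + y.length := by
      have := sum_length_update_le (fun _ : K => ([] : List A)) k₀ x.reverse (m := x.length)
        (by simp)
      simp only [List.length_nil, Finset.sum_const_zero, zero_add] at this
      simp only [initConf, Conf.size, List.length_nil]
      omega
    have hpot : ρ.pot (initConf k₀ n₀ x y) ≤ (ρ.max + 1) * y.length + ρ.max := by
      have := ρ.le_max n₀
      simp only [initConf, Rank.pot, List.map_nil, List.sum_nil]
      omega
    refine ⟨n + (x.length + 1), ?_, ?_⟩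
    · have : 0 ≤ ρ.max * x.length := Nat.zero_le _
      nlinarith
    · have h0 : initList tm (x.map .inl ++ y.map .inr) = ⟨some .load, var₀,
          contents (x.map .inl ++ y.map .inr) [] (Function.update (fun _ => []) k₀ [])⟩ := by
        simp only [initList, tm]
        congr 1
        funext k
        cases k with
        | data k => by_cases h : k = k₀ <;> simp [contents, Function.update]
        | _ => rfl
      have h1 : haltList tm [decide (Accepts code (initConf k₀ n₀ x y))] = ⟨none, var₀,
          Function.update (fun _ => []) .output [b]⟩ := by
        simp only [haltList, tm, hb']
        congr 1
        funext k
        cases k <;> rfl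
      rw [h0, h1, Function.iterate_add_apply]
      unfold RunsTo at H H'
      refine (congrArg _ H).trans H'
  choose f hf hf' using key
  refine ⟨{ tm := tm, inputAlphabet := Equiv.refl _, outputAlphabet := Equiv.refl _
            time := Polynomial.C (2 * ρ.max + 5) * Polynomial.X + Polynomial.C (2 * ρ.max + 3)
            outputsFun := ?_ }⟩
  rintro ⟨x, y⟩
  refine ⟨⟨f x y, ?_⟩, ?_⟩
  · have := hf' x y
    have h0 : List.map (Equiv.refl (A ⊕ Bool)).invFun (x.map .inl ++ y.map .inr) =
        x.map .inl ++ y.map .inr := List.map_id _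
    exact (congrArg (fun l => (flip bind tm.step)^[f x y] (some (initList tm l))) h0).trans this
  · have := hf x y
    simp only [Polynomial.eval_add, Polynomial.eval_mul, Polynomial.eval_C, Polynomial.eval_X,
      Computability.encodingProd, Computability.encodingList, List.length_append, List.length_map,
      id]
    omega

end StackMachine

/-! ## Nondeterministic stack programs with procedures -/

namespace StackMachine

variable {K A F : Type} [DecidableEq K] [DecidableEq A]

/-- An instruction: an elementary operation or a procedure call. -/
inductive Instr (K A F : Type)
  | op (o : Op K A)
  | call (f : F)

/-- A program assigns to every procedure name its alternative bodies. -/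
abbrev Prog (K A F : Type) : Type := F → List (List (Instr K A F))

/-- `Exec P l s n s'`: the instructions `l` can transform the stacks `s` into `s'` with `n`
calls. -/
inductive Exec (P : Prog K A F) : List (Instr K A F) → (K → List A) → ℕ → (K → List A) → Prop
  | nil {s} : Exec P [] s 0 s
  | op {o l s s₁ n s'} : o.run s = some s₁ → Exec P l s₁ n s' → Exec P (.op o :: l) s n s'
  | call {f b l s n s'} : b ∈ P f → Exec P (b ++ l) s n s' → Exec P (.call f :: l) s (n + 1) s'

namespace Prog

variable (P : Prog K A F)

/-- The control points of a program: a rest of a body, or a list of remaining alternatives. -/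
def Node : Type :=
  {l : List (Instr K A F) // ∃ f, ∃ b ∈ P f, l <:+ b} ⊕ {L // ∃ f, L <:+ P f}

instance [Finite F] : Finite P.Node := by
  have h1 : {l : List (Instr K A F) | ∃ f, ∃ b ∈ P f, l <:+ b}.Finite := by
    have : {l : List (Instr K A F) | ∃ f, ∃ b ∈ P f, l <:+ b} =
        ⋃ f, ⋃ b ∈ {b | b ∈ P f}, {l | l ∈ b.tails} := by
      ext l; simp
    rw [this]
    exact Set.finite_iUnion fun f => (List.finite_toSet (P f)).biUnion fun b _ =>
      List.finite_toSet b.tails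
  have h2 : {L | ∃ f, L <:+ P f}.Finite := by
    have : {L | ∃ f, L <:+ P f} = ⋃ f, {L | L ∈ (P f).tails} := by
      ext l; simp
    rw [this]
    exact Set.finite_iUnion fun f => List.finite_toSet (P f).tails
  have : Finite {l : List (Instr K A F) // ∃ f, ∃ b ∈ P f, l <:+ b} := h1.to_subtype
  have : Finite {L // ∃ f, L <:+ P f} := h2.to_subtype
  exact inferInstanceAs (Finite (_ ⊕ _))

/-- The flow graph of a program. -/
def flow : P.Node → Code K A P.Node
  | .inl ⟨[], _⟩ => .ret
  | .inl ⟨.op o :: l, h⟩ => .op o <| .inl ⟨l, by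
      obtain ⟨f, b, hb, h⟩ := h; exact ⟨f, b, hb, (List.suffix_cons _ _).trans h⟩⟩
  | .inl ⟨.call f :: l, h⟩ => .call (.inr ⟨P f, f, List.suffix_rfl⟩) <| .inl ⟨l, by
      obtain ⟨f, b, hb, h⟩ := h; exact ⟨f, b, hb, (List.suffix_cons _ _).trans h⟩⟩
  | .inr ⟨[], _⟩ => .fail
  -- The bit `true` enters the first alternative and `false` passes on to the others, so selecting
  -- an alternative takes at most as many bits as there are alternatives.
  | .inr ⟨b :: L, h⟩ => .choose
      (.inl ⟨b, by obtain ⟨f, h⟩ := h; exact ⟨f, b, h.subset (by simp), List.suffix_rfl⟩⟩)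
      (.inr ⟨L, by obtain ⟨f, h⟩ := h; exact ⟨f, (List.suffix_cons _ _).trans h⟩⟩)

/-- The rank of a control point. -/
def nodeRank : P.Node → ℕ
  -- An elementary operation lowers this value by 2, and so does a call, since the list of
  -- alternatives that it enters has rank 0. The summand 1 pays for the return.
  | .inl l => 2 * l.1.length + 1
  | .inr _ => 0

omit [DecidableEq K] [DecidableEq A] in
theorem exists_rank [Finite F] : Nonempty (Rank P.flow) := by
  obtain ⟨m, hm⟩ := (Set.finite_range P.nodeRank).bddAbove
  refine ⟨⟨P.nodeRank, m, fun n => hm ⟨n, rfl⟩, ?_, ?_, ?_⟩⟩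
  · rintro (⟨_ | ⟨_ | _, _⟩, _⟩ | ⟨_ | _, _⟩) h <;> simp_all [flow, nodeRank]
  · rintro (⟨_ | ⟨_ | _, _⟩, _⟩ | ⟨_ | _, _⟩) o n' h <;> simp [flow] at h
    obtain ⟨rfl, rfl⟩ := h
    simp [nodeRank]
  · rintro (⟨_ | ⟨_ | _, _⟩, _⟩ | ⟨_ | _, _⟩) n₁ n₂ h <;> simp [flow] at h
    obtain ⟨rfl, rfl⟩ := h
    simp [nodeRank]

/-- The instructions that a list of return addresses stands for. -/
def pending : List P.Node → List (Instr K A F)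
  | [] => []
  | .inl l :: r => l.1 ++ pending r
  | .inr _ :: r => pending r

/-- Induction on the accepting run. The stack of return addresses is read as the list of
instructions still to be executed, so that a return is no step of `Exec` at all. Lists of
alternatives never occur as return addresses, which the hypothesis `hr` records. -/
theorem exec_of_accepts {c : Conf K A P.Node} (h : Accepts P.flow c)
    (hr : ∀ n ∈ c.rets, n.isLeft) :
    match c.cur with
    | .inl l => ∃ n s', Exec P (l.1 ++ P.pending c.rets) c.stk n s'
    | .inr L => ∃ b ∈ L.1, ∃ n s', Exec P (b ++ P.pending c.rets) c.stk n s' := by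
  induction h with
  | @halt c h =>
    obtain ⟨cur, rets, bits, stk⟩ := c
    obtain (⟨_ | ⟨_ | _, _⟩, _⟩ | ⟨_ | _, _⟩) := cur
    · cases rets with
      | nil => exact ⟨_, _, .nil⟩
      | cons n r => simp [next, flow] at h
    · simp only [next, flow] at h; split at h <;> simp at h
    · simp [next, flow] at h
    · simp [next, flow] at h
    · simp only [next, flow] at h; split at h <;> simp at h
  | @step c c' h H ih =>
    obtain ⟨cur, rets, bits, stk⟩ := c
    obtain (⟨_ | ⟨_ | _, _⟩, _⟩ | ⟨_ | _, _⟩) := cur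
    · cases rets with
      | nil => simp [next, flow] at h
      | cons n r =>
        simp [next, flow] at h
        subst h
        obtain l | L := n
        · exact ih fun n hn => hr n (List.mem_cons_of_mem _ hn)
        · simpa using hr (.inr L) List.mem_cons_self
    · simp only [next, flow] at h
      split at h
      · simp at h
      · next s hs =>
        simp at h; subst h
        obtain ⟨n, s', H⟩ := ih hr
        exact ⟨n, s', .op hs H⟩
    · simp [next, flow] at h
      subst h
      obtain ⟨b, hb, n, s', H⟩ := ih fun n hn => by
        rcases List.mem_cons.1 hn with rfl | hn
        · rfl
        · exact hr n hn
      exact ⟨n + 1, s', .call hb H⟩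
    · simp [next, flow] at h
    · simp only [next, flow] at h
      cases bits with
      | nil => simp at h
      | cons b bs =>
        simp at h
        subst h
        cases b with
        | true =>
          obtain ⟨n, s', H⟩ := ih hr
          exact ⟨_, List.mem_cons_self, n, s', H⟩
        | false =>
          obtain ⟨b, hb, n, s', H⟩ := ih hr
          exact ⟨b, List.mem_cons_of_mem _ hb, n, s', H⟩

theorem accepts_alts {b : List (Instr K A F)} {L : List (List (Instr K A F))} (hb : b ∈ L)
    (hL : ∃ f, L <:+ P f) (hb' : ∃ f, ∃ b' ∈ P f, b <:+ b') : ∃ y : List Bool, y.length ≤ L.length ∧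
    ∀ rets bits stk, Accepts P.flow ⟨.inl ⟨b, hb'⟩, rets, bits, stk⟩ →
      Accepts P.flow ⟨.inr ⟨L, hL⟩, rets, y ++ bits, stk⟩ := by
  induction L with
  | nil => simp at hb
  | cons b₁ L ih =>
    rcases List.mem_cons.1 hb with rfl | hb
    · exact ⟨[true], by simp, fun rets bits stk H => .step rfl H⟩
    · obtain ⟨f, hf⟩ := hL
      obtain ⟨y, hy, H⟩ := ih hb ⟨f, (List.suffix_cons _ _).trans hf⟩
      exact ⟨false :: y, by simpa using hy,
        fun rets bits stk h => Accepts.step rfl (H rets bits stk h)⟩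

/-- `Exec` sees only the concatenation of the current rest of a body with everything pending. Hence
the same bits must work for every way to split `l` into a rest of a body and a stack of return
addresses. Each call contributes at most `M` bits, by `accepts_alts`. -/
theorem accepts_of_exec {l : List (Instr K A F)} {s s' : K → List A} {n M : ℕ}
    (hM : ∀ f, (P f).length ≤ M) (h : Exec P l s n s') :
    ∃ y : List Bool, y.length ≤ M * n ∧ ∀ l₁ hl₁ rets, (∀ n ∈ rets, n.isLeft) →
      l₁ ++ P.pending rets = l → Accepts P.flow ⟨.inl ⟨l₁, hl₁⟩, rets, y, s⟩ := by
  -- It suffices to treat splittings whose current rest of a body is nonempty: an empty one is left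
  -- by a return, which consumes no bits, and this is repeated down the stack of return addresses.
  have aux : ∀ (l : List (Instr K A F)) (s : K → List A) (y : List Bool), (∀ i l₁ hl₁ rets,
      (∀ n ∈ rets, n.isLeft) → i :: l₁ ++ P.pending rets = l →
      Accepts P.flow ⟨.inl ⟨i :: l₁, hl₁⟩, rets, y, s⟩) → l ≠ [] → ∀ l₁ hl₁ rets,
      (∀ n ∈ rets, n.isLeft) → l₁ ++ P.pending rets = l →
      Accepts P.flow ⟨.inl ⟨l₁, hl₁⟩, rets, y, s⟩ := by
    intro l s y H hne l₁ hl₁ rets hr hl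
    induction rets generalizing l₁ with
    | nil =>
      cases l₁ with
      | nil => simp [pending] at hl; exact absurd hl hne
      | cons i l₁ => exact H _ _ _ _ hr hl
    | cons n r ih =>
      cases l₁ with
      | nil =>
        obtain n | n := n
        · exact .step rfl (ih n.1 n.2 (fun m hm => hr m (List.mem_cons_of_mem _ hm)) hl)
        · simpa using hr _ List.mem_cons_self
      | cons i l₁ => exact H _ _ _ _ hr hl
  induction h with
  | nil =>
    refine ⟨[], by simp, fun l₁ hl₁ rets hr hl => ?_⟩
    induction rets generalizing l₁ with
    | nil =>
      simp [pending] at hl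
      subst hl
      exact .halt rfl
    | cons n r ih =>
      simp at hl
      obtain ⟨rfl, hl⟩ := hl
      obtain n | n := n
      · exact .step rfl (ih n.1 n.2 (fun m hm => hr m (List.mem_cons_of_mem _ hm)) hl)
      · simpa using hr _ List.mem_cons_self
  | @op o l s s₁ n s' hs H ih =>
    obtain ⟨y, hy, ih⟩ := ih
    refine ⟨y, hy, aux _ _ _ ?_ (by simp)⟩
    intro i l₁ hl₁ rets hr hl
    simp at hl
    obtain ⟨rfl, rfl⟩ := hl
    have hl₁' : ∃ f, ∃ b ∈ P f, l₁ <:+ b := by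
      obtain ⟨f, b, hb, h⟩ := hl₁
      exact ⟨f, b, hb, (List.suffix_cons _ _).trans h⟩
    exact .step (c' := ⟨.inl ⟨l₁, hl₁'⟩, rets, y, s₁⟩) (by simp only [next, flow, hs])
      (ih _ _ _ hr rfl)
  | @call f b l s n s' hb H ih =>
    obtain ⟨y, hy, ih⟩ := ih
    obtain ⟨y', hy', H'⟩ := P.accepts_alts hb ⟨f, List.suffix_rfl⟩ ⟨f, b, hb, List.suffix_rfl⟩
    refine ⟨y' ++ y, ?_, aux _ _ _ ?_ (by simp)⟩
    · have := hM f
      simp only [List.length_append, mul_add]; omega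
    intro i l₁ hl₁ rets hr hl
    simp at hl
    obtain ⟨rfl, rfl⟩ := hl
    refine .step rfl (H' _ _ _ (ih _ _ _ ?_ rfl))
    intro m hm
    rcases List.mem_cons.1 hm with rfl | hm
    · rfl
    · exact hr m hm

end Prog

/-- A language is in NP if it is accepted by a stack program with polynomially many calls. -/
theorem inNP_of_exec [Fintype K] [Fintype A] [Inhabited A] [Finite F] (P : Prog K A F) (f : F)
    (k₀ : K) (c : Polynomial ℕ) (L : Set (List A))
    (hsound : ∀ x n s', Exec P [.call f] (Function.update (fun _ => []) k₀ x.reverse) n s' → x ∈ L)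
    (hcomplete : ∀ x ∈ L, ∃ n ≤ c.eval x.length, ∃ s',
      Exec P [.call f] (Function.update (fun _ => []) k₀ x.reverse) n s') :
    XPathDTD.InNP L := by
  classical
  obtain ⟨ρ⟩ := P.exists_rank
  obtain ⟨M, hM⟩ : ∃ M, ∀ f, (P f).length ≤ M := by
    obtain ⟨m, hm⟩ := (Set.finite_range fun f => (P f).length).bddAbove
    exact ⟨m, fun f => hm ⟨f, rfl⟩⟩
  have : Fintype P.Node := Fintype.ofFinite _
  refine ⟨Polynomial.C M * c, _, nonempty_computableInPolyTime ρ k₀ (.inr ⟨P f, f,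
    List.suffix_rfl⟩),
    fun x => ?_⟩
  simp only [decide_eq_true_iff, Polynomial.eval_mul, Polynomial.eval_C]
  constructor
  · intro hx
    obtain ⟨n, hn, s', H⟩ := hcomplete x hx
    cases H with
    | @call _ b _ _ n _ hb H =>
      obtain ⟨y, hy, H⟩ := P.accepts_of_exec hM H
      obtain ⟨y', hy', H'⟩ := P.accepts_alts hb ⟨f, List.suffix_rfl⟩ ⟨f, b, hb, List.suffix_rfl⟩
      refine ⟨y' ++ y, ?_, H' _ _ _ (H _ _ _ (by simp) (by simp [Prog.pending]))⟩
      have := hM f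
      have := Nat.mul_le_mul_left M hn
      rw [mul_add] at this
      simp only [List.length_append]; omega
  · rintro ⟨y, -, H⟩
    obtain ⟨b, hb, n, s', H⟩ := P.exec_of_accepts H (by simp [initConf])
    exact hsound x (n + 1) s' (.call hb H)

end StackMachine

/-! ## Reading encodings from left to right -/

namespace XPathDTD

/-- The syntactic categories of the encoding. -/
inductive Cat
  | label
  | regex
  | rules
  | xpath
  | filters
  deriving DecidableEq

instance : Fintype Cat :=
  ⟨{.label, .regex, .rules, .xpath, .filters}, by intro n; cases n <;> simp⟩

open Cat in
/-- The categories that follow after the first symbol of a word of a given category. -/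
def expand : Cat → Sym → Option (List Cat)
  | label, .bit _ => some [label]
  | label, .sep => some []
  | regex, .zero => some []
  | regex, .epsilon => some []
  | regex, .char => some [label]
  | regex, .plus => some [regex, regex]
  | regex, .cat => some [regex, regex]
  | regex, .star => some [regex]
  | rules, .done => some []
  | rules, .more => some [label, regex, rules]
  | xpath, .self => some [label, filters]
  | xpath, .child => some [label, filters]
  | xpath, .slash => some [xpath, xpath]
  | filters, .done => some []
  | filters, .more => some [xpath, filters]
  | _, _ => none

/-- `Reads ns v`: the word `v` is a sequence of words of the categories `ns`. -/
inductive Reads : List Cat → List Sym → Prop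
  | nil : Reads [] []
  | cons {n c ns ms v} : expand n c = some ns → Reads (ns ++ ms) v → Reads (n :: ms) (c :: v)

theorem Reads.append {a b : List Cat} {u v : List Sym} (hu : Reads a u) (hv : Reads b v) :
    Reads (a ++ b) (u ++ v) := by
  induction hu with
  | nil => exact hv
  | cons h _ ih => exact .cons h (by simpa using ih)

theorem Reads.split {m : List Cat} {w : List Sym} (h : Reads m w) :
    ∀ {a b}, m = a ++ b → ∃ u v, w = u ++ v ∧ Reads a u ∧ Reads b v := by
  induction h with
  | nil =>
    intro a b hm
    obtain ⟨rfl, rfl⟩ := List.append_eq_nil_iff.1 hm.symm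
    exact ⟨[], [], rfl, .nil, .nil⟩
  | @cons n c ns ms v hn hv ih =>
    intro a b hm
    cases a with
    | nil => exact ⟨[], c :: v, rfl, .nil, by rw [List.nil_append] at hm; exact hm ▸ .cons hn hv⟩
    | cons n' a =>
      simp only [List.cons_append, List.cons.injEq] at hm
      obtain ⟨rfl, rfl⟩ := hm
      obtain ⟨u, v', rfl, h1, h2⟩ := ih (a := ns ++ a) (b := b) (by simp)
      exact ⟨c :: u, v', rfl, .cons hn h1, h2⟩

/-- The first symbol of a word determines the production that is used, so the words of given
categories form a prefix code. -/
theorem Reads.unique {a : List Cat} {u u' r r' : List Sym} (h : Reads a u) (h' : Reads a u')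
    (e : u ++ r = u' ++ r') : u = u' ∧ r = r' := by
  induction h generalizing u' with
  | nil => cases h'; exact ⟨rfl, e⟩
  | cons hn _ ih =>
    cases h' with
    | cons hn' hv' =>
      simp only [List.cons_append, List.cons.injEq] at e
      obtain ⟨rfl, e⟩ := e
      rw [hn] at hn'
      cases hn'
      obtain ⟨rfl, rfl⟩ := ih hv' e
      exact ⟨rfl, rfl⟩

theorem Reads.cons_split {n : Cat} {ms : List Cat} {w : List Sym} (h : Reads (n :: ms) w) :
    ∃ u v, w = u ++ v ∧ Reads [n] u ∧ Reads ms v :=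
  h.split (a := [n]) rfl

theorem reads_label (a : Label) : Reads [.label] (encLabel a) := by
  induction a with
  | nil => exact .cons rfl .nil
  | cons b a ih => exact .cons rfl ih

theorem reads_regex (r : RegularExpression Label) : Reads [.regex] (encRegex r) := by
  induction r with
  | zero => exact .cons rfl .nil
  | epsilon => exact .cons rfl .nil
  | char a => exact .cons rfl (reads_label a)
  | plus r s hr hs => exact .cons rfl (hr.append hs)
  | comp r s hr hs => exact .cons rfl (hr.append hs)
  | star r hr => exact .cons rfl hr

theorem reads_rules (ρs : List (Label × RegularExpression Label)) :
    Reads [.rules] (encRules ρs) := by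
  induction ρs with
  | nil => exact .cons rfl .nil
  | cons ρ ρs ih =>
    refine .cons rfl ?_
    rw [List.append_assoc]
    exact (reads_label _).append ((reads_regex _).append ih)

mutual
theorem reads_xpath : ∀ p : XPath, Reads [.xpath] (encXPath p)
  | .step ax a es => by
    rw [encXPath]
    cases ax
    · exact .cons rfl ((reads_label a).append (reads_filters es))
    · exact .cons rfl ((reads_label a).append (reads_filters es))
  | .comp p q => by
    rw [encXPath]
    exact .cons rfl ((reads_xpath p).append (reads_xpath q))
theorem reads_filters : ∀ es : List XPath, Reads [.filters] (encFilters es)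
  | [] => by
    rw [encFilters]
    exact .cons rfl .nil
  | e :: es => by
    rw [encFilters]
    exact .cons rfl ((reads_xpath e).append (reads_filters es))
end

/-- The encodings of the objects of a category. -/
def Encodes : Cat → List Sym → Prop
  | .label, v => ∃ a, v = encLabel a
  | .regex, v => ∃ r, v = encRegex r
  | .rules, v => ∃ ρs, v = encRules ρs
  | .xpath, v => ∃ p, v = encXPath p
  | .filters, v => ∃ es, v = encFilters es

/-- The induction is on the length and not on `Reads`, because an expansion leaves up to three
consecutive parts, each of which is a shorter word of a single category. -/
theorem Reads.encodes_aux (k : ℕ) : ∀ {n : Cat} {v : List Sym}, v.length ≤ k → Reads [n] v →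
    Encodes n v := by
  induction k with
  | zero =>
    intro n v hv h
    cases h
    simp at hv
  | succ k ih =>
    intro n v hv h
    cases h with
    | @cons _ c ns _ v hn h =>
      rw [List.append_nil] at h
      simp only [List.length_cons, Nat.add_le_add_iff_right] at hv
      have one {n : Cat} (h : Reads [n] v) : Encodes n v := ih hv h
      have two {n n' : Cat} (h : Reads [n, n'] v) :
          ∃ u u', v = u ++ u' ∧ Encodes n u ∧ Encodes n' u' := by
        obtain ⟨u, u', rfl, h1, h2⟩ := h.cons_split
        rw [List.length_append] at hv
        exact ⟨u, u', rfl, ih (by omega) h1, ih (by omega) h2⟩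
      have three {n n' n'' : Cat} (h : Reads [n, n', n''] v) : ∃ u u' u'', v = u ++ u' ++ u'' ∧
          Encodes n u ∧ Encodes n' u' ∧ Encodes n'' u'' := by
        obtain ⟨u, w, rfl, h1, h⟩ := h.cons_split
        obtain ⟨u', u'', rfl, h2, h3⟩ := h.cons_split
        simp only [List.length_append] at hv
        exact ⟨u, u', u'', by simp, ih (by omega) h1, ih (by omega) h2, ih (by omega) h3⟩
      cases n <;> cases c <;> simp only [expand, reduceCtorEq, Option.some.injEq] at hn <;> subst hn
      · obtain ⟨a, rfl⟩ := one h
        exact ⟨_ :: a, rfl⟩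
      · cases h; exact ⟨[], rfl⟩
      · cases h; exact ⟨.zero, rfl⟩
      · cases h; exact ⟨.epsilon, rfl⟩
      · obtain ⟨a, rfl⟩ := one h
        exact ⟨.char a, rfl⟩
      · obtain ⟨_, _, rfl, ⟨r, rfl⟩, ⟨s, rfl⟩⟩ := two h
        exact ⟨.plus r s, rfl⟩
      · obtain ⟨_, _, rfl, ⟨r, rfl⟩, ⟨s, rfl⟩⟩ := two h
        exact ⟨.comp r s, rfl⟩
      · obtain ⟨r, rfl⟩ := one h
        exact ⟨.star r, rfl⟩
      · obtain ⟨_, _, _, rfl, ⟨a, rfl⟩, ⟨r, rfl⟩, ⟨ρs, rfl⟩⟩ := three h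
        exact ⟨(a, r) :: ρs, rfl⟩
      · cases h; exact ⟨[], rfl⟩
      · obtain ⟨_, _, rfl, ⟨a, rfl⟩, ⟨es, rfl⟩⟩ := two h
        exact ⟨.step .self a es, by simp [encXPath, encAxis]⟩
      · obtain ⟨_, _, rfl, ⟨a, rfl⟩, ⟨es, rfl⟩⟩ := two h
        exact ⟨.step .child a es, by simp [encXPath, encAxis]⟩
      · obtain ⟨_, _, rfl, ⟨p, rfl⟩, ⟨q, rfl⟩⟩ := two h
        exact ⟨.comp p q, by simp [encXPath]⟩
      · obtain ⟨_, _, rfl, ⟨e, rfl⟩, ⟨es, rfl⟩⟩ := two h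
        exact ⟨e :: es, by simp [encFilters]⟩
      · cases h; exact ⟨[], by simp [encFilters]⟩

theorem Reads.encodes {n : Cat} {v : List Sym} (h : Reads [n] v) : Encodes n v :=
  Reads.encodes_aux _ le_rfl h

/-- The word for an instance in which the conditions on DTDs need not hold. -/
def encRaw (a : Label) (ρs : List (Label × RegularExpression Label)) (p q : XPath) : List Sym :=
  encLabel a ++ encRules ρs ++ encXPath p ++ encXPath q

/-- The grammar captures exactly the words of the right syntactic form. The conditions on the rules
of a DTD are not a matter of syntax and are tested separately. -/
theorem reads_instance_iff {w : List Sym} :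
    Reads [.label, .rules, .xpath, .xpath] w ↔ ∃ a ρs p q, w = encRaw a ρs p q := by
  constructor
  · intro h
    obtain ⟨u₁, w, rfl, h1, h⟩ := h.cons_split
    obtain ⟨u₂, w, rfl, h2, h⟩ := h.cons_split
    obtain ⟨u₃, u₄, rfl, h3, h4⟩ := h.cons_split
    obtain ⟨a, rfl⟩ := h1.encodes
    obtain ⟨ρs, rfl⟩ := h2.encodes
    obtain ⟨p, rfl⟩ := h3.encodes
    obtain ⟨q, rfl⟩ := h4.encodes
    exact ⟨a, ρs, p, q, by simp [encRaw]⟩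
  · rintro ⟨a, ρs, p, q, rfl⟩
    rw [encRaw]
    exact (((reads_label a).append (reads_rules ρs)).append (reads_xpath p)).append (reads_xpath q)

end XPathDTD

/-! ## The program -/

-- Execution rules for single instructions and for concatenations.

namespace StackMachine

variable {K A F : Type} [DecidableEq K] [DecidableEq A] {P : Prog K A F}

theorem exec_nil_iff {s s' : K → List A} {n : ℕ} : Exec P [] s n s' ↔ n = 0 ∧ s' = s := by
  constructor
  · rintro ⟨⟩; exact ⟨rfl, rfl⟩
  · rintro ⟨rfl, rfl⟩; exact .nil

theorem exec_pop_iff {k : K} {a : A} {l : List (Instr K A F)} {s s' : K → List A} {n : ℕ} :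
    Exec P (.op (.pop k a) :: l) s n s' ↔
      ∃ r, s k = a :: r ∧ Exec P l (Function.update s k r) n s' := by
  constructor
  · intro h
    cases h with
    | op h H =>
      simp only [Op.run] at h
      split at h
      · next ha =>
        cases h
        obtain ⟨r, hr⟩ : ∃ r, s k = a :: r := by
          cases hs : s k with
          | nil => simp [hs] at ha
          | cons c r => simp [hs] at ha; exact ⟨r, by rw [ha]⟩
        exact ⟨r, hr, by simpa [hr] using H⟩
      · simp at h
  · rintro ⟨r, hr, H⟩
    exact .op (by simp [Op.run, hr]) H

theorem exec_push_iff {k : K} {a : A} {l : List (Instr K A F)} {s s' : K → List A} {n : ℕ} :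
    Exec P (.op (.push k a) :: l) s n s' ↔ Exec P l (Function.update s k (a :: s k)) n s' := by
  constructor
  · intro h
    cases h with
    | op h H => cases h; exact H
  · exact .op rfl

theorem exec_empty_iff {k : K} {l : List (Instr K A F)} {s s' : K → List A} {n : ℕ} :
    Exec P (.op (.empty k) :: l) s n s' ↔ s k = [] ∧ Exec P l s n s' := by
  constructor
  · intro h
    cases h with
    | op h H =>
      simp only [Op.run] at h
      split at h
      · next hk => cases h; exact ⟨hk, H⟩
      · simp at h
  · rintro ⟨hk, H⟩
    exact .op (by simp [Op.run, hk]) H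

theorem exec_call_iff {f : F} {l : List (Instr K A F)} {s s' : K → List A} {n : ℕ} :
    Exec P (.call f :: l) s n s' ↔ ∃ m, n = m + 1 ∧ ∃ b ∈ P f, Exec P (b ++ l) s m s' := by
  constructor
  · intro h
    cases h with
    | call hb H => exact ⟨_, rfl, _, hb, H⟩
  · rintro ⟨m, rfl, b, hb, H⟩
    exact .call hb H

theorem exec_append_iff {l₁ l₂ : List (Instr K A F)} {s s' : K → List A} {n : ℕ} :
    Exec P (l₁ ++ l₂) s n s' ↔
      ∃ n₁ n₂ s₁, n = n₁ + n₂ ∧ Exec P l₁ s n₁ s₁ ∧ Exec P l₂ s₁ n₂ s' := by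
  constructor
  · generalize hl : l₁ ++ l₂ = l
    intro h
    induction h generalizing l₁ with
    | nil =>
      obtain ⟨rfl, rfl⟩ := List.append_eq_nil_iff.1 hl
      exact ⟨0, 0, _, rfl, .nil, .nil⟩
    | @op o l s s₁ n s' hs H ih =>
      cases l₁ with
      | nil => exact ⟨0, n, s, by simp, .nil, by rw [List.nil_append] at hl; exact hl ▸ .op hs H⟩
      | cons i l₁ =>
        simp only [List.cons_append, List.cons.injEq] at hl
        obtain ⟨rfl, rfl⟩ := hl
        obtain ⟨n₁, n₂, s₂, rfl, h1, h2⟩ := ih rfl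
        exact ⟨n₁, n₂, s₂, rfl, .op hs h1, h2⟩
    | @call f b l s n s' hb H ih =>
      cases l₁ with
      | nil =>
        exact ⟨0, n + 1, s, by simp, .nil, by rw [List.nil_append] at hl; exact hl ▸ .call hb H⟩
      | cons i l₁ =>
        simp only [List.cons_append, List.cons.injEq] at hl
        obtain ⟨rfl, rfl⟩ := hl
        obtain ⟨n₁, n₂, s₂, rfl, h1, h2⟩ := ih (List.append_assoc _ _ _)
        exact ⟨n₁ + 1, n₂, s₂, by omega, .call hb h1, h2⟩
  · rintro ⟨n₁, n₂, s₁, rfl, h1, h2⟩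
    induction h1 with
    | nil => simpa using h2
    | op hs _ ih => exact .op hs (ih h2)
    | @call f b l s n s' hb _ ih =>
      rw [show n + 1 + n₂ = n + n₂ + 1 by omega]
      exact .call hb (by simpa using ih h2)

end StackMachine

namespace XPathDTD

open StackMachine

/-- The stacks of the program. -/
inductive Reg
  -- Roles: `X` holds the input, `D` the database, `C` its number of records in unary. `T` and `V`
  -- are auxiliary. `W` holds rules or a regular expression being read, and `E` a copy being
  -- searched. `B` and `G` hold the label and the goal of a new record, `H` the goal for its
  -- children, `N` numbers of records. In the final phase, `G` holds the path that is evaluated.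
  | X | D | C | T | V | W | E | B | G | H | N
  deriving DecidableEq

instance : Fintype Reg :=
  ⟨{.X, .D, .C, .T, .V, .W, .E, .B, .G, .H, .N}, by intro k; cases k <;> simp⟩

/-- The procedures of the program. -/
inductive Pr
  | mv (a b : Reg)
  | mv2 (a b c : Reg)
  | drop (a : Reg)
  | eqPre (a b : Reg)
  | skip (n : Cat) (a : Reg)
  | take (n : Cat) (a b : Reg)
  | bad (n : Cat) (a : Reg)
  | eqLab (a b : Reg)
  | neqLab (a b : Reg)
  | findRule (a : Reg)
  | dropId (a : Reg)
  | notIn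
  | guessLabel
  | guessGoal
  | reduce
  | redFil
  | takeId
  | pick
  | gen
  | addRec
  | build
  | mvU
  | eqId
  | mvUs
  | dropGoal
  | dropIds
  | goChild
  | test
  | fils
  | walk
  | finish
  | decideInput
  | main

instance : Finite Pr := by
  let f : Fin 11 × Reg × Reg × Reg × Cat → Pr := fun z => match z with
    | (0, a, b, _, _) => .mv a b
    | (1, a, b, c, _) => .mv2 a b c
    | (2, a, _, _, _) => .drop a
    | (3, a, b, _, _) => .eqPre a b
    | (4, a, _, _, n) => .skip n a
    | (5, a, b, _, n) => .take n a b
    | (6, a, _, _, n) => .bad n a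
    | (7, a, b, _, _) => .eqLab a b
    | (8, a, b, _, _) => .neqLab a b
    | (9, a, _, _, _) => .findRule a
    | (_, a, _, _, _) => .dropId a
  have h : (Set.range f ∪ {.notIn, .guessLabel, .guessGoal, .reduce, .redFil, .takeId, .pick, .gen,
      .addRec, .build, .mvU, .eqId, .mvUs, .dropGoal, .dropIds, .goChild, .test, .fils, .walk,
      .finish, .decideInput, .main}).Finite :=
    (Set.finite_range f).union (Set.toFinite _)
  rw [← Set.finite_univ_iff]
  refine h.subset fun z _ => ?_
  cases z with
  | mv a b => exact .inl ⟨(0, a, b, a, .label), rfl⟩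
  | mv2 a b c => exact .inl ⟨(1, a, b, c, .label), rfl⟩
  | drop a => exact .inl ⟨(2, a, a, a, .label), rfl⟩
  | eqPre a b => exact .inl ⟨(3, a, b, a, .label), rfl⟩
  | skip n a => exact .inl ⟨(4, a, a, a, n), rfl⟩
  | take n a b => exact .inl ⟨(5, a, b, a, n), rfl⟩
  | bad n a => exact .inl ⟨(6, a, a, a, n), rfl⟩
  | eqLab a b => exact .inl ⟨(7, a, b, a, .label), rfl⟩
  | neqLab a b => exact .inl ⟨(8, a, b, a, .label), rfl⟩
  | findRule a => exact .inl ⟨(9, a, a, a, .label), rfl⟩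
  | dropId a => exact .inl ⟨(10, a, a, a, .label), rfl⟩
  | _ => exact .inr (by simp)

/-- The instructions of the program. -/
abbrev I : Type := Instr Reg Sym Pr

/-- Remove the given symbol from the top of a stack. -/
abbrev pop (k : Reg) (a : Sym) : I := .op (.pop k a)
/-- Put a symbol on a stack. -/
abbrev push (k : Reg) (a : Sym) : I := .op (.push k a)
/-- Require that a stack is empty. -/
abbrev tst (k : Reg) : I := .op (.empty k)
/-- Call a procedure. -/
abbrev call (f : Pr) : I := .call f

/-- The symbol in front of every record of the database. -/
abbrev mark : Sym := .star
/-- The unit in which the numbers of records are written. -/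
abbrev idU : Sym := .char
/-- The end marker of a number of a record. -/
abbrev idE : Sym := .cat
/-- The end marker of the goal of a record. -/
abbrev endg : Sym := .plus
/-- The goal that is never reached. -/
abbrev noGoal : Sym := .epsilon

/-- The list of all symbols. -/
def syms : List Sym :=
  [.bit true, .bit false, .sep, .zero, .epsilon, .char, .plus, .cat, .star, .self, .child, .slash,
    .more, .done]

theorem mem_syms (c : Sym) : c ∈ syms := by
  rcases c with (_ | _) | _ <;> simp [syms]

/-- The symbols that may occur in goals. -/
def goalSyms : List Sym :=
  [.bit true, .bit false, .sep, .self, .child, .slash, .more, .done, noGoal]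

/-- All ways to split a list at an element: what is before it, and the element. -/
def splits : List Cat → List (List Cat × Cat)
  | [] => []
  | n :: ns => ([], n) :: (splits ns).map fun z => (n :: z.1, z.2)

open Reg

/-- Empty a stack. -/
def clear (a : Reg) : List I := [call (.drop a), tst a]
/-- Move the whole contents of a stack to another one, in reverse order. -/
def mvAll (a b : Reg) : List I := [call (.mv a b), tst a]
/-- Put a copy of the contents of a stack on top of another one. -/
def copy (a b : Reg) : List I := [tst T, call (.mv a T), tst a, call (.mv2 T a b), tst T]
/-- Move the contents of a stack to another one. -/
def prepend (a b : Reg) : List I := [tst T, call (.mv a T), tst a, call (.mv T b), tst T]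
/-- Remove the contents of the stack `b` from the top of the stack `a`. -/
def matchPre (a b : Reg) : List I := copy b V ++ [call (.eqPre a V), tst V]
/-- Go to the record whose number is on top of the stack `N`. -/
def look : List I :=
  copy D E ++ [call (.drop E), pop E mark] ++ copy N V ++ [call .eqId] ++ clear V
/-- Move the number of a record from `E` to `N`. -/
def moveId : List I := [push N idE, call .mvU]
/-- Duplicate the number on top of the stack `N`. -/
def dupId : List I :=
  [call .mvUs, push N idE] ++ copy V N ++ [push N idE] ++ mvAll V N

/-- The procedure bodies. -/
def prog : Prog Reg Sym Pr
  | .mv a b => [] :: syms.map fun c => [pop a c, push b c, call (.mv a b)]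
  | .mv2 a b d => [] :: syms.map fun c => [pop a c, push b c, push d c, call (.mv2 a b d)]
  | .drop a => [] :: syms.map fun c => [pop a c, call (.drop a)]
  | .eqPre a b => [] :: syms.map fun c => [pop a c, pop b c, call (.eqPre a b)]
  | .skip n a => syms.filterMap fun c => (expand n c).map fun ns =>
      pop a c :: ns.map fun m => call (.skip m a)
  | .take n a b => syms.filterMap fun c => (expand n c).map fun ns =>
      pop a c :: push b c :: ns.map fun m => call (.take m a b)
  -- No prefix of the stack is a word of category `n` in three cases: the stack is empty, its first
  -- symbol cannot start such a word, or among the parts that must follow there is a first one that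
  -- cannot be read. The last part is guessed by means of `splits`.
  | .bad n a => [tst a] :: syms.flatMap fun c => match expand n c with
    | none => [[pop a c]]
    | some ns => (splits ns).map fun z =>
        pop a c :: ((z.1.map fun m => call (.skip m a)) ++ [call (.bad z.2 a)])
  | .eqLab a b => [pop a .sep, pop b .sep] ::
      [true, false].map fun c => [pop a (.bit c), pop b (.bit c), call (.eqLab a b)]
  -- A common prefix is removed until one label ends or the letters differ. The label on `a` is then
  -- removed completely, while what remains of the label on `b` stays.
  | .neqLab a b =>
      ([true, false].map fun c => [pop a (.bit c), pop b (.bit c), call (.neqLab a b)]) ++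
      ([true, false].map fun c => [pop a .sep, pop b (.bit c)]) ++
      ([true, false].map fun c => [pop a (.bit c), pop b .sep, call (.skip .label a)]) ++
      [true, false].map fun c => [pop a (.bit c), pop b (.bit !c), call (.skip .label a)]
  | .findRule a =>
      [[], [pop a .more, call (.skip .label a), call (.skip .regex a), call (.findRule a)]]
  | .dropId a => [[pop a idE], [pop a idU, call (.dropId a)]]
  | .notIn => [[pop W .done], [pop W .more] ++ copy V E ++ [call (.neqLab W E)] ++ clear E ++
      [call (.skip .regex W), call .notIn]]
  | .guessLabel => [] :: [true, false].map fun c => [push B (.bit c), call .guessLabel]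
  | .guessGoal => [] :: goalSyms.map fun c => [push G c, call .guessGoal]
  -- The alternatives of `reduce` and `redFil` are the constructors of `Red` for the flags `false`
  -- and `true`, in the same order.
  | .reduce =>
      [[pop H .slash, call .reduce],
        [pop H .self] ++ copy B V ++ [call (.neqLab H V)] ++ clear V ++ clear H ++ [push H noGoal],
        [pop H .self, call (.skip .label H), call .redFil],
        [pop H .child, push H .self],
        [pop H noGoal, push H noGoal]]
  | .redFil => [[pop H .more, call .reduce],
      [pop H .more, call (.skip .xpath H), call .redFil], [pop H .done, call .reduce]]
  | .takeId => [[pop E idE, push N idE], [pop E idU, push N idU, call .takeId]]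
  -- A record is guessed by dropping an arbitrary part of a copy of the database. Its number is kept
  -- on `N`, its label has to agree with the letter on `W` and its goal with `H`.
  | .pick => [copy D E ++ [call (.drop E), pop E mark, call .takeId, call (.eqLab W E)] ++
      matchPre E H ++ [pop E endg] ++ clear E]
  | .gen =>
      [[pop W .epsilon],
        [pop W .char, call .pick],
        [pop W .plus, call .gen, call (.skip .regex W)],
        [pop W .plus, call (.skip .regex W), call .gen],
        [pop W .cat, call .gen, call .gen],
        [pop W .star, call (.skip .regex W)],
        -- The star is unrolled once: the expression `r*` on top of `W` is replaced by `r` followed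
        -- by `r*`. The second copy of `r` is made through `T` and `V`.
        [pop W .star, tst T, call (.take .regex W T), call (.mv2 T W V), tst T, push W .star] ++
          mvAll V T ++ mvAll T W ++ [call .gen, call .gen]]
  -- The children are picked from records that are already on `D`, so references cannot be circular.
  -- The parts of the record are written from the last to the first because `D` is a stack, and its
  -- number is the current value of the counter `C`.
  | .addRec => [[push B .sep, call .guessLabel] ++ copy X W ++
      [call (.skip .label W), call (.findRule W), pop W .more] ++ matchPre W B ++
      [call .guessGoal] ++ copy G H ++ [call .reduce, call .gen] ++ clear W ++ clear H ++
      mvAll N D ++ [push D endg] ++ prepend G D ++ prepend B D ++ [push D idE] ++ copy C D ++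
      [push D mark, push C idU]]
  | .build => [[], [call .addRec, call .build]]
  | .mvU => [[pop E idE], [pop E idU, push N idU, call .mvU]]
  | .eqId => [[pop E idE, pop V idE], [pop E idU, pop V idU, call .eqId]]
  | .mvUs => [[pop N idE], [pop N idU, push V idU, call .mvUs]]
  | .dropGoal => [] :: goalSyms.map fun c => [pop E c, call .dropGoal]
  | .dropIds => [[], [call (.dropId E), call .dropIds]]
  | .goChild => [look ++ [call (.skip .label E), call .dropGoal, pop E endg, call .dropIds,
      call (.dropId N)] ++ moveId ++ clear E]
  | .test => [look ++ [call (.eqLab G E)] ++ clear E ++ [call .fils]]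
  | .fils => [[pop G .done],
      -- The evaluation of a filter moves to another vertex, so the number of the present one is
      -- duplicated first, and the number that was reached is discarded afterwards.
      [pop G .more] ++ dupId ++ [call .walk, call (.dropId N), call .fils]]
  | .walk => [[pop G .slash, call .walk, call .walk], [pop G .self, call .test],
      [pop G .child, call .goChild, call .test]]
  | .finish => [copy D E ++ [pop E mark] ++ moveId ++ copy X W ++
      [call (.eqLab W E), call (.skip .rules W)] ++ copy W G ++ [call (.skip .xpath W)] ++
      matchPre E W ++ [pop E endg] ++ clear E ++ clear W ++ [call .walk]]
  -- The alternatives, in order: no prefix of the input has the form of an instance; symbols are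
  -- left over after one; a label has two rules; the start symbol has no rule; a letter of a regular
  -- expression has no rule; there is a counterexample.
  | .decideInput =>
      ((splits [.label, .rules, .xpath, .xpath]).map fun z =>
        (z.1.map fun m => call (.skip m X)) ++ [call (.bad z.2 X)]) ++
      (syms.map fun c => [call (.skip .label X), call (.skip .rules X), call (.skip .xpath X),
        call (.skip .xpath X), pop X c]) ++
      [copy X W ++ [call (.skip .label W), call (.findRule W), pop W .more] ++ copy W E ++
        [call (.skip .label E), call (.skip .regex E), call (.findRule E), pop E .more,
          call (.eqLab W E)],
        copy X V ++ copy X W ++ [call (.skip .label W), call .notIn],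
        copy X V ++ [call (.drop V), pop V .char] ++ copy X W ++
          [call (.skip .label W), call .notIn],
        [call .build, call .finish]]
  | .main => [[call (.mv T X), tst T, call .decideInput]]

/-- The stacks with the given contents. -/
def st (x d c t v w e b g h n : List Sym) : Reg → List Sym
  | X => x | D => d | C => c | T => t | V => v | W => w | E => e | B => b | G => g | H => h | N => n

section St

variable (x d c t v w e b g h n y : List Sym)

@[simp] theorem st_X : st x d c t v w e b g h n X = x := rfl
@[simp] theorem st_D : st x d c t v w e b g h n D = d := rfl
@[simp] theorem st_C : st x d c t v w e b g h n C = c := rfl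
@[simp] theorem st_T : st x d c t v w e b g h n T = t := rfl
@[simp] theorem st_V : st x d c t v w e b g h n V = v := rfl
@[simp] theorem st_W : st x d c t v w e b g h n W = w := rfl
@[simp] theorem st_E : st x d c t v w e b g h n E = e := rfl
@[simp] theorem st_B : st x d c t v w e b g h n B = b := rfl
@[simp] theorem st_G : st x d c t v w e b g h n G = g := rfl
@[simp] theorem st_H : st x d c t v w e b g h n H = h := rfl
@[simp] theorem st_N : st x d c t v w e b g h n N = n := rfl
@[simp] theorem update_st_X : Function.update (st x d c t v w e b g h n) X y =
    st y d c t v w e b g h n := by funext k; cases k <;> simp [Function.update, st]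
@[simp] theorem update_st_D : Function.update (st x d c t v w e b g h n) D y =
    st x y c t v w e b g h n := by funext k; cases k <;> simp [Function.update, st]
@[simp] theorem update_st_C : Function.update (st x d c t v w e b g h n) C y =
    st x d y t v w e b g h n := by funext k; cases k <;> simp [Function.update, st]
@[simp] theorem update_st_T : Function.update (st x d c t v w e b g h n) T y =
    st x d c y v w e b g h n := by funext k; cases k <;> simp [Function.update, st]
@[simp] theorem update_st_V : Function.update (st x d c t v w e b g h n) V y =
    st x d c t y w e b g h n := by funext k; cases k <;> simp [Function.update, st]
@[simp] theorem update_st_W : Function.update (st x d c t v w e b g h n) W y =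
    st x d c t v y e b g h n := by funext k; cases k <;> simp [Function.update, st]
@[simp] theorem update_st_E : Function.update (st x d c t v w e b g h n) E y =
    st x d c t v w y b g h n := by funext k; cases k <;> simp [Function.update, st]
@[simp] theorem update_st_B : Function.update (st x d c t v w e b g h n) B y =
    st x d c t v w e y g h n := by funext k; cases k <;> simp [Function.update, st]
@[simp] theorem update_st_G : Function.update (st x d c t v w e b g h n) G y =
    st x d c t v w e b y h n := by funext k; cases k <;> simp [Function.update, st]
@[simp] theorem update_st_H : Function.update (st x d c t v w e b g h n) H y =
    st x d c t v w e b g y n := by funext k; cases k <;> simp [Function.update, st]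
@[simp] theorem update_st_N : Function.update (st x d c t v w e b g h n) N y =
    st x d c t v w e b g h y := by funext k; cases k <;> simp [Function.update, st]

end St

theorem eq_st (s : Reg → List Sym) :
    s = st (s X) (s D) (s C) (s T) (s V) (s W) (s E) (s B) (s G) (s H) (s N) := by
  funext k; cases k <;> rfl

end XPathDTD

/-! ## What the basic procedures do -/

namespace StackMachine

variable {K A F α : Type} [DecidableEq K] [DecidableEq A] {P : Prog K A F}

/-- Iteration of a family of relations with costs along a list. -/
def Steps (R : α → (K → List A) → ℕ → (K → List A) → Prop) :
    List α → (K → List A) → ℕ → (K → List A) → Prop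
  | [], s, k, t => k = 0 ∧ t = s
  | c :: u, s, k, t => ∃ k₁ k₂ s₁, k = k₁ + k₂ ∧ R c s k₁ s₁ ∧ Steps R u s₁ k₂ t

/-- A procedure that is a loop with bodies `body c` for `c ∈ cs` and with ends `fins`. -/
theorem exec_loop {f : F} {fins : List (List (Instr K A F))} {cs : List α}
    {body : α → List (Instr K A F)} (R : α → (K → List A) → ℕ → (K → List A) → Prop)
    (hf : ∀ b, b ∈ P f ↔ b ∈ fins ∨ ∃ c ∈ cs, b = body c ++ [.call f])
    (hR : ∀ c ∈ cs, ∀ l s n s', Exec P (body c ++ l) s n s' ↔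
      ∃ k m s₁, n = k + m ∧ R c s k s₁ ∧ Exec P l s₁ m s')
    {l : List (Instr K A F)} {s s' : K → List A} {n : ℕ} :
    Exec P (.call f :: l) s n s' ↔ ∃ u k m s₁, (∀ c ∈ u, c ∈ cs) ∧ n = u.length + 1 + k + m ∧
      Steps R u s k s₁ ∧ ∃ e ∈ fins, Exec P (e ++ l) s₁ m s' := by
  constructor
  · intro H
    induction n using Nat.strong_induction_on generalizing s with
    | _ n ih =>
      rw [exec_call_iff] at H
      obtain ⟨m, rfl, b, hb, H⟩ := H
      rcases (hf b).1 hb with hb | ⟨c, hc, rfl⟩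
      · exact ⟨[], 0, m, s, by simp, by simp; omega, ⟨rfl, rfl⟩, b, hb, H⟩
      · rw [List.append_assoc, hR c hc] at H
        obtain ⟨k, m, s₁, rfl, h1, H⟩ := H
        obtain ⟨u, k', m', s₂, hu, rfl, h2, H⟩ := ih m (by omega) H
        exact ⟨c :: u, k + k', m', s₂, by simpa [hc] using hu, by simp; omega,
          ⟨k, k', s₁, rfl, h1, h2⟩, H⟩
  · rintro ⟨u, k, m, s₁, hu, rfl, hs, e, he, H⟩
    induction u generalizing s k with
    | nil =>
      obtain ⟨rfl, rfl⟩ := hs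
      rw [exec_call_iff]
      exact ⟨m, by simp; omega, e, (hf e).2 (.inl he), H⟩
    | cons c u ih =>
      obtain ⟨k₁, k₂, s₂, rfl, h1, h2⟩ := hs
      have hc : c ∈ cs := hu c (by simp)
      rw [exec_call_iff]
      refine ⟨u.length + 1 + (k₁ + k₂) + m, by simp; omega, _, (hf _).2 (.inr ⟨c, hc, rfl⟩), ?_⟩
      rw [List.append_assoc, hR c hc]
      exact ⟨k₁, u.length + 1 + k₂ + m, s₂, by omega, h1,
        ih _ (fun c hc => hu c (List.mem_cons_of_mem _ hc)) h2⟩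

/-- A loop the bodies of which do not contain calls; `W` is the combined effect of its
iterations. -/
theorem exec_simple_loop {f : F} {fins : List (List (Instr K A F))} {cs : List α}
    {body : α → List (Instr K A F)} (g : α → (K → List A) → (K → List A) → Prop)
    (W : List α → (K → List A) → (K → List A) → Prop)
    (hf : ∀ b, b ∈ P f ↔ b ∈ fins ∨ ∃ c ∈ cs, b = body c ++ [.call f])
    (hg : ∀ c ∈ cs, ∀ l s n s', Exec P (body c ++ l) s n s' ↔ ∃ s₁, g c s s₁ ∧ Exec P l s₁ n s')
    (h0 : ∀ s s₁, W [] s s₁ ↔ s₁ = s)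
    (hcons : ∀ c u s s₁, W (c :: u) s s₁ ↔ ∃ s₂, g c s s₂ ∧ W u s₂ s₁)
    {l : List (Instr K A F)} {s s' : K → List A} {n : ℕ} :
    Exec P (.call f :: l) s n s' ↔ ∃ u, (∀ c ∈ u, c ∈ cs) ∧ ∃ m, n = u.length + 1 + m ∧
      ∃ s₁, W u s s₁ ∧ ∃ e ∈ fins, Exec P (e ++ l) s₁ m s' := by
  have hs : ∀ u s k s₁, Steps (fun c s k s' => k = 0 ∧ g c s s') u s k s₁ ↔ k = 0 ∧ W u s s₁ := by
    intro u
    induction u with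
    | nil => intro s k s₁; simp [Steps, h0]
    | cons c u ih =>
      intro s k s₁
      simp only [Steps, hcons, ih]
      constructor
      · rintro ⟨k₁, k₂, s₂, rfl, ⟨rfl, h1⟩, rfl, h2⟩
        exact ⟨rfl, s₂, h1, h2⟩
      · rintro ⟨rfl, s₂, h1, h2⟩
        exact ⟨0, 0, s₂, rfl, ⟨rfl, h1⟩, rfl, h2⟩
  rw [exec_loop (fun c s k s' => k = 0 ∧ g c s s') hf]
  · constructor
    · rintro ⟨u, k, m, s₁, hu, rfl, h, H⟩
      obtain ⟨rfl, h'⟩ := (hs _ _ _ _).1 h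
      exact ⟨u, hu, m, rfl, s₁, h', H⟩
    · rintro ⟨u, hu, m, rfl, s₁, h, H⟩
      exact ⟨u, 0, m, s₁, hu, rfl, (hs _ _ _ _).2 ⟨rfl, h⟩, H⟩
  · intro c hc l s n s'
    rw [hg c hc]
    constructor
    · rintro ⟨s₁, h1, H⟩
      exact ⟨0, n, s₁, by simp, ⟨rfl, h1⟩, H⟩
    · rintro ⟨k, m, s₁, rfl, ⟨rfl, h1⟩, H⟩
      exact ⟨s₁, h1, by simpa using H⟩

end StackMachine

namespace XPathDTD

open StackMachine Reg

variable {l : List I} {s s' : Reg → List Sym} {n : ℕ}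

theorem mem_nil_cons_map {α : Type*} {L : List α} {f : α → List I} {b : List I} :
    b ∈ [] :: L.map f ↔ b ∈ [([] : List I)] ∨ ∃ c ∈ L, b = f c := by
  simp [eq_comm]


-- Loops that transfer a word between stacks.

/-- The effect of removing the word `u` from the stacks `p` and putting it on the stacks `q`. -/
def Transfer (p q : List Reg) (u : List Sym) (s s₁ : Reg → List Sym) : Prop :=
  ∀ k, (k ∈ p → s k = u ++ s₁ k) ∧ (k ∈ q → s₁ k = u.reverse ++ s k) ∧
    (k ∉ p → k ∉ q → s₁ k = s k)

theorem exec_pops_iff {p : List Reg} (hp : p.Nodup) {c : Sym} :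
    Exec prog ((p.map fun k => pop k c) ++ l) s n s' ↔
      ∃ s₁, Transfer p [] [c] s s₁ ∧ Exec prog l s₁ n s' := by
  induction p generalizing s with
  | nil =>
    simp only [Transfer, List.map_nil, List.nil_append, List.not_mem_nil, false_implies, true_and,
      not_false_eq_true, true_implies]
    exact ⟨fun H => ⟨s, fun _ => rfl, H⟩, fun ⟨s₁, h, h'⟩ => by rwa [funext h] at h'⟩
  | cons k p ih =>
    rw [List.nodup_cons] at hp
    simp only [List.map_cons, List.cons_append, exec_pop_iff, ih hp.2]
    constructor
    · rintro ⟨r, hr, s₁, h, H⟩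
      refine ⟨s₁, fun k' => ⟨fun hk' => ?_, by simp, fun hk' _ => ?_⟩, H⟩
      · by_cases e : k' = k
        · subst e; rw [(h k').2.2 hp.1 (by simp)]; simpa using hr
        · simpa [e] using (h k').1 (by simpa [e] using hk')
      · simp only [List.mem_cons, not_or] at hk'
        simpa [hk'.1] using (h k').2.2 hk'.2 (by simp)
    · rintro ⟨s₁, h, H⟩
      refine ⟨s₁ k, by simpa using (h k).1 (by simp), s₁, fun k' => ?_, H⟩
      by_cases e : k' = k
      · subst e; simp [hp.1]
      · simpa [e] using h k'

theorem exec_pushes_iff {q : List Reg} (hq : q.Nodup) {c : Sym} :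
    Exec prog ((q.map fun k => push k c) ++ l) s n s' ↔
      ∃ s₁, Transfer [] q [c] s s₁ ∧ Exec prog l s₁ n s' := by
  induction q generalizing s with
  | nil =>
    simp only [Transfer, List.map_nil, List.nil_append, List.not_mem_nil, false_implies, true_and,
      not_false_eq_true, true_implies]
    exact ⟨fun H => ⟨s, fun _ => rfl, H⟩, fun ⟨s₁, h, h'⟩ => by rwa [funext h] at h'⟩
  | cons k q ih =>
    rw [List.nodup_cons] at hq
    simp only [List.map_cons, List.cons_append, exec_push_iff, ih hq.2]
    constructor
    · rintro ⟨s₁, h, H⟩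
      refine ⟨s₁, fun k' => ⟨by simp, fun hk' => ?_, fun _ hk' => ?_⟩, H⟩
      · by_cases e : k' = k
        · subst e; rw [(h k').2.2 (by simp) hq.1]; simp
        · simpa [e] using (h k').2.1 (by simpa [e] using hk')
      · simp only [List.mem_cons, not_or] at hk'
        simpa [hk'.1] using (h k').2.2 (by simp) hk'.2
    · rintro ⟨s₁, h, H⟩
      refine ⟨s₁, fun k' => ?_, H⟩
      by_cases e : k' = k
      · subst e; simpa [hq.1] using (h k').2.1 (by simp)
      · simpa [e] using (h k')

/-- Loops that remove a word from some stacks and put it on some other ones. -/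
theorem exec_transfer {f : Pr} {fins : List (List I)} {cs : List Sym} {p q : List Reg}
    (hp : p.Nodup) (hq : q.Nodup) (hpq : p.Disjoint q)
    (hf : ∀ b, b ∈ prog f ↔ b ∈ fins ∨
      ∃ c ∈ cs, b = (p.map fun k => pop k c) ++ (q.map fun k => push k c) ++ [call f]) :
    Exec prog (call f :: l) s n s' ↔ ∃ u, (∀ c ∈ u, c ∈ cs) ∧ ∃ m, n = u.length + 1 + m ∧
      ∃ s₁, Transfer p q u s s₁ ∧ ∃ e ∈ fins, Exec prog (e ++ l) s₁ m s' := by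
  have key : ∀ c u s s₁, Transfer p q (c :: u) s s₁ ↔
      ∃ s₂, Transfer p q [c] s s₂ ∧ Transfer p q u s₂ s₁ := by
    intro c u s s₁
    constructor
    · intro h
      -- After the first round the stacks in `p` still carry `u` above their final contents, while
      -- those in `q` have received only `c`. Disjointness of `p` and `q` makes this consistent.
      refine ⟨fun k => if k ∈ p then u ++ s₁ k else if k ∈ q then c :: s k else s k,
        fun k => ⟨fun hk => ?_, fun hk => ?_, fun hk hk' => ?_⟩,
        fun k => ⟨fun hk => ?_, fun hk => ?_, fun hk hk' => ?_⟩⟩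
      · simpa [hk] using (h k).1 hk
      · simp [hk, show k ∉ p from fun h => hpq h hk]
      · simp [hk, hk']
      · simp [hk]
      · simpa [hk, show k ∉ p from fun h => hpq h hk] using (h k).2.1 hk
      · simpa [hk, hk'] using (h k).2.2 hk hk'
    · rintro ⟨s₂, h1, h2⟩
      refine fun k => ⟨fun hk => ?_, fun hk => ?_, fun hk hk' => ?_⟩
      · rw [(h1 k).1 hk, (h2 k).1 hk]; simp
      · rw [(h2 k).2.1 hk, (h1 k).2.1 hk]; simp
      · rw [(h2 k).2.2 hk hk', (h1 k).2.2 hk hk']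
  refine exec_simple_loop (fun c => Transfer p q [c]) (Transfer p q) hf ?_ ?_ key
  · intro c _ l s n s'
    rw [List.append_assoc, exec_pops_iff hp]
    simp only [exec_pushes_iff hq]
    constructor
    · rintro ⟨s₁, h1, s₂, h2, H⟩
      refine ⟨s₂, fun k => ⟨fun hk => ?_, fun hk => ?_, fun hk hk' => ?_⟩, H⟩
      · rw [(h1 k).1 hk, (h2 k).2.2 (by simp) (hpq hk)]
      · rw [(h2 k).2.1 hk, (h1 k).2.2 (fun h => hpq h hk) (by simp)]
      · rw [(h2 k).2.2 (by simp) hk', (h1 k).2.2 hk (by simp)]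
    · rintro ⟨s₂, h, H⟩
      refine ⟨fun k => if k ∈ p then s₂ k else s k, fun k => ⟨fun hk => ?_, by simp,
        fun hk _ => ?_⟩,
        s₂, fun k => ⟨by simp, fun hk => ?_, fun _ hk => ?_⟩, H⟩
      · simpa [hk] using (h k).1 hk
      · simp [hk]
      · simpa [show k ∉ p from fun h => hpq h hk] using (h k).2.1 hk
      · by_cases hk' : k ∈ p
        · simp [hk']
        · simpa [hk'] using (h k).2.2 hk' hk
  · intro s s₁
    simp only [Transfer, List.nil_append, List.reverse_nil]
    constructor
    · intro h
      funext k
      by_cases hk : k ∈ p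
      · exact ((h k).1 hk).symm
      · by_cases hk' : k ∈ q
        · exact (h k).2.1 hk'
        · exact (h k).2.2 hk hk'
    · rintro rfl
      simp

theorem transfer_drop {a : Reg} {u : List Sym} {s s₁ : Reg → List Sym} :
    Transfer [a] [] u s s₁ ↔ ∃ r, s a = u ++ r ∧ s₁ = Function.update s a r := by
  constructor
  · intro h
    refine ⟨s₁ a, (h a).1 (by simp), ?_⟩
    funext k
    by_cases hk : k = a
    · subst hk; simp
    · simpa [hk] using (h k).2.2
  · rintro ⟨r, h, rfl⟩ k
    by_cases hk : k = a
    · subst hk; simpa using h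
    · simp [hk]

theorem transfer_push {a : Reg} {u : List Sym} {s s₁ : Reg → List Sym} :
    Transfer [] [a] u s s₁ ↔ s₁ = Function.update s a (u.reverse ++ s a) := by
  constructor
  · intro h
    funext k
    by_cases hk : k = a
    · subst hk; simpa using (h k).2.1
    · simpa [hk] using (h k).2.2
  · rintro rfl k
    by_cases hk : k = a
    · subst hk; simp
    · simp [hk]

theorem transfer_mv {a b : Reg} (hab : a ≠ b) {u : List Sym} {s s₁ : Reg → List Sym} :
    Transfer [a] [b] u s s₁ ↔ ∃ r, s a = u ++ r ∧
      s₁ = Function.update (Function.update s a r) b (u.reverse ++ s b) := by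
  constructor
  · intro h
    refine ⟨s₁ a, (h a).1 (by simp), ?_⟩
    funext k
    by_cases hk : k = b
    · subst hk; simpa using (h k).2.1
    · by_cases hk' : k = a
      · subst hk'; simp [hk]
      · simpa [hk, hk'] using (h k).2.2
  · rintro ⟨r, h, rfl⟩ k
    by_cases hk : k = b
    · subst hk; simp [hab.symm]
    · by_cases hk' : k = a
      · subst hk'; simpa [hk] using h
      · simp [hk, hk']

theorem transfer_mv2 {a b d : Reg} (hab : a ≠ b) (had : a ≠ d) (hbd : b ≠ d) {u : List Sym}
    {s s₁ : Reg → List Sym} :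
    Transfer [a] [b, d] u s s₁ ↔ ∃ r, s a = u ++ r ∧
      s₁ = Function.update (Function.update (Function.update s a r) b (u.reverse ++ s b)) d
        (u.reverse ++ s d) := by
  constructor
  · intro h
    refine ⟨s₁ a, (h a).1 (by simp), ?_⟩
    funext k
    by_cases hk : k = d
    · subst hk; simpa using (h k).2.1
    · by_cases hk' : k = b
      · subst hk'; simpa [hk] using (h k).2.1
      · by_cases hk'' : k = a
        · subst hk''; simp [hk, hk']
        · simpa [hk, hk', hk''] using (h k).2.2
  · rintro ⟨r, h, rfl⟩ k
    by_cases hk : k = d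
    · subst hk; simp [had.symm]
    · by_cases hk' : k = b
      · subst hk'; simp [hk, hab.symm]
      · by_cases hk'' : k = a
        · subst hk''; simpa [hk, hk'] using h
        · simp [hk, hk', hk'']

theorem transfer_eq {a b : Reg} (hab : a ≠ b) {u : List Sym} {s s₁ : Reg → List Sym} :
    Transfer [a, b] [] u s s₁ ↔ ∃ r r', s a = u ++ r ∧ s b = u ++ r' ∧
      s₁ = Function.update (Function.update s a r) b r' := by
  constructor
  · intro h
    refine ⟨s₁ a, s₁ b, (h a).1 (by simp), (h b).1 (by simp), ?_⟩
    funext k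
    by_cases hk : k = b
    · subst hk; simp
    · by_cases hk' : k = a
      · subst hk'; simp [hk]
      · simpa [hk, hk'] using (h k).2.2
  · rintro ⟨r, r', h, h', rfl⟩ k
    by_cases hk : k = b
    · subst hk; simpa [hab.symm] using h'
    · by_cases hk' : k = a
      · subst hk'; simpa [hk] using h
      · simp [hk, hk']

theorem exec_drop {a : Reg} : Exec prog (call (.drop a) :: l) s n s' ↔
    ∃ u r m, s a = u ++ r ∧ n = u.length + 1 + m ∧ Exec prog l (Function.update s a r) m s' := by
  rw [exec_transfer (f := .drop a) (fins := [[]]) (cs := syms) (p := [a]) (q := []) (by simp)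
    (by simp) (by simp) (fun b => mem_nil_cons_map)]
  simp only [mem_syms, implies_true, true_and, transfer_drop]
  constructor
  · rintro ⟨u, m, rfl, _, ⟨r, h, rfl⟩, e, he, H⟩
    simp at he; subst he
    exact ⟨u, r, m, h, rfl, H⟩
  · rintro ⟨u, r, m, h, rfl, H⟩
    exact ⟨u, m, rfl, _, ⟨r, h, rfl⟩, [], by simp, H⟩

theorem exec_mv {a b : Reg} (hab : a ≠ b) : Exec prog (call (.mv a b) :: l) s n s' ↔
    ∃ u r m, s a = u ++ r ∧ n = u.length + 1 + m ∧
      Exec prog l (Function.update (Function.update s a r) b (u.reverse ++ s b)) m s' := by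
  rw [exec_transfer (f := .mv a b) (fins := [[]]) (cs := syms) (p := [a]) (q := [b]) (by simp)
    (by simp) (by simpa using hab.symm) (fun b => mem_nil_cons_map)]
  simp only [mem_syms, implies_true, true_and, transfer_mv hab]
  constructor
  · rintro ⟨u, m, rfl, _, ⟨r, h, rfl⟩, e, he, H⟩
    simp at he; subst he
    exact ⟨u, r, m, h, rfl, H⟩
  · rintro ⟨u, r, m, h, rfl, H⟩
    exact ⟨u, m, rfl, _, ⟨r, h, rfl⟩, [], by simp, H⟩

theorem exec_mv2 {a b d : Reg} (hab : a ≠ b) (had : a ≠ d) (hbd : b ≠ d) :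
    Exec prog (call (.mv2 a b d) :: l) s n s' ↔ ∃ u r m, s a = u ++ r ∧ n = u.length + 1 + m ∧
      Exec prog l (Function.update (Function.update (Function.update s a r) b (u.reverse ++ s b)) d
        (u.reverse ++ s d)) m s' := by
  rw [exec_transfer (f := .mv2 a b d) (fins := [[]]) (cs := syms) (p := [a]) (q := [b, d]) (by simp)
    (by simpa using hbd) (by simpa using ⟨hab, had⟩) (fun b => mem_nil_cons_map)]
  simp only [mem_syms, implies_true, true_and, transfer_mv2 hab had hbd]
  constructor
  · rintro ⟨u, m, rfl, _, ⟨r, h, rfl⟩, e, he, H⟩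
    simp at he; subst he
    exact ⟨u, r, m, h, rfl, H⟩
  · rintro ⟨u, r, m, h, rfl, H⟩
    exact ⟨u, m, rfl, _, ⟨r, h, rfl⟩, [], by simp, H⟩

theorem exec_eqPre {a b : Reg} (hab : a ≠ b) : Exec prog (call (.eqPre a b) :: l) s n s' ↔
    ∃ u r r' m, s a = u ++ r ∧ s b = u ++ r' ∧ n = u.length + 1 + m ∧
      Exec prog l (Function.update (Function.update s a r) b r') m s' := by
  rw [exec_transfer (f := .eqPre a b) (fins := [[]]) (cs := syms) (p := [a, b]) (q := [])
    (by simpa using hab) (by simp) (by simp) (fun b => mem_nil_cons_map)]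
  simp only [mem_syms, implies_true, true_and, transfer_eq hab]
  constructor
  · rintro ⟨u, m, rfl, _, ⟨r, r', h, h', rfl⟩, e, he, H⟩
    simp at he; subst he
    exact ⟨u, r, r', m, h, h', rfl, H⟩
  · rintro ⟨u, r, r', m, h, h', rfl, H⟩
    exact ⟨u, m, rfl, _, ⟨r, r', h, h', rfl⟩, [], by simp, H⟩

theorem exec_guessGoal : Exec prog (call .guessGoal :: l) s n s' ↔
    ∃ g m, (∀ c ∈ g, c ∈ goalSyms) ∧ n = g.length + 1 + m ∧
      Exec prog l (Function.update s G (g ++ s G)) m s' := by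
  rw [exec_transfer (f := .guessGoal) (fins := [[]]) (cs := goalSyms) (p := []) (q := [G])
    (by simp) (by simp) (by simp) (fun b => mem_nil_cons_map)]
  simp only [transfer_push]
  constructor
  · rintro ⟨u, hu, m, rfl, _, rfl, e, he, H⟩
    simp at he; subst he
    exact ⟨u.reverse, m, by simpa using hu, by simp, H⟩
  · rintro ⟨g, m, hg, rfl, H⟩
    exact ⟨g.reverse, by simpa using hg, m, by simp, _, rfl, [], by simp, by simpa using H⟩

theorem exec_dropGoal : Exec prog (call .dropGoal :: l) s n s' ↔
    ∃ g r m, (∀ c ∈ g, c ∈ goalSyms) ∧ s E = g ++ r ∧ n = g.length + 1 + m ∧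
      Exec prog l (Function.update s E r) m s' := by
  rw [exec_transfer (f := .dropGoal) (fins := [[]]) (cs := goalSyms) (p := [E]) (q := [])
    (by simp) (by simp) (by simp) (fun b => mem_nil_cons_map)]
  simp only [transfer_drop]
  constructor
  · rintro ⟨u, hu, m, rfl, _, ⟨r, h, rfl⟩, e, he, H⟩
    simp at he; subst he
    exact ⟨u, r, m, hu, h, rfl, H⟩
  · rintro ⟨u, r, m, hu, h, rfl, H⟩
    exact ⟨u, hu, m, rfl, _, ⟨r, h, rfl⟩, [], by simp, H⟩

/-- Labels as words over the alphabet of the program. -/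
def bits (a : Label) : List Sym := a.map Sym.bit

theorem exists_eq_bits {u : List Sym} (hu : ∀ c ∈ u, c ∈ [true, false].map Sym.bit) :
    ∃ a, u = bits a := by
  induction u with
  | nil => exact ⟨[], rfl⟩
  | cons c u ih =>
    obtain ⟨a, rfl⟩ := ih fun c hc => hu c (by simp [hc])
    obtain ⟨b, -, rfl⟩ := List.mem_map.1 (hu c (by simp))
    exact ⟨b :: a, rfl⟩

theorem mem_of_mem_bits {a : Label} {c : Sym} (hc : c ∈ bits a) :
    c ∈ [true, false].map Sym.bit := by
  simp only [bits, List.mem_map] at hc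
  obtain ⟨b, -, rfl⟩ := hc
  cases b <;> simp

theorem exec_guessLabel : Exec prog (call .guessLabel :: l) s n s' ↔
    ∃ a m, n = a.length + 1 + m ∧ Exec prog l (Function.update s B (bits a ++ s B)) m s' := by
  rw [exec_transfer (f := .guessLabel) (fins := [[]]) (cs := [true, false].map Sym.bit) (p := [])
    (q := [B]) (by simp) (by simp) (by simp) (fun b => by simp [prog])]
  simp only [transfer_push]
  constructor
  · rintro ⟨u, hu, m, rfl, _, rfl, e, he, H⟩
    simp at he; subst he
    obtain ⟨a, rfl⟩ := exists_eq_bits hu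
    exact ⟨a.reverse, m, by simp [bits], by simpa [bits] using H⟩
  · rintro ⟨a, m, rfl, H⟩
    exact ⟨bits a.reverse, fun _ => mem_of_mem_bits, m, by simp [bits], _, rfl, [], by simp,
      by simpa [bits] using H⟩

theorem exec_eqLab {a b : Reg} (hab : a ≠ b) : Exec prog (call (.eqLab a b) :: l) s n s' ↔
    ∃ x r r' m, s a = encLabel x ++ r ∧ s b = encLabel x ++ r' ∧ n = x.length + 1 + m ∧
      Exec prog l (Function.update (Function.update s a r) b r') m s' := by
  rw [exec_transfer (f := .eqLab a b) (fins := [[pop a .sep, pop b .sep]])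
    (cs := [true, false].map Sym.bit) (p := [a, b]) (q := [])
    (by simpa using hab) (by simp) (by simp) (fun b => by simp [prog])]
  simp only [transfer_eq hab]
  constructor
  · rintro ⟨u, hu, m, rfl, _, ⟨r, r', h, h', rfl⟩, e, he, H⟩
    simp at he; subst he
    obtain ⟨x, rfl⟩ := exists_eq_bits hu
    simp only [List.cons_append, List.nil_append, exec_pop_iff, Function.update_self, ne_eq, hab,
      not_false_eq_true, Function.update_of_ne, hab.symm] at H
    obtain ⟨r, rfl, r', rfl, H⟩ := H
    refine ⟨x, r, r', m, by simp [h, encLabel, bits], by simp [h', encLabel, bits],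
      by simp [bits], ?_⟩
    simpa [Function.update_comm hab] using H
  · rintro ⟨x, r, r', m, h, h', rfl, H⟩
    refine ⟨bits x, fun _ => mem_of_mem_bits, m, by simp [bits], _,
      ⟨.sep :: r, .sep :: r', by simp [h, encLabel, bits], by simp [h', encLabel, bits], rfl⟩,
      _, List.mem_singleton.2 rfl, ?_⟩
    simp only [List.cons_append, List.nil_append, exec_pop_iff, Function.update_self, ne_eq, hab,
      not_false_eq_true, Function.update_of_ne, hab.symm, List.cons.injEq, true_and,
      exists_eq_left']
    simpa [Function.update_comm hab] using H

end XPathDTD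

namespace XPathDTD

open StackMachine Reg

variable {l : List I} {s s' : Reg → List Sym} {n : ℕ}

/-! ### Combinations of loops -/

/-- The loop may stop at any moment, but the emptiness test behind it leaves only the run that
empties the stack. The same device makes the other combinations of loops below deterministic. -/
theorem exec_clear {a : Reg} : Exec prog (clear a ++ l) s n s' ↔
    ∃ m, n = (s a).length + 1 + m ∧ Exec prog l (Function.update s a []) m s' := by
  simp only [clear, List.cons_append, List.nil_append, exec_drop, exec_empty_iff,
    Function.update_self]
  constructor
  · rintro ⟨u, _, m, h, rfl, rfl, hx⟩
    exact ⟨m, by simp [h], hx⟩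
  · rintro ⟨m, rfl, hx⟩
    exact ⟨s a, [], m, by simp, rfl, rfl, hx⟩

theorem exec_mvAll {a b : Reg} (hab : a ≠ b) : Exec prog (mvAll a b ++ l) s n s' ↔
    ∃ m, n = (s a).length + 1 + m ∧
      Exec prog l (Function.update (Function.update s a []) b ((s a).reverse ++ s b)) m s' := by
  simp only [mvAll, List.cons_append, List.nil_append, exec_mv hab, exec_empty_iff,
    Function.update_of_ne hab, Function.update_self]
  constructor
  · rintro ⟨u, _, m, h, rfl, rfl, hx⟩
    exact ⟨m, by simp [h], by simpa [h] using hx⟩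
  · rintro ⟨m, rfl, hx⟩
    exact ⟨s a, [], m, by simp, rfl, rfl, hx⟩

/-- The word passes through `T` and is reversed twice. `T` has to be empty at the start, as
otherwise its contents would be copied as well. -/
theorem exec_copy {a b : Reg} (haT : a ≠ T) (hbT : b ≠ T) (hab : a ≠ b) :
    Exec prog (copy a b ++ l) s n s' ↔ s T = [] ∧ ∃ m, n = 2 * (s a).length + 2 + m ∧
      Exec prog l (Function.update s b (s a ++ s b)) m s' := by
  simp only [copy, List.cons_append, List.nil_append, exec_mv haT, exec_mv2 haT.symm hbT.symm hab,
    exec_empty_iff, Function.update_of_ne haT, Function.update_self, Function.update_of_ne hab.symm,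
    Function.update_of_ne haT.symm, Function.update_of_ne hbT,
    Function.update_of_ne hbT.symm]
  have e : ∀ u : List Sym, s a = u → s T = [] → Function.update (Function.update (Function.update
      (Function.update (Function.update s a []) T u.reverse) T []) a u) b (u ++ s b) =
      Function.update s b (u ++ s b) := by
    intro u hu hT
    funext k
    simp only [Function.update_apply]
    split_ifs <;> simp_all
  constructor
  · rintro ⟨hT, u, _, m, h, rfl, rfl, u', _, m', h', rfl, rfl, hx⟩
    simp only [List.append_nil, hT] at h h'
    subst h'
    simp only [List.reverse_reverse, List.append_nil, hT] at hx
    rw [e u h hT] at hx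
    exact ⟨hT, m', by simp [h]; omega, by simpa [h] using hx⟩
  · rintro ⟨hT, m, rfl, hx⟩
    refine ⟨hT, s a, [], (s a).length + 1 + m, by simp, by omega, rfl, (s a).reverse, [], m,
      by simp [hT], by simp, rfl, ?_⟩
    simp only [List.reverse_reverse, List.append_nil, hT]
    rwa [e _ rfl hT]

theorem exec_prepend {a b : Reg} (haT : a ≠ T) (hbT : b ≠ T) (hab : a ≠ b) :
    Exec prog (prepend a b ++ l) s n s' ↔ s T = [] ∧ ∃ m, n = 2 * (s a).length + 2 + m ∧
      Exec prog l (Function.update (Function.update s a []) b (s a ++ s b)) m s' := by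
  simp only [prepend, List.cons_append, List.nil_append, exec_mv haT, exec_mv hbT.symm,
    exec_empty_iff, Function.update_of_ne haT, Function.update_self, Function.update_of_ne hab.symm,
    Function.update_of_ne hbT, Function.update_of_ne hbT.symm]
  have e : ∀ u : List Sym, s a = u → s T = [] → Function.update (Function.update
      (Function.update (Function.update s a []) T u.reverse) T []) b (u ++ s b) =
      Function.update (Function.update s a []) b (u ++ s b) := by
    intro u hu hT
    funext k
    simp only [Function.update_apply]
    split_ifs <;> simp_all
  constructor
  · rintro ⟨hT, u, _, m, h, rfl, rfl, u', _, m', h', rfl, rfl, hx⟩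
    simp only [List.append_nil, hT] at h h'
    subst h'
    simp only [List.reverse_reverse, List.append_nil, hT] at hx
    rw [e u h hT] at hx
    exact ⟨hT, m', by simp [h]; omega, by simpa [h] using hx⟩
  · rintro ⟨hT, m, rfl, hx⟩
    refine ⟨hT, s a, [], (s a).length + 1 + m, by simp, by omega, rfl, (s a).reverse, [], m,
      by simp [hT], by simp, rfl, ?_⟩
    simp only [List.reverse_reverse, List.append_nil, hT]
    rwa [e _ rfl hT]

theorem exec_matchPre {a b : Reg} (haV : a ≠ V) (hbT : b ≠ T) (hbV : b ≠ V) (hV : s V = []) :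
    Exec prog (matchPre a b ++ l) s n s' ↔ s T = [] ∧ ∃ r m, s a = s b ++ r ∧
      n = 3 * (s b).length + 3 + m ∧ Exec prog l (Function.update s a r) m s' := by
  simp only [matchPre, List.append_assoc, List.cons_append, List.nil_append,
    exec_copy hbT (show V ≠ T by decide) hbV, exec_eqPre haV, exec_empty_iff, Function.update_self,
    Function.update_of_ne haV]
  have e : ∀ r : List Sym, Function.update (Function.update (Function.update s V (s b ++ s V)) a r)
      V [] = Function.update s a r := by
    intro u
    funext k
    simp only [Function.update_apply]
    split_ifs <;> simp_all
  constructor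
  · rintro ⟨hT, m, rfl, u, r, _, m', h, h', rfl, rfl, hx⟩
    rw [hV, List.append_nil, List.append_nil] at h'
    rw [e] at hx
    exact ⟨hT, r, m', by rw [h, h'], by rw [h']; omega, hx⟩
  · rintro ⟨hT, r, m, h, rfl, hx⟩
    exact ⟨hT, (s b).length + 1 + m, by omega, s b, r, [], m, h, by rw [hV], rfl, rfl, by rwa [e]⟩

/-! ### Numbers of records -/

/-- The number `i` of a record. -/
def uid (i : ℕ) : List Sym := List.replicate i idU ++ [idE]

theorem length_uid (i : ℕ) : (uid i).length = i + 1 := by simp [uid]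

theorem eq_replicate_idU {u : List Sym} (hu : ∀ c ∈ u, c ∈ [idU]) :
    u = List.replicate u.length idU :=
  List.eq_replicate_iff.2 ⟨rfl, fun c hc => by simpa using hu c hc⟩

theorem mem_replicate_idU (i : ℕ) : ∀ c ∈ List.replicate i idU, c ∈ [idU] := by
  intro c hc
  simp [(List.mem_replicate.1 hc).2]

theorem exec_dropId {a : Reg} : Exec prog (call (.dropId a) :: l) s n s' ↔
    ∃ i r m, s a = uid i ++ r ∧ n = i + 1 + m ∧ Exec prog l (Function.update s a r) m s' := by
  rw [exec_transfer (f := .dropId a) (fins := [[pop a idE]]) (cs := [idU]) (p := [a]) (q := [])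
    (by simp) (by simp) (by simp) (fun b => by simp [prog])]
  simp only [transfer_drop]
  constructor
  · rintro ⟨u, hu, m, rfl, _, ⟨r, h, rfl⟩, e, he, hx⟩
    simp at he; subst he
    simp only [List.cons_append, List.nil_append, exec_pop_iff, Function.update_self,
      Function.update_idem] at hx
    obtain ⟨r, rfl, hx⟩ := hx
    exact ⟨u.length, r, m, by rw [h, uid, ← eq_replicate_idU hu]; simp, rfl, hx⟩
  · rintro ⟨i, r, m, h, rfl, hx⟩
    refine ⟨List.replicate i idU, mem_replicate_idU i, m, by simp, _,
      ⟨idE :: r, by simp [h, uid], rfl⟩, _, List.mem_singleton.2 rfl, ?_⟩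
    simpa [exec_pop_iff] using hx

theorem exec_takeId : Exec prog (call .takeId :: l) s n s' ↔
    ∃ i r m, s E = uid i ++ r ∧ n = i + 1 + m ∧
      Exec prog l (Function.update (Function.update s E r) N ((uid i).reverse ++ s N)) m s' := by
  rw [exec_transfer (f := .takeId) (fins := [[pop E idE, push N idE]]) (cs := [idU]) (p := [E])
    (q := [N]) (by simp) (by simp) (by simp) (fun b => by simp [prog])]
  simp only [transfer_mv (show E ≠ N by decide)]
  constructor
  · rintro ⟨u, hu, m, rfl, _, ⟨r, h, rfl⟩, e, he, hx⟩
    simp at he; subst he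
    simp only [List.cons_append, List.nil_append, exec_pop_iff, exec_push_iff, Function.update_self,
      Function.update_of_ne (show E ≠ N by decide),
      Function.update_of_ne (show N ≠ E by decide)] at hx
    obtain ⟨r, rfl, hx⟩ := hx
    have hu' := eq_replicate_idU hu
    refine ⟨u.length, r, m, by rw [h, uid, ← hu']; simp, rfl, ?_⟩
    rw [uid, ← hu']
    simpa [Function.update_comm (show N ≠ E by decide)] using hx
  · rintro ⟨i, r, m, h, rfl, hx⟩
    refine ⟨List.replicate i idU, mem_replicate_idU i, m, by simp, _,
      ⟨idE :: r, by simp [h, uid], rfl⟩, _, List.mem_singleton.2 rfl, ?_⟩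
    simpa [exec_pop_iff, exec_push_iff, uid, Function.update_comm (show N ≠ E by decide)] using hx

theorem exec_moveId : Exec prog (moveId ++ l) s n s' ↔
    ∃ i r m, s E = uid i ++ r ∧ n = i + 1 + m ∧
      Exec prog l (Function.update (Function.update s E r) N (uid i ++ s N)) m s' := by
  simp only [moveId, List.cons_append, List.nil_append, exec_push_iff]
  rw [exec_transfer (f := .mvU) (fins := [[pop E idE]]) (cs := [idU]) (p := [E])
    (q := [N]) (by simp) (by simp) (by simp) (fun b => by simp [prog])]
  simp only [transfer_mv (show E ≠ N by decide)]
  constructor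
  · rintro ⟨u, hu, m, rfl, _, ⟨r, h, rfl⟩, e, he, hx⟩
    simp at he; subst he
    simp only [List.cons_append, List.nil_append, exec_pop_iff, Function.update_self,
      Function.update_of_ne (show E ≠ N by decide)] at hx h
    obtain ⟨r, rfl, hx⟩ := hx
    have hu' := eq_replicate_idU hu
    refine ⟨u.length, r, m, by rw [h, uid, ← hu']; simp, rfl, ?_⟩
    rw [hu'] at hx
    simpa [Function.update_comm (show N ≠ E by decide), uid] using hx
  · rintro ⟨i, r, m, h, rfl, hx⟩
    refine ⟨List.replicate i idU, mem_replicate_idU i, m, by simp, _,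
      ⟨idE :: r, by simp [h, uid], rfl⟩, _, List.mem_singleton.2 rfl, ?_⟩
    simpa [exec_pop_iff, uid, Function.update_comm (show N ≠ E by decide)] using hx

theorem exec_eqId : Exec prog (call .eqId :: l) s n s' ↔
    ∃ i r r' m, s E = uid i ++ r ∧ s V = uid i ++ r' ∧ n = i + 1 + m ∧
      Exec prog l (Function.update (Function.update s E r) V r') m s' := by
  rw [exec_transfer (f := .eqId) (fins := [[pop E idE, pop V idE]]) (cs := [idU]) (p := [E, V])
    (q := []) (by simp) (by simp) (by simp) (fun b => by simp [prog])]
  simp only [transfer_eq (show E ≠ V by decide)]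
  constructor
  · rintro ⟨u, hu, m, rfl, _, ⟨r, r', h, h', rfl⟩, e, he, hx⟩
    simp at he; subst he
    simp only [List.cons_append, List.nil_append, exec_pop_iff, Function.update_self,
      Function.update_of_ne (show E ≠ V by decide),
      Function.update_of_ne (show V ≠ E by decide)] at hx
    obtain ⟨r, rfl, r', rfl, hx⟩ := hx
    have hu' := eq_replicate_idU hu
    refine ⟨u.length, r, r', m, by rw [h, uid, ← hu']; simp, by rw [h', uid, ← hu']; simp, rfl, ?_⟩
    simpa [Function.update_comm (show V ≠ E by decide)] using hx
  · rintro ⟨i, r, r', m, h, h', rfl, hx⟩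
    refine ⟨List.replicate i idU, mem_replicate_idU i, m, by simp, _,
      ⟨idE :: r, idE :: r', by simp [h, uid], by simp [h', uid], rfl⟩, _,
      List.mem_singleton.2 rfl, ?_⟩
    simpa [exec_pop_iff, Function.update_comm (show V ≠ E by decide)] using hx

theorem exec_mvUs : Exec prog (call .mvUs :: l) s n s' ↔
    ∃ i r m, s N = uid i ++ r ∧ n = i + 1 + m ∧ Exec prog l
      (Function.update (Function.update s N r) V (List.replicate i idU ++ s V)) m s' := by
  rw [exec_transfer (f := .mvUs) (fins := [[pop N idE]]) (cs := [idU]) (p := [N])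
    (q := [V]) (by simp) (by simp) (by simp) (fun b => by simp [prog])]
  simp only [transfer_mv (show N ≠ V by decide)]
  constructor
  · rintro ⟨u, hu, m, rfl, _, ⟨r, h, rfl⟩, e, he, hx⟩
    simp at he; subst he
    simp only [List.cons_append, List.nil_append, exec_pop_iff, Function.update_self,
      Function.update_of_ne (show N ≠ V by decide)] at hx
    obtain ⟨r, rfl, hx⟩ := hx
    have hu' := eq_replicate_idU hu
    refine ⟨u.length, r, m, by rw [h, uid, ← hu']; simp, rfl, ?_⟩
    rw [hu'] at hx
    simpa [Function.update_comm (show V ≠ N by decide)] using hx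
  · rintro ⟨i, r, m, h, rfl, hx⟩
    refine ⟨List.replicate i idU, mem_replicate_idU i, m, by simp, _,
      ⟨idE :: r, by simp [h, uid], rfl⟩, _, List.mem_singleton.2 rfl, ?_⟩
    simpa [exec_pop_iff, Function.update_comm (show V ≠ N by decide)] using hx

theorem uid_append_inj {i j : ℕ} {r r' : List Sym} :
    uid i ++ r = uid j ++ r' ↔ i = j ∧ r = r' := by
  constructor
  · intro h
    induction i generalizing j with
    | zero => cases j <;> simp [uid, List.replicate_succ] at h ⊢; exact h
    | succ i ih =>
      cases j with
      | zero => simp [uid, List.replicate_succ] at h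
      | succ j =>
        simp only [uid, List.replicate_succ, List.cons_append, List.cons.injEq, true_and] at h
        simpa using ih h
  · rintro ⟨rfl, rfl⟩; rfl

/-! ### Reading words of a category -/

theorem mem_skip {c : Cat} {a : Reg} {b : List I} : b ∈ prog (.skip c a) ↔
    ∃ x ns, expand c x = some ns ∧ b = pop a x :: ns.map fun m => call (.skip m a) := by
  simp only [prog, List.mem_filterMap, mem_syms, true_and, Option.map_eq_some_iff, @eq_comm _ b]

theorem mem_take {c : Cat} {a a' : Reg} {b : List I} : b ∈ prog (.take c a a') ↔
    ∃ x ns, expand c x = some ns ∧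
      b = pop a x :: push a' x :: ns.map fun m => call (.take m a a') := by
  simp only [prog, List.mem_filterMap, mem_syms, true_and, Option.map_eq_some_iff, @eq_comm _ b]

/-- Every call consumes exactly one symbol, so the cost is the length of the word that is removed.
The list of pending categories is a stack of calls, and the proof follows it for a general list. -/
theorem exec_skips {ns : List Cat} {a : Reg} :
    Exec prog ((ns.map fun m => call (.skip m a)) ++ l) s n s' ↔ ∃ v r m, s a = v ++ r ∧
      Reads ns v ∧ n = v.length + m ∧ Exec prog l (Function.update s a r) m s' := by
  constructor
  · intro hx
    induction n using Nat.strong_induction_on generalizing ns s with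
    | _ n ih =>
      cases ns with
      | nil => exact ⟨[], s a, n, rfl, .nil, by simp, by simpa using hx⟩
      | cons c ns =>
        simp only [List.map_cons, List.cons_append, exec_call_iff, mem_skip] at hx
        obtain ⟨m, rfl, _, ⟨x, ns', hns', rfl⟩, hx⟩ := hx
        simp only [List.cons_append, exec_pop_iff] at hx
        obtain ⟨r, hr, hx⟩ := hx
        rw [← List.append_assoc, ← List.map_append] at hx
        obtain ⟨v, r', m', h, hv, rfl, hx'⟩ := ih m (by omega) hx
        simp only [Function.update_self] at h
        subst h
        exact ⟨x :: v, r', m', hr, .cons hns' hv, by simp; omega, by simpa using hx'⟩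
  · rintro ⟨v, r, m, h, hv, rfl, hx⟩
    induction hv generalizing s with
    | nil =>
      simp only [List.nil_append] at h
      subst h
      simpa using hx
    | @cons c x ns ms v hc hv ih =>
      simp only [List.map_cons, List.cons_append, exec_call_iff, mem_skip]
      refine ⟨v.length + m, by simp; omega, _, ⟨x, ns, hc, rfl⟩, ?_⟩
      simp only [List.cons_append, exec_pop_iff]
      refine ⟨v ++ r, h, ?_⟩
      rw [← List.append_assoc, ← List.map_append]
      exact ih (by simp) (by simpa using hx)

theorem exec_skip {c : Cat} {a : Reg} : Exec prog (call (.skip c a) :: l) s n s' ↔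
    ∃ v r m, s a = v ++ r ∧ Reads [c] v ∧ n = v.length + m ∧
      Exec prog l (Function.update s a r) m s' :=
  exec_skips (ns := [c])

theorem exec_skip_of {c : Cat} {a : Reg} {v r : List Sym} (hv : Reads [c] v) (h : s a = v ++ r) :
    Exec prog (call (.skip c a) :: l) s n s' ↔
      ∃ m, n = v.length + m ∧ Exec prog l (Function.update s a r) m s' := by
  rw [exec_skip]
  constructor
  · rintro ⟨v', r', m, h', hv', rfl, hx⟩
    obtain ⟨rfl, rfl⟩ := hv.unique hv' (h.symm.trans h')
    exact ⟨m, rfl, hx⟩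
  · rintro ⟨m, rfl, hx⟩
    exact ⟨v, r, m, h, hv, rfl, hx⟩

theorem exec_takes {ns : List Cat} {a b : Reg} (hab : a ≠ b) :
    Exec prog ((ns.map fun m => call (.take m a b)) ++ l) s n s' ↔ ∃ v r m, s a = v ++ r ∧
      Reads ns v ∧ n = v.length + m ∧ Exec prog l
        (Function.update (Function.update s a r) b (v.reverse ++ s b)) m s' := by
  constructor
  · intro hx
    induction n using Nat.strong_induction_on generalizing ns s with
    | _ n ih =>
      cases ns with
      | nil => exact ⟨[], s a, n, rfl, .nil, by simp, by simpa using hx⟩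
      | cons c ns =>
        simp only [List.map_cons, List.cons_append, exec_call_iff, mem_take] at hx
        obtain ⟨m, rfl, _, ⟨x, ns', hns', rfl⟩, hx⟩ := hx
        simp only [List.cons_append, exec_pop_iff, exec_push_iff] at hx
        obtain ⟨r, hr, hx⟩ := hx
        rw [← List.append_assoc, ← List.map_append] at hx
        obtain ⟨v, r', m', h, hv, rfl, hx'⟩ := ih m (by omega) hx
        simp only [Function.update_self, Function.update_of_ne hab, Function.update_of_ne hab.symm]
          at h
        subst h
        refine ⟨x :: v, r', m', hr, .cons hns' hv, by simp; omega, ?_⟩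
        simpa [Function.update_comm hab, hab.symm] using hx'
  · rintro ⟨v, r, m, h, hv, rfl, hx⟩
    induction hv generalizing s with
    | nil =>
      simp only [List.nil_append] at h
      subst h
      simpa using hx
    | @cons c x ns ms v hc hv ih =>
      simp only [List.map_cons, List.cons_append, exec_call_iff, mem_take]
      refine ⟨v.length + m, by simp; omega, _, ⟨x, ns, hc, rfl⟩, ?_⟩
      simp only [List.cons_append, exec_pop_iff, exec_push_iff]
      refine ⟨v ++ r, h, ?_⟩
      rw [← List.append_assoc, ← List.map_append]
      refine ih (by simp [hab]) ?_
      simpa [Function.update_comm hab, hab.symm] using hx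

theorem exec_take_of {c : Cat} {a b : Reg} (hab : a ≠ b) {v r : List Sym} (hv : Reads [c] v)
    (h : s a = v ++ r) : Exec prog (call (.take c a b) :: l) s n s' ↔ ∃ m, n = v.length + m ∧
      Exec prog l (Function.update (Function.update s a r) b (v.reverse ++ s b)) m s' := by
  rw [show call (.take c a b) :: l = ([c].map fun m => call (.take m a b)) ++ l from rfl,
    exec_takes hab]
  constructor
  · rintro ⟨v', r', m, h', hv', rfl, hx⟩
    obtain ⟨rfl, rfl⟩ := hv.unique hv' (h.symm.trans h')
    exact ⟨m, rfl, hx⟩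
  · rintro ⟨m, rfl, hx⟩
    exact ⟨v, r, m, h, hv, rfl, hx⟩

theorem mem_splits {ns : List Cat} {z : List Cat × Cat} :
    z ∈ splits ns ↔ ∃ post, ns = z.1 ++ z.2 :: post := by
  induction ns generalizing z with
  | nil => simp [splits]
  | cons c ns ih =>
    obtain ⟨z1, z2⟩ := z
    simp only [splits, List.mem_cons, List.mem_map, Prod.mk.injEq, ih]
    constructor
    · rintro (⟨rfl, rfl⟩ | ⟨z, ⟨post, rfl⟩, rfl, rfl⟩)
      · exact ⟨ns, rfl⟩
      · exact ⟨post, rfl⟩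
    · rintro ⟨post, h⟩
      cases z1 with
      | nil => simp at h; exact .inl ⟨rfl, h.1.symm⟩
      | cons c' z1 =>
        simp at h
        obtain ⟨rfl, rfl⟩ := h
        exact .inr ⟨(z1, z2), ⟨post, rfl⟩, rfl, rfl⟩

theorem mem_bad {c : Cat} {a : Reg} {b : List I} : b ∈ prog (.bad c a) ↔ b = [tst a] ∨
    (∃ x, expand c x = none ∧ b = [pop a x]) ∨ ∃ x ns, expand c x = some ns ∧ ∃ z ∈ splits ns,
      b = pop a x :: ((z.1.map fun m => call (.skip m a)) ++ [call (.bad z.2 a)]) := by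
  simp only [prog, List.mem_cons, List.mem_flatMap, mem_syms, true_and]
  refine or_congr_right ⟨?_, ?_⟩
  · rintro ⟨x, hx⟩
    cases h : expand c x with
    | none => rw [h] at hx; exact .inl ⟨x, h, by simpa using hx⟩
    | some ns =>
      rw [h] at hx
      obtain ⟨z, hz, rfl⟩ := List.mem_map.1 hx
      exact .inr ⟨x, ns, h, z, hz, rfl⟩
  · rintro (⟨x, h, rfl⟩ | ⟨x, ns, h, z, hz, rfl⟩)
    · exact ⟨x, by simp [h]⟩
    · exact ⟨x, by rw [h]; exact List.mem_map.2 ⟨z, hz, rfl⟩⟩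

/-- In the recursive case the parts before the guessed one are uniquely determined prefixes, by
`Reads.unique`. So if the whole could be read, the guessed part could be read from the very position
at which the recursive call starts. -/
theorem not_reads_of_exec_bad {c : Cat} {a : Reg}
    (hx : Exec prog (call (.bad c a) :: l) s n s') : ¬ ∃ v r, s a = v ++ r ∧ Reads [c] v := by
  induction n using Nat.strong_induction_on generalizing c s with
  | _ n ih =>
    rintro ⟨v, r, h, hv⟩
    simp only [exec_call_iff, mem_bad] at hx
    obtain ⟨m, rfl, _, rfl | ⟨x, hx', rfl⟩ | ⟨x, ns, hns, z, hz, rfl⟩, hx⟩ := hx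
    · simp only [List.cons_append, List.nil_append, exec_empty_iff] at hx
      rw [hx.1] at h
      cases hv
      simp at h
    · simp only [List.cons_append, List.nil_append, exec_pop_iff] at hx
      obtain ⟨r', hr', -⟩ := hx
      cases hv with
      | cons h1 h2 =>
        rw [h, List.cons_append, List.cons.injEq] at hr'
        rw [hr'.1, hx'] at h1
        cases h1
    · simp only [List.cons_append, List.append_assoc, List.nil_append, exec_pop_iff] at hx
      obtain ⟨r', hr', hx⟩ := hx
      obtain ⟨v', r'', m', h', hv', rfl, hx'⟩ := exec_skips.1 hx
      simp only [Function.update_self] at h'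
      subst h'
      refine ih m' (by omega) hx' ?_
      simp only [Function.update_self]
      cases hv with
      | @cons _ c' ns' _ v h1 h2 =>
        rw [h, List.cons_append, List.cons.injEq] at hr'
        obtain ⟨rfl, hr'⟩ := hr'
        rw [hns] at h1
        cases h1
        rw [List.append_nil] at h2
        obtain ⟨post, hpost⟩ := mem_splits.1 hz
        obtain ⟨v₁, w, rfl, h3, h4⟩ := h2.split hpost
        obtain ⟨v₂, v₃, rfl, h5, h6⟩ := h4.cons_split
        rw [List.append_assoc] at hr'
        obtain ⟨rfl, rfl⟩ := h3.unique hv' hr'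
        exact ⟨v₂, v₃ ++ r, by simp, h5⟩

/-- Take the first category at which reading gets stuck. -/
theorem exists_split_of_not_reads {ns : List Cat} {x : List Sym}
    (h : ¬ ∃ v r, x = v ++ r ∧ Reads ns v) : ∃ z ∈ splits ns, ∃ v r, x = v ++ r ∧ Reads z.1 v ∧
      ¬ ∃ v' r', r = v' ++ r' ∧ Reads [z.2] v' := by
  induction ns generalizing x with
  | nil => exact absurd ⟨[], x, rfl, .nil⟩ h
  | cons c ns ih =>
    by_cases hc : ∃ v r, x = v ++ r ∧ Reads [c] v
    · obtain ⟨v, r, rfl, hv⟩ := hc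
      obtain ⟨z, hz, v', r', rfl, hv', h'⟩ := ih (x := r) (by
        rintro ⟨v', r', rfl, hv'⟩
        exact h ⟨v ++ v', r', by simp, hv.append hv'⟩)
      exact ⟨(c :: z.1, z.2), List.mem_cons_of_mem _ (List.mem_map.2 ⟨z, hz, rfl⟩), v ++ v', r',
        by simp, hv.append hv', h'⟩
    · exact ⟨([], c), List.mem_cons_self, [], x, rfl, .nil, hc⟩

theorem exec_bad_of_not_reads {c : Cat} {a : Reg} (k : ℕ) (hk : (s a).length ≤ k)
    (h : ¬ ∃ v r, s a = v ++ r ∧ Reads [c] v) :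
    ∃ n ≤ (s a).length + 1, ∃ s', Exec prog [call (.bad c a)] s n s' := by
  induction k generalizing c s with
  | zero =>
    have : s a = [] := by simpa using hk
    refine ⟨1, by omega, s, ?_⟩
    rw [exec_call_iff]
    exact ⟨0, rfl, _, mem_bad.2 (.inl rfl), by simp [exec_empty_iff, exec_nil_iff, this]⟩
  | succ k ih =>
    cases hs : s a with
    | nil =>
      refine ⟨1, by omega, s, ?_⟩
      rw [exec_call_iff]
      exact ⟨0, rfl, _, mem_bad.2 (.inl rfl), by simp [exec_empty_iff, exec_nil_iff, hs]⟩
    | cons x w =>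
      rw [hs] at h hk
      simp only [List.length_cons, Nat.add_le_add_iff_right] at hk
      cases hc : expand c x with
      | none =>
        refine ⟨1, by omega, Function.update s a w, ?_⟩
        rw [exec_call_iff]
        exact ⟨0, rfl, _, mem_bad.2 (.inr (.inl ⟨x, hc, rfl⟩)),
          by simp [exec_pop_iff, exec_nil_iff, hs]⟩
      | some ns =>
        obtain ⟨z, hz, v, r, rfl, hv, h'⟩ := exists_split_of_not_reads (ns := ns) (x := w) (by
          rintro ⟨v, r, rfl, hv⟩
          exact h ⟨x :: v, r, rfl, .cons hc (by simpa using hv)⟩)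
        rw [List.length_append] at hk
        obtain ⟨m, hm, s', hx⟩ := ih (c := z.2) (s := Function.update s a r)
          (by simp; omega) (by simpa using h')
        simp only [Function.update_self] at hm
        refine ⟨v.length + m + 1, by simp; omega, s', ?_⟩
        rw [exec_call_iff]
        refine ⟨_, rfl, _, mem_bad.2 (.inr (.inr ⟨x, ns, hc, z, hz, rfl⟩)), ?_⟩
        simp only [List.cons_append, List.append_assoc, List.nil_append, exec_pop_iff, hs]
        exact ⟨_, rfl, exec_skips.2 ⟨v, r, m, by simp, hv, rfl, by simpa using hx⟩⟩

end XPathDTD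

/-! ## Trees as an inductive type -/

namespace XPathDTD

/-- Finite ordered labelled trees. -/
inductive Tr
  | node (a : Label) (ch : List Tr)

namespace Tr

/-- The label of the root. -/
def lab : Tr → Label
  | node a _ => a

/-- The subtrees at the children of the root. -/
def ch : Tr → List Tr
  | node _ ts => ts

theorem ind {p : Tr → Prop} (h : ∀ a ts, (∀ c ∈ ts, p c) → p (node a ts)) : ∀ t, p t
  | node a ts => h a ts fun c _ => ind h c
termination_by t => sizeOf t
decreasing_by
  have := List.sizeOf_lt_of_mem ‹c ∈ ts›
  simp only [node.sizeOf_spec]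
  omega

/-- A tree conforms to a list of rules, regardless of the label of the root. -/
inductive Conf (ρs : List (Label × RegularExpression Label)) : Tr → Prop
  | node {a r ts} : (a, r) ∈ ρs → ts.map lab ∈ r.matches' → (∀ c ∈ ts, Conf ρs c) →
      Conf ρs (node a ts)

/-- The subtree at a vertex. -/
def sub : Tr → Vertex → Option Tr
  | t, [] => some t
  | t, i :: v => t.ch[i]?.bind fun c => sub c v

theorem sub_append (t : Tr) (v : Vertex) (i : ℕ) : t.sub (v ++ [i]) =
    (t.sub v).bind (·.ch[i]?) := by
  induction v generalizing t with
  | nil => simp [sub]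
  | cons j v ih =>
    simp only [List.cons_append, sub]
    cases t.ch[j]? <;> simp [ih]

theorem finite_dom : ∀ t : Tr, {v | (t.sub v).isSome}.Finite := by
  refine ind fun a ts ih => ?_
  have : {v | ((node a ts).sub v).isSome} ⊆
      {[]} ∪ ⋃ i : Fin ts.length, List.cons i.1 '' {v | (ts[i].sub v).isSome} := by
    rintro (_ | ⟨i, v⟩) hv
    · exact .inl rfl
    · right
      simp only [Set.mem_ofPred_eq, sub, ch] at hv
      by_cases hi : i < ts.length
      · rw [List.getElem?_eq_getElem hi] at hv
        exact Set.mem_iUnion.2 ⟨⟨i, hi⟩, v, hv, rfl⟩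
      · rw [List.getElem?_eq_none (by omega)] at hv
        simp at hv
  refine Set.Finite.subset ?_ this
  exact (Set.finite_singleton _).union
    (Set.finite_iUnion fun i => (ih _ (List.getElem_mem _)).image _)

/-- The tree domain of a tree. -/
noncomputable def toXML (t : Tr) : XMLTree where
  dom := t.finite_dom.toFinset
  -- The default label is used only outside the tree domain.
  lab v := ((t.sub v).map lab).getD []
  root_mem := by simp [sub]
  parent_mem v i h := by
    simp only [Set.Finite.mem_toFinset, Set.mem_ofPred_eq, sub_append] at h ⊢
    cases hv : t.sub v <;> simp [hv] at h ⊢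
  sibling_mem v i h := by
    simp only [Set.Finite.mem_toFinset, Set.mem_ofPred_eq, sub_append] at h ⊢
    cases hv : t.sub v <;> simp [hv] at h ⊢
    omega

end Tr

/-- The subtree of `t` at the vertex `v` is the given tree. -/
inductive IsSub (t : XMLTree) : Vertex → Tr → Prop
  | mk {v ts} : t.HasArity v ts.length → (∀ i (h : i < ts.length), IsSub t (v ++ [i]) ts[i]) →
      IsSub t v (.node (t.lab v) ts)

theorem IsSub.lab {t : XMLTree} {v : Vertex} {S : Tr} (h : IsSub t v S) : S.lab = t.lab v := by
  cases h; rfl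

theorem Tr.isSub_toXML (T : Tr) : ∀ (S : Tr) (v : Vertex), T.sub v = some S →
    IsSub T.toXML v S := by
  refine Tr.ind fun a ts ih v hv => ?_
  have h : IsSub T.toXML v (node (T.toXML.lab v) ts) := by
    refine .mk (fun i => ?_) fun i hi => ih _ (List.getElem_mem _) _ ?_
    · simp [toXML, sub_append, hv, Tr.ch]
    · simp [sub_append, hv, Tr.ch, List.getElem?_eq_getElem hi]
  have ha : T.toXML.lab v = a := by simp [toXML, hv, Tr.lab]
  rwa [ha] at h

/-- The number `k` bounds how far the finite domain extends below `v`, and the subtree is assembled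
by induction on it. The arities come from conformity in the application. -/
theorem exists_isSub {t : XMLTree} (ha : ∀ u ∈ t.dom, ∃ n, t.HasArity u n) (k : ℕ) :
    ∀ v ∈ t.dom, (∀ u ∈ t.dom, u.length ≤ v.length + k) → ∃ T, IsSub t v T := by
  induction k with
  | zero =>
    intro v hv hk
    obtain ⟨n, hn⟩ := ha v hv
    have : n = 0 := by
      by_contra h0
      have := hk _ ((hn 0).2 (by omega))
      simp at this
    subst this
    exact ⟨.node (t.lab v) [], .mk hn (by simp)⟩
  | succ k ih =>
    intro v hv hk
    obtain ⟨n, hn⟩ := ha v hv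
    have : ∀ i : Fin n, ∃ T, IsSub t (v ++ [i.1]) T := fun i =>
      ih _ ((hn i).2 i.2) fun u hu => by have := hk u hu; simp; omega
    choose f hf using this
    refine ⟨.node (t.lab v) (List.ofFn f), .mk (by simpa using hn) fun i hi => ?_⟩
    simpa using hf ⟨i, by simpa using hi⟩

-- Paths evaluated on subtrees instead of vertices.

mutual
/-- The relation on trees, seen as subtrees of a given tree, that a location path defines. -/
def SemT : XPath → Tr → Tr → Prop
  | .step .self a es, S, S' => S' = S ∧ S'.lab = a ∧ AllT es S'
  | .step .child a es, S, S' => S' ∈ S.ch ∧ S'.lab = a ∧ AllT es S'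
  | .comp p q, S, U => ∃ S₁, SemT p S S₁ ∧ SemT q S₁ U
/-- All filters of a list are true at the root. -/
def AllT : List XPath → Tr → Prop
  | [], _ => True
  | e :: es, S => (∃ S', SemT e S S') ∧ AllT es S
end

theorem IsSub.exists_child {t : XMLTree} {v : Vertex} {S S' : Tr} (h : IsSub t v S)
    (hS : S' ∈ S.ch) : ∃ i, v ++ [i] ∈ t.dom ∧ IsSub t (v ++ [i]) S' := by
  cases h with
  | mk h1 h2 =>
    obtain ⟨i, hi, rfl⟩ := List.getElem_of_mem hS
    exact ⟨i, (h1 i).2 hi, h2 i hi⟩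

theorem IsSub.child {t : XMLTree} {v : Vertex} {S : Tr} (h : IsSub t v S) {i : ℕ}
    (hi : v ++ [i] ∈ t.dom) : ∃ S' ∈ S.ch, IsSub t (v ++ [i]) S' := by
  cases h with
  | mk h1 h2 => exact ⟨_, List.getElem_mem ((h1 i).1 hi), h2 i ((h1 i).1 hi)⟩

mutual
-- Both axes lead downwards, so what a path does from a vertex depends only on the subtree there. A
-- relation between subtrees forgets the position, but this is harmless: equal subtrees satisfy the
-- same paths. The converse is `sem_of_semT`.
theorem semT_of_sem {t : XMLTree} : ∀ {p : XPath} {v w : Vertex} {S : Tr}, IsSub t v S →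
    p.Sem t v w → ∃ S', IsSub t w S' ∧ SemT p S S'
  | .step .self a es, v, w, S, h, hp => by
    simp only [XPath.Sem, Axis.Rel] at hp
    obtain ⟨h1, h2, rfl, rfl, h3⟩ := hp
    exact ⟨S, h, by simp only [SemT]; exact ⟨trivial, h.lab, allT_of_allHold h h3⟩⟩
  | .step .child a es, v, w, S, h, hp => by
    simp only [XPath.Sem, Axis.Rel] at hp
    obtain ⟨h1, h2, ⟨i, rfl⟩, rfl, h3⟩ := hp
    obtain ⟨S', hS', h'⟩ := h.child h2
    exact ⟨S', h', by simp only [SemT]; exact ⟨hS', h'.lab, allT_of_allHold h' h3⟩⟩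
  | .comp p q, v, w, S, h, hp => by
    simp only [XPath.Sem] at hp
    obtain ⟨u, h1, h2⟩ := hp
    obtain ⟨S₁, h3, h4⟩ := semT_of_sem h h1
    obtain ⟨S₂, h5, h6⟩ := semT_of_sem h3 h2
    exact ⟨S₂, h5, by simp only [SemT]; exact ⟨S₁, h4, h6⟩⟩
theorem allT_of_allHold {t : XMLTree} : ∀ {es : List XPath} {v : Vertex} {S : Tr}, IsSub t v S →
    XPath.AllHold t es v → AllT es S
  | [], _, _, _, _ => by simp only [AllT]
  | e :: es, v, S, h, hp => by
    simp only [XPath.AllHold] at hp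
    obtain ⟨⟨w, h1⟩, h2⟩ := hp
    obtain ⟨S', -, h3⟩ := semT_of_sem h h1
    simp only [AllT]
    exact ⟨⟨S', h3⟩, allT_of_allHold h h2⟩
end

mutual
theorem sem_of_semT {t : XMLTree} : ∀ {p : XPath} {v : Vertex} {S S' : Tr}, IsSub t v S →
    v ∈ t.dom → SemT p S S' → ∃ w ∈ t.dom, IsSub t w S' ∧ p.Sem t v w
  | .step .self a es, v, S, S', h, hv, hp => by
    simp only [SemT] at hp
    obtain ⟨rfl, rfl, h3⟩ := hp
    refine ⟨v, hv, h, ?_⟩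
    simp only [XPath.Sem, Axis.Rel]
    exact ⟨hv, hv, trivial, h.lab.symm, allHold_of_allT h hv h3⟩
  | .step .child a es, v, S, S', h, hv, hp => by
    simp only [SemT] at hp
    obtain ⟨h1, rfl, h3⟩ := hp
    obtain ⟨i, hi, h'⟩ := h.exists_child h1
    refine ⟨_, hi, h', ?_⟩
    simp only [XPath.Sem, Axis.Rel]
    exact ⟨hv, hi, ⟨i, rfl⟩, h'.lab.symm, allHold_of_allT h' hi h3⟩
  | .comp p q, v, S, S', h, hv, hp => by
    simp only [SemT] at hp
    obtain ⟨S₁, h1, h2⟩ := hp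
    obtain ⟨u, hu, h3, h4⟩ := sem_of_semT h hv h1
    obtain ⟨w, hw, h5, h6⟩ := sem_of_semT h3 hu h2
    refine ⟨w, hw, h5, ?_⟩
    simp only [XPath.Sem]
    exact ⟨u, h4, h6⟩
theorem allHold_of_allT {t : XMLTree} : ∀ {es : List XPath} {v : Vertex} {S : Tr}, IsSub t v S →
    v ∈ t.dom → AllT es S → XPath.AllHold t es v
  | [], _, _, _, _, _ => by simp only [XPath.AllHold]
  | e :: es, v, S, h, hv, hp => by
    simp only [AllT] at hp
    obtain ⟨⟨S', h1⟩, h2⟩ := hp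
    obtain ⟨w, -, -, h3⟩ := sem_of_semT h hv h1
    simp only [XPath.AllHold]
    exact ⟨⟨w, h3⟩, allHold_of_allT h hv h2⟩
end

theorem HasArity.unique {t : XMLTree} {v : Vertex} {m n : ℕ} (hm : t.HasArity v m)
    (hn : t.HasArity v n) : m = n := by
  have h : ∀ i, i < m ↔ i < n := fun i => (hm i).symm.trans (hn i)
  have := h m
  have := h n
  omega

theorem IsSub.map_lab {t : XMLTree} {v : Vertex} {ts : List Tr} {a : Label}
    (h : IsSub t v (.node a ts)) : ts.map Tr.lab = t.childWord v ts.length := by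
  cases h with
  | mk h1 h2 =>
    refine List.ext_getElem (by simp [XMLTree.childWord]) fun i hi _ => ?_
    simp only [List.length_map] at hi
    simpa [XMLTree.childWord] using (h2 i hi).lab

theorem IsSub.conf {t : XMLTree} {d : DTD} (hd : t.Conforms d) : ∀ (T : Tr) (v : Vertex),
    v ∈ t.dom → IsSub t v T → T.Conf d.rules := by
  refine Tr.ind fun a ts ih v hv h => ?_
  obtain ⟨n, hn, r, hr, hw⟩ := hd.2 v hv
  have hlab := h.map_lab
  have hch := fun i => h.exists_child (S' := i)
  cases h with
  | mk h1 h2 =>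
    rw [← HasArity.unique h1 hn, ← hlab] at hw
    refine .node hr hw fun c hc => ?_
    obtain ⟨i, hi, hi'⟩ := hch c hc
    exact ih c hc _ hi hi'

/-- Counterexamples to containment can be taken to be inductive trees. -/
theorem not_containedIn_iff {d : DTD} {p q : XPath} : ¬ ContainedIn d p q ↔
    ∃ T : Tr, T.lab = d.start ∧ T.Conf d.rules ∧ (∃ S, SemT p T S) ∧ ¬ ∃ S, SemT q T S := by
  constructor
  · intro h
    simp only [ContainedIn, not_forall] at h
    obtain ⟨t, ht, ⟨w, hp⟩, hq⟩ := h
    obtain ⟨T, hT⟩ := exists_isSub (fun u hu => (ht.2 u hu).imp fun n hn => hn.1)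
      (t.dom.sup List.length) [] t.root_mem fun u hu => by
        simpa using Finset.le_sup (f := List.length) hu
    refine ⟨T, hT.lab.trans ht.1, hT.conf ht _ _ t.root_mem, ?_, ?_⟩
    · obtain ⟨S, -, hS⟩ := semT_of_sem hT hp
      exact ⟨S, hS⟩
    · rintro ⟨S, hS⟩
      obtain ⟨w, -, -, hw⟩ := sem_of_semT hT t.root_mem hS
      exact hq ⟨w, hw⟩
  · rintro ⟨T, hT, hc, ⟨S, hS⟩, hq⟩ h
    have hsub : ∀ v S, T.sub v = some S → IsSub T.toXML v S := fun v S => T.isSub_toXML S v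
    have hroot := hsub [] T rfl
    have hconf : ∀ (v : Vertex) (S : Tr), T.sub v = some S → S.Conf d.rules := by
      intro v
      -- Conformity passes from a subtree to the subtrees at its children, so the induction appends
      -- one child number at a time.
      induction v using List.reverseRecOn with
      | nil => rintro S ⟨⟩; exact hc
      | append_singleton v i ih =>
        intro S hS
        rw [Tr.sub_append] at hS
        cases hv : T.sub v with
        | none => simp [hv] at hS
        | some S' =>
          rw [hv] at hS
          cases ih S' hv with
          | node _ _ h3 => exact h3 _ (List.mem_of_getElem? hS)
    have hd : T.toXML.Conforms d := by
      refine ⟨hroot.lab.symm.trans hT, fun u hu => ?_⟩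
      obtain ⟨S', hS'⟩ := Option.isSome_iff_exists.1 (by simpa [Tr.toXML] using hu)
      have h1 := hsub u S' hS'
      have h2 := hconf u S' hS'
      cases h2 with
      | @node a r ts hr hw hts =>
        refine ⟨ts.length, ?_, r, ?_, ?_⟩
        · cases h1; assumption
        · rw [← h1.lab]; exact hr
        · rw [← h1.map_lab]; exact hw
    obtain ⟨w, -, -, hw⟩ := sem_of_semT hroot T.toXML.root_mem hS
    obtain ⟨w', hw'⟩ := h T.toXML hd ⟨w, hw⟩
    obtain ⟨S', -, hS'⟩ := semT_of_sem hroot hw'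
    exact hq ⟨S', hS'⟩

/-! ### Sequences of location paths -/

/-- The composition of a list of location paths selects some vertex. -/
def Sat : List XPath → Tr → Prop
  | [], _ => True
  | p :: ps, S => ∃ S', SemT p S S' ∧ Sat ps S'

theorem sat_singleton {p : XPath} {S : Tr} : Sat [p] S ↔ ∃ S', SemT p S S' := by simp [Sat]

theorem sat_comp {p q : XPath} {ps : List XPath} {S : Tr} :
    Sat (.comp p q :: ps) S ↔ Sat (p :: q :: ps) S := by
  simp only [Sat, SemT]
  constructor
  · rintro ⟨S', ⟨S₁, h1, h2⟩, h3⟩; exact ⟨S₁, h1, S', h2, h3⟩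
  · rintro ⟨S₁, h1, S', h2, h3⟩; exact ⟨S', ⟨S₁, h1, h2⟩, h3⟩

theorem sat_self {a : Label} {es ps : List XPath} {S : Tr} :
    Sat (.step .self a es :: ps) S ↔ S.lab = a ∧ AllT es S ∧ Sat ps S := by
  simp only [Sat, SemT]
  constructor
  · rintro ⟨S', ⟨rfl, h1, h2⟩, h3⟩; exact ⟨h1, h2, h3⟩
  · rintro ⟨h1, h2, h3⟩; exact ⟨S, ⟨rfl, h1, h2⟩, h3⟩

/-- This is the only rule that moves to a child. It makes every requirement at a child start with a
self step, and it is the source of the goals of the form `.self :: t`. -/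
theorem sat_child {a : Label} {es ps : List XPath} {S : Tr} :
    Sat (.step .child a es :: ps) S ↔ ∃ S' ∈ S.ch, Sat (.step .self a es :: ps) S' := by
  simp only [sat_self]
  simp only [Sat, SemT]
  constructor
  · rintro ⟨S', ⟨h0, h1, h2⟩, h3⟩; exact ⟨S', h0, h1, h2, h3⟩
  · rintro ⟨S', h0, h1, h2, h3⟩; exact ⟨S', ⟨h0, h1, h2⟩, h3⟩

theorem allT_iff {es : List XPath} {S : Tr} : AllT es S ↔ ∀ e ∈ es, Sat [e] S := by
  induction es with
  | nil => simp [AllT]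
  | cons e es ih => simp only [AllT, ih, List.forall_mem_cons, sat_singleton]

mutual
/-- The weight of a location path: its size, where child steps count twice. -/
def weight : XPath → ℕ
  | .step .self _ es => 1 + weights es
  | .step .child _ es => 2 + weights es
  | .comp p q => 1 + weight p + weight q
/-- The sum of the weights of a list of location paths. -/
def weights : List XPath → ℕ
  | [] => 0
  | e :: es => weight e + weights es
end

mutual
theorem weight_le : ∀ p : XPath, weight p ≤ 2 * (encXPath p).length
  | .step .self a es => by
    have := weights_le es
    simp only [weight, encXPath, List.length_cons, List.length_append]; omega
  | .step .child a es => by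
    have := weights_le es
    simp only [weight, encXPath, List.length_cons, List.length_append]; omega
  | .comp p q => by
    have := weight_le p
    have := weight_le q
    simp only [weight, encXPath, List.length_cons, List.length_append]; omega
theorem weights_le : ∀ es : List XPath, weights es ≤ 2 * (encFilters es).length
  | [] => by simp [weights]
  | e :: es => by
    have := weight_le e
    have := weights_le es
    simp only [weights, encFilters, List.length_cons, List.length_append]; omega
end

end XPathDTD

/-! ## Goals that fail -/

namespace XPathDTD

/-- The encodings of a list of location paths, one after the other. -/
def encs (L : List XPath) : List Sym := L.flatMap encXPath

@[simp] theorem encs_nil : encs [] = [] := rfl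
@[simp] theorem encs_cons (p : XPath) (L : List XPath) : encs (p :: L) = encXPath p ++ encs L := rfl

/-- A word at which a sequence of location paths ends. -/
def Term (w : List Sym) : Prop := ∀ c u, w = c :: u → c = .more ∨ c = .done

theorem term_nil : Term [] := by simp [Term]

/-- When a filter is picked as the goal, the remaining filters and the rest of the path stay behind
it as unread garbage. The garbage starts with `more` or `done`, so it is visible where the goal
ends. -/
theorem term_encFilters (es : List XPath) (w : List Sym) : Term (encFilters es ++ w) := by
  cases es <;> simp [Term, encFilters]

/-- At a vertex with label `a`, the goal `s` fails if the goal `h` fails at all children. For the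
flag `true`, the word `s` starts with a list of filters. -/
inductive Red (a : Label) : Bool → List Sym → List Sym → Prop
  | slash {s h} : Red a false s h → Red a false (.slash :: s) h
  | neq {x s} : x ≠ a → Red a false (.self :: (encLabel x ++ s)) [noGoal]
  | self {x s h} : Red a true s h → Red a false (.self :: (encLabel x ++ s)) h
  | child {s} : Red a false (.child :: s) (.self :: s)
  | noGoal {s} : Red a false (noGoal :: s) (noGoal :: s)
  | pick {s h} : Red a false s h → Red a true (.more :: s) h
  | skip {e s h} : Red a true s h → Red a true (.more :: (encXPath e ++ s)) h
  | done {s h} : Red a false s h → Red a true (.done :: s) h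

/-- Some child of the tree satisfies a sequence of location paths at the head of `h`. -/
def ChildSat (h : List Sym) (S : Tr) : Prop :=
  ∃ c ∈ S.ch, ∃ L w, Term w ∧ h = encs L ++ w ∧ Sat L c

/-- Soundness of the reduction in contrapositive form: a goal that holds at a vertex leaves its
reduced goal true at some child. In each case, the first symbol of `s` together with `Term w`
excludes that the sequence of paths is empty, and the prefix code property recovers its first path.
For `noGoal` no parse exists at all. -/
theorem Red.childSat {S : Tr} {b : Bool} {s h : List Sym} (hr : Red S.lab b s h) :
    (b = false → ∀ L w, Term w → s = encs L ++ w → Sat L S → ChildSat h S) ∧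
    (b = true → ∀ es L w, Term w → s = encFilters es ++ (encs L ++ w) → AllT es S → Sat L S →
      ChildSat h S) := by
  induction hr with
  | @slash s h hr ih =>
    refine ⟨fun _ L w hw hs hL => ?_, by simp⟩
    match L with
    | [] => simp only [encs_nil, List.nil_append] at hs; simpa using hw _ _ hs.symm
    | .step ax a es :: L => cases ax <;> simp [encXPath, encAxis] at hs
    | .comp p q :: L =>
      simp only [encs_cons, encXPath, List.cons_append, List.cons.injEq, true_and] at hs
      exact ih.1 rfl (p :: q :: L) w hw (by simpa using hs) (sat_comp.1 hL)
  | @neq x s hx =>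
    refine ⟨fun _ L w hw hs hL => ?_, by simp⟩
    match L with
    | [] => simp only [encs_nil, List.nil_append] at hs; simpa using hw _ _ hs.symm
    | .step .child a es :: L => simp [encXPath, encAxis] at hs
    | .comp p q :: L => simp [encXPath] at hs
    | .step .self a es :: L =>
      simp only [encs_cons, encXPath, encAxis, List.cons_append, List.cons.injEq, true_and,
        List.append_assoc] at hs
      obtain ⟨rfl, -⟩ := encLabel_inj hs
      exact absurd (sat_self.1 hL).1.symm hx
  | @self x s h hr ih =>
    refine ⟨fun _ L w hw hs hL => ?_, by simp⟩
    match L with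
    | [] => simp only [encs_nil, List.nil_append] at hs; simpa using hw _ _ hs.symm
    | .step .child a es :: L => simp [encXPath, encAxis] at hs
    | .comp p q :: L => simp [encXPath] at hs
    | .step .self a es :: L =>
      simp only [encs_cons, encXPath, encAxis, List.cons_append, List.cons.injEq, true_and,
        List.append_assoc] at hs
      replace hs := encLabel_inj hs
      obtain ⟨rfl, hs⟩ := hs
      obtain ⟨-, h1, h2⟩ := sat_self.1 hL
      exact ih.2 rfl es L w hw hs h1 h2
  | @child s =>
    refine ⟨fun _ L w hw hs hL => ?_, by simp⟩
    match L with
    | [] => simp only [encs_nil, List.nil_append] at hs; simpa using hw _ _ hs.symm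
    | .step .self a es :: L => simp [encXPath, encAxis] at hs
    | .comp p q :: L => simp [encXPath] at hs
    | .step .child a es :: L =>
      simp only [encs_cons, encXPath, encAxis, List.cons_append, List.cons.injEq, true_and] at hs
      obtain ⟨c, hc, h1⟩ := sat_child.1 hL
      exact ⟨c, hc, .step .self a es :: L, w, hw, by simp [hs, encXPath, encAxis], h1⟩
  | @noGoal s =>
    refine ⟨fun _ L w hw hs hL => ?_, by simp⟩
    match L with
    | [] => simp only [encs_nil, List.nil_append] at hs; simpa using hw _ _ hs.symm
    | .step ax a es :: L => cases ax <;> simp [encXPath, encAxis] at hs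
    | .comp p q :: L => simp [encXPath] at hs
  | @pick s h hr ih =>
    refine ⟨by simp, fun _ es L w hw hs h1 h2 => ?_⟩
    match es with
    | [] => simp [encFilters] at hs
    | e :: es =>
      simp only [encFilters, List.cons_append, List.cons.injEq, true_and, List.append_assoc] at hs
      exact ih.1 rfl [e] _ (term_encFilters es _) (by simpa using hs)
        (allT_iff.1 h1 e (by simp))
  | @skip e s h hr ih =>
    refine ⟨by simp, fun _ es L w hw hs h1 h2 => ?_⟩
    match es with
    | [] => simp [encFilters] at hs
    | e' :: es =>
      simp only [encFilters, List.cons_append, List.cons.injEq, true_and, List.append_assoc] at hs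
      replace hs := encXPath_inj hs
      obtain ⟨rfl, hs⟩ := hs
      simp only [AllT] at h1
      exact ih.2 rfl es L w hw hs h1.2 h2
  | @done s h hr ih =>
    refine ⟨by simp, fun _ es L w hw hs h1 h2 => ?_⟩
    match es with
    | [] =>
      simp only [encFilters, List.cons_append, List.cons.injEq, true_and, List.nil_append] at hs
      exact ih.1 rfl L w hw hs h2
    | e :: es => simp [encFilters] at hs

/-- The goal fails at the root of the tree. -/
inductive FailS : List Sym → Tr → Prop
  | node {a ts s h} : Red a false s h → (∀ c ∈ ts, FailS h c) → FailS s (.node a ts)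

/-- If the goal held, `Red.childSat` would produce a child at which the reduced goal holds, although
it fails there by the annotation. -/
theorem FailS.not_sat : ∀ (T : Tr) {L : List XPath} {w : List Sym}, Term w →
    FailS (encs L ++ w) T → ¬ Sat L T := by
  refine Tr.ind fun a ts ih L w hw hf hs => ?_
  cases hf with
  | node hr hc =>
    obtain ⟨c, hc', L', w', hw', rfl, hs'⟩ :=
      (Red.childSat (S := .node a ts) hr).1 rfl L w hw rfl hs
    exact ih c hc' hw' (hc c hc') hs'

theorem failS_noGoal : ∀ T : Tr, FailS [noGoal] T :=
  Tr.ind fun _ _ ih => .node .noGoal ih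

/-- At the tree `c`, the goal `h` does not hold. -/
def NotSat (h : List Sym) (c : Tr) : Prop :=
  h = [noGoal] ∨ ∃ L w, h = encs L ++ w ∧ ¬ Sat L c

/-- Completeness of the reduction. A conjunction fails because of a single conjunct, and the blame
is followed by induction on the weight until it reaches a wrong label or a child step. There the
negation of "some child" is "all children", so one goal serves for all of them. -/
theorem exists_red (S : Tr) : ∀ (L : List XPath) (w : List Sym), ¬ Sat L S →
    ∃ h, Red S.lab false (encs L ++ w) h ∧ ∀ c ∈ S.ch, NotSat h c := by
  suffices hn : ∀ n, ∀ (L : List XPath) (w : List Sym), weights L < n → ¬ Sat L S →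
      ∃ h, Red S.lab false (encs L ++ w) h ∧ ∀ c ∈ S.ch, NotSat h c from
    fun L w => hn _ L w (Nat.lt_succ_self _)
  intro n
  induction n with
  | zero => simp
  | succ n ih =>
    intro L w hn hL
    match L with
    | [] => simp [Sat] at hL
    | .comp p q :: L =>
      rw [sat_comp] at hL
      obtain ⟨h, h1, h2⟩ := ih _ w (by simp only [weights, weight] at hn ⊢; omega) hL
      exact ⟨h, by simpa [encXPath] using Red.slash h1, h2⟩
    | .step .child a es :: L =>
      refine ⟨_, by simpa [encXPath, encAxis] using Red.child, fun c hc => .inr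
        ⟨.step .self a es :: L, w, by simp [encXPath, encAxis], fun h => hL ?_⟩⟩
      exact sat_child.2 ⟨c, hc, h⟩
    | .step .self a es :: L =>
      by_cases ha : a = S.lab
      -- Blame the first filter that fails, or `L` if there is none. A picked filter turns the
      -- remaining filters and `L` into garbage behind the goal, which is why `w` is arbitrary in
      -- the statement.
      · have key : ∀ fs : List XPath, weights fs + weights L < n → ¬ (AllT fs S ∧ Sat L S) →
            ∃ h, Red S.lab true (encFilters fs ++ (encs L ++ w)) h ∧ ∀ c ∈ S.ch, NotSat h c := by
          intro fs
          induction fs with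
          | nil =>
            intro hw hf
            obtain ⟨h, h1, h2⟩ := ih L w (by simpa [weights] using hw) (by simpa [AllT] using hf)
            exact ⟨h, by simpa [encFilters] using Red.done h1, h2⟩
          | cons e fs ihf =>
            intro hw hf
            simp only [weights] at hw
            by_cases he : Sat [e] S
            · obtain ⟨h, h1, h2⟩ := ihf (by omega) fun h => hf
                ⟨by simp only [AllT]; exact ⟨sat_singleton.1 he, h.1⟩, h.2⟩
              exact ⟨h, by simpa [encFilters] using Red.skip h1, h2⟩
            · obtain ⟨h, h1, h2⟩ := ih [e] (encFilters fs ++ (encs L ++ w))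
                (by simp only [weights]; omega) he
              exact ⟨h, by simpa [encFilters] using Red.pick h1, h2⟩
        obtain ⟨h, h1, h2⟩ := key es (by simp only [weights, weight] at hn; omega)
          fun h => hL (sat_self.2 ⟨ha.symm, h⟩)
        exact ⟨h, by simpa [encXPath, encAxis] using Red.self (x := a) h1, h2⟩
      · exact ⟨_, by simpa [encXPath, encAxis] using Red.neq ha, fun c hc => .inl rfl⟩

theorem failS_of_not_sat : ∀ (T : Tr) {L : List XPath} {w : List Sym}, ¬ Sat L T →
    FailS (encs L ++ w) T := by
  refine Tr.ind fun a ts ih L w hL => ?_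
  obtain ⟨h, h1, h2⟩ := exists_red _ L w hL
  refine .node h1 fun c hc => ?_
  obtain rfl | ⟨L', w', rfl, h3⟩ := h2 c hc
  · exact failS_noGoal c
  · exact ih c hc h3

/-! ### The goals that occur -/

/-- The goals that come up when the goal `Q` is treated. -/
def IsGoal (Q h : List Sym) : Prop :=
  h = [noGoal] ∨ h <:+ Q ∨ ∃ t, .child :: t <:+ Q ∧ h = .self :: t

/-- A reduction only removes symbols from the front, until a child step has its first symbol
replaced or the dummy goal is reached. -/
theorem Red.isGoal_of_suffix {a : Label} {b : Bool} {s h Q : List Sym} (hr : Red a b s h)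
    (hs : s <:+ Q) : IsGoal Q h := by
  have hc : ∀ {c : Sym} {s : List Sym}, c :: s <:+ Q → s <:+ Q := fun h =>
    (List.suffix_cons _ _).trans h
  have ha : ∀ {v s : List Sym}, v ++ s <:+ Q → s <:+ Q := fun h =>
    (List.suffix_append _ _).trans h
  induction hr with
  | slash _ ih => exact ih (hc hs)
  | neq => exact .inl rfl
  | self _ ih => exact ih (ha (hc hs))
  | child => exact .inr (.inr ⟨_, hs, rfl⟩)
  | noGoal => exact .inr (.inl hs)
  | pick _ ih => exact ih (hc hs)
  | skip _ ih => exact ih (ha (hc hs))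
  | done _ ih => exact ih (hc hs)

/-- A goal with replaced first symbol is no suffix itself, but reducing it removes this symbol or
gives the dummy goal, so replacements do not accumulate. -/
theorem Red.isGoal {a : Label} {s h Q : List Sym} (hr : Red a false s h) (hs : IsGoal Q s) :
    IsGoal Q h := by
  obtain rfl | hs | ⟨t, ht, rfl⟩ := hs
  · cases hr; exact .inl rfl
  · exact hr.isGoal_of_suffix hs
  · cases hr with
    | neq => exact .inl rfl
    | self hr =>
      exact hr.isGoal_of_suffix ((List.suffix_append _ _).trans ((List.suffix_cons _ _).trans ht))

/-- A list of all goals that come up when `Q` is treated. -/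
def goalList (Q : List Sym) : List (List Sym) :=
  [noGoal] :: (Q.tails ++ Q.tails.map fun t => .self :: t.tail)

theorem length_goalList (Q : List Sym) : (goalList Q).length = 2 * Q.length + 3 := by
  simp [goalList]; omega

theorem IsGoal.mem {Q h : List Sym} (hg : IsGoal Q h) : h ∈ goalList Q := by
  obtain rfl | hs | ⟨t, ht, rfl⟩ := hg
  · simp [goalList]
  · simp [goalList, hs]
  · simp only [goalList, List.mem_cons, List.mem_append, List.mem_map, List.mem_tails]
    exact .inr (.inr ⟨_, ht, rfl⟩)

theorem IsGoal.length_le {Q h : List Sym} (hg : IsGoal Q h) : h.length ≤ Q.length + 1 := by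
  obtain rfl | hs | ⟨t, ht, rfl⟩ := hg
  · simp
  · have := hs.length_le; omega
  · have := ht.length_le; simp at this ⊢; omega

theorem mem_goalSyms_label {a : Label} {c : Sym} (h : c ∈ encLabel a) : c ∈ goalSyms := by
  simp only [encLabel, List.mem_append, List.mem_map, List.mem_singleton] at h
  obtain ⟨b, -, rfl⟩ | rfl := h
  · cases b <;> simp [goalSyms]
  · simp [goalSyms]

mutual
theorem mem_goalSyms : ∀ {q : XPath} {c : Sym}, c ∈ encXPath q → c ∈ goalSyms
  | .step ax a es, c, h => by
    simp only [encXPath, List.mem_cons, List.mem_append] at h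
    obtain rfl | h | h := h
    · cases ax <;> simp [encAxis, goalSyms]
    · exact mem_goalSyms_label h
    · exact mem_goalSyms_filters h
  | .comp p q, c, h => by
    simp only [encXPath, List.mem_cons, List.mem_append] at h
    obtain rfl | h | h := h
    · simp [goalSyms]
    · exact mem_goalSyms h
    · exact mem_goalSyms h
theorem mem_goalSyms_filters : ∀ {es : List XPath} {c : Sym}, c ∈ encFilters es → c ∈ goalSyms
  | [], c, h => by simp only [encFilters, List.mem_singleton] at h; subst h; simp [goalSyms]
  | e :: es, c, h => by
    simp only [encFilters, List.mem_cons, List.mem_append] at h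
    obtain rfl | h | h := h
    · simp [goalSyms]
    · exact mem_goalSyms h
    · exact mem_goalSyms_filters h
end

theorem IsGoal.mem_goalSyms {q : XPath} {h : List Sym} (hg : IsGoal (encXPath q) h) :
    ∀ c ∈ h, c ∈ goalSyms := by
  intro c hc
  obtain rfl | hs | ⟨t, ht, rfl⟩ := hg
  · simp only [List.mem_singleton] at hc; subst hc; simp [goalSyms]
  · exact XPathDTD.mem_goalSyms (hs.subset hc)
  · obtain rfl | hc := List.mem_cons.1 hc
    · simp [goalSyms]
    · exact XPathDTD.mem_goalSyms (ht.subset (List.mem_cons_of_mem _ hc))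

/-! ## Generating words of regular languages -/

/-- The word `w` is generated by the regular expression in the given number of steps. -/
inductive RegGen : RegularExpression Label → List Label → ℕ → Prop
  | epsilon : RegGen .epsilon [] 1
  | char {a} : RegGen (.char a) [a] 1
  | plus_left {r s w n} : RegGen r w n → RegGen (.plus r s) w (n + 1)
  | plus_right {r s w n} : RegGen s w n → RegGen (.plus r s) w (n + 1)
  | comp {r s u v m n} : RegGen r u m → RegGen s v n → RegGen (.comp r s) (u ++ v) (m + n + 1)
  | star_nil {r} : RegGen (.star r) [] 1
  | star_append {r u v m n} : RegGen r u m → RegGen (.star r) v n →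
      RegGen (.star r) (u ++ v) (m + n + 1)

theorem RegGen.mem {r : RegularExpression Label} {w : List Label} {n : ℕ} (h : RegGen r w n) :
    w ∈ r.matches' := by
  induction h with
  | epsilon => exact Language.nil_mem_one
  | char => exact Set.mem_singleton _
  | plus_left _ ih => exact .inl ih
  | plus_right _ ih => exact .inr ih
  | comp _ _ ih1 ih2 => exact Language.append_mem_mul ih1 ih2
  | star_nil => exact Language.nil_mem_kstar _
  | star_append _ _ ih1 ih2 =>
    obtain ⟨L, rfl, hL⟩ := Language.mem_kstar.1 ih2
    exact Language.mem_kstar.2 ⟨_ :: L, rfl, List.forall_mem_cons.2 ⟨ih1, hL⟩⟩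

theorem RegGen.length_le {r : RegularExpression Label} {w : List Label} {n : ℕ}
    (h : RegGen r w n) : w.length ≤ n := by
  induction h <;> grind

theorem encRegex_length_pos (r : RegularExpression Label) : 0 < (encRegex r).length := by
  cases r <;> simp [encRegex]

/-- From a word of a regular language, letters can be removed such that all marked letters stay and
the rest is generated in few steps. -/
theorem exists_regGen {α : Type} (f : α → Label) (p : α → Bool) (r : RegularExpression Label) :
    ∀ xs : List α, xs.map f ∈ r.matches' → ∃ (ys : List α) (n : ℕ), ys.Sublist xs ∧ (∀ x ∈ xs,
      p x → x ∈ ys) ∧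
      RegGen r (ys.map f) n ∧ (xs.countP p = 0 → n ≤ (encRegex r).length) ∧
      (0 < xs.countP p → n ≤ 2 * (encRegex r).length * xs.countP p) := by
  induction r with
  | zero => intro xs h; exact absurd h (Language.notMem_zero _)
  | epsilon =>
    intro xs h
    have : xs = [] := by simpa using (Language.mem_one _).1 h
    subst this
    exact ⟨[], 1, .refl _, by simp, .epsilon, by simp [encRegex], by simp⟩
  | char a =>
    intro xs h
    have h : xs.map f = [a] := h
    refine ⟨xs, 1, .refl _, fun _ h _ => h, h ▸ .char, by simp [encRegex], fun hp => ?_⟩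
    have : 0 < (encRegex (.char a)).length := encRegex_length_pos _
    nlinarith
  | plus r s ihr ihs =>
    intro xs h
    obtain h | h := h
    · obtain ⟨ys, n, h1, h2, h3, h4, h5⟩ := ihr xs h
      refine ⟨ys, n + 1, h1, h2, .plus_left h3, fun h => ?_, fun h => ?_⟩
      · have := h4 h; simp [encRegex]; omega
      · have := h5 h; simp only [encRegex, List.length_cons, List.length_append]; nlinarith
    · obtain ⟨ys, n, h1, h2, h3, h4, h5⟩ := ihs xs h
      refine ⟨ys, n + 1, h1, h2, .plus_right h3, fun h => ?_, fun h => ?_⟩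
      · have := h4 h; simp [encRegex]; omega
      · have := h5 h; simp only [encRegex, List.length_cons, List.length_append]; nlinarith
  | comp r s ihr ihs =>
    intro xs h
    obtain ⟨u, hu, v, hv, h⟩ := Language.mem_mul.1 h
    obtain ⟨x1, x2, rfl, rfl, rfl⟩ := List.map_eq_append_iff.1 h.symm
    obtain ⟨y1, n1, h1, h2, h3, h4, h5⟩ := ihr x1 hu
    obtain ⟨y2, n2, g1, g2, g3, g4, g5⟩ := ihs x2 hv
    refine ⟨y1 ++ y2, n1 + n2 + 1, h1.append g1, ?_, ?_, fun h => ?_, fun h => ?_⟩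
    · intro x hx hp
      obtain hx | hx := List.mem_append.1 hx
      · exact List.mem_append_left _ (h2 x hx hp)
      · exact List.mem_append_right _ (g2 x hx hp)
    · rw [List.map_append]; exact .comp h3 g3
    · rw [List.countP_append] at h
      have := h4 (by omega)
      have := g4 (by omega)
      simp [encRegex]; omega
    · rw [List.countP_append] at h ⊢
      simp only [encRegex, List.length_cons, List.length_append]
      -- If one factor has no marked letter, its bound without a factor is absorbed, because the
      -- other factor has at least one.
      rcases Nat.eq_zero_or_pos (x1.countP p) with h0 | h0 <;>
      rcases Nat.eq_zero_or_pos (x2.countP p) with h0' | h0'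
      · omega
      · have := h4 h0; have := g5 h0'; rw [h0]; nlinarith
      · have := h5 h0; have := g4 h0'; rw [h0']; nlinarith
      · have := h5 h0; have := g5 h0'; nlinarith
  | star r ih =>
    intro xs h
    obtain ⟨L, hx, hL⟩ := Language.mem_kstar.1 h
    clear h
    have hr := encRegex_length_pos r
    -- The additive form suits the induction on the iterations: one with `c > 0` marked letters
    -- costs at most `2 * |r| * c + 1`, hence at most `(2 * |r| + 1) * c`. With at least one mark,
    -- the bound `2 * (|r| + 1)` per mark for the star also pays for the last step.
    suffices hs : ∃ (ys : List α) (n : ℕ), ys.Sublist xs ∧ (∀ x ∈ xs, p x → x ∈ ys) ∧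
        RegGen (.star r) (ys.map f) n ∧
        n ≤ 1 + (2 * (encRegex r).length + 1) * xs.countP p by
      obtain ⟨ys, n, h1, h2, h3, h4⟩ := hs
      refine ⟨ys, n, h1, h2, h3, fun h => ?_, fun h => ?_⟩
      · rw [h] at h4; simp [encRegex]; omega
      · simp only [encRegex, List.length_cons]; nlinarith
    induction L generalizing xs with
    | nil =>
      have : xs = [] := by simpa using hx
      subst this
      exact ⟨[], 1, .refl _, by simp, .star_nil, by simp⟩
    | cons u L ihL =>
      obtain ⟨x1, x2, rfl, rfl, h⟩ := List.map_eq_append_iff.1 hx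
      obtain ⟨y2, n2, g1, g2, g3, g4⟩ := ihL x2 h fun y hy => hL y (by simp [hy])
      obtain ⟨y1, n1, h1, h2, h3, h4, h5⟩ := ih x1 (hL _ (by simp))
      rw [List.countP_append]
      rcases Nat.eq_zero_or_pos (x1.countP p) with h0 | h0
      -- An iteration without marked letters is deleted.
      · refine ⟨y2, n2, g1.trans (List.sublist_append_right _ _), fun x hx hp => ?_, g3, ?_⟩
        · obtain hx | hx := List.mem_append.1 hx
          · exact absurd hp (List.countP_eq_zero.1 h0 x hx)
          · exact g2 x hx hp
        · rw [h0]; simpa using g4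
      · refine ⟨y1 ++ y2, n1 + n2 + 1, h1.append g1, ?_, ?_, ?_⟩
        · intro x hx hp
          obtain hx | hx := List.mem_append.1 hx
          · exact List.mem_append_left _ (h2 x hx hp)
          · exact List.mem_append_right _ (g2 x hx hp)
        · rw [List.map_append]; exact .star_append h3 g3
        · have := h5 h0; nlinarith

end XPathDTD

/-! ## Small counterexamples -/

namespace XPathDTD

/-- A record of a database: the label of a vertex, a goal that fails there, and the numbers of the
records for the children. -/
structure Rec where
  lab : Label
  goal : List Sym
  ch : List ℕ

/-- The record with the number `j` of the database `D` is `r`. The numbering starts at the end of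
the list. -/
def At (D : List Rec) (j : ℕ) (r : Rec) : Prop := ∃ D₁ D₂, D = D₁ ++ r :: D₂ ∧ D₂.length = j

/-- This is the reason for numbering records from the end: numbers stay valid when records are put
in front. -/
theorem At.mono {D D' : List Rec} {j : ℕ} {r : Rec} (h : At D j r) (hD : D <:+ D') : At D' j r := by
  obtain ⟨D₁, D₂, rfl, h⟩ := h
  obtain ⟨D₀, rfl⟩ := hD
  exact ⟨D₀ ++ D₁, D₂, by simp, h⟩

theorem At.unique {D : List Rec} {j : ℕ} {r r' : Rec} (h : At D j r) (h' : At D j r') : r = r' := by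
  obtain ⟨D₁, D₂, rfl, rfl⟩ := h
  obtain ⟨D₁', D₂', h1, h2⟩ := h'
  have := List.append_inj_right' h1 (by simp [h2])
  simp at this
  exact this.1

theorem At.lt {D : List Rec} {j : ℕ} {r : Rec} (h : At D j r) : j < D.length := by
  obtain ⟨D₁, D₂, rfl, rfl⟩ := h
  simp only [List.length_append, List.length_cons]
  omega

theorem at_head (D : List Rec) (r : Rec) : At (r :: D) D.length r := ⟨[], D, rfl, rfl⟩

theorem exists_at_of_mem {D : List Rec} {r : Rec} (h : r ∈ D) : ∃ j, At D j r := by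
  obtain ⟨D₁, D₂, rfl⟩ := List.append_of_mem h
  exact ⟨_, D₁, D₂, rfl, rfl⟩

/-- The list of numbers of records with the goal `h` is such that the labels of these records form a
word of the regular language, which is generated in `n` steps. -/
def GenD (D : List Rec) (h : List Sym) (ρ : RegularExpression Label) (js : List ℕ) (n : ℕ) : Prop :=
  ∃ w, RegGen ρ w n ∧ List.Forall₂ (fun a j => ∃ r, At D j r ∧ r.lab = a ∧ r.goal = h) w js

/-- The record `r` can be put in front of the database `D`. -/
def Step (rs : List (Label × RegularExpression Label)) (N : ℕ) (D : List Rec) (r : Rec) : Prop :=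
  ∃ ρ h n, (r.lab, ρ) ∈ rs ∧ Red r.lab false r.goal h ∧ n ≤ N ∧ GenD D h ρ r.ch n

/-- Every record of the database refers only to later records of the list, and describes a rule
and a goal that fails. -/
inductive Valid (rs : List (Label × RegularExpression Label)) (N : ℕ) : List Rec → Prop
  | nil : Valid rs N []
  | cons {D r} : Valid rs N D → Step rs N D r → Valid rs N (r :: D)

theorem Step.mono {rs : List (Label × RegularExpression Label)} {N N' : ℕ} {D : List Rec} {r : Rec}
    (h : Step rs N D r) (hN : N ≤ N') : Step rs N' D r := by
  obtain ⟨ρ, h', n, h1, h2, h3, h4⟩ := h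
  exact ⟨ρ, h', n, h1, h2, h3.trans hN, h4⟩

theorem Valid.mono {rs : List (Label × RegularExpression Label)} {N N' : ℕ} {D : List Rec}
    (h : Valid rs N D) (hN : N ≤ N') : Valid rs N' D := by
  induction h with
  | nil => exact .nil
  | cons _ h ih => exact .cons ih (h.mono hN)

-- Unfolding a database into trees.

/-- The tree that is described by the record with the number `j`. -/
inductive TreeAt (D : List Rec) : ℕ → Tr → Prop
  | mk {j r} (zs : List (ℕ × Tr)) : At D j r → zs.map Prod.fst = r.ch →
      (∀ z ∈ zs, TreeAt D z.1 z.2) → TreeAt D j (.node r.lab (zs.map Prod.snd))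

theorem TreeAt.mono {D D' : List Rec} {j : ℕ} {T : Tr} (h : TreeAt D j T) (hD : D <:+ D') :
    TreeAt D' j T := by
  induction h with
  | mk zs h1 h2 _ ih => exact .mk zs (h1.mono hD) h2 ih

theorem TreeAt.inv {D : List Rec} {j : ℕ} {T : Tr} (h : TreeAt D j T) : ∃ r, ∃ zs : List (ℕ × Tr),
    At D j r ∧ zs.map Prod.fst = r.ch ∧ (∀ z ∈ zs, TreeAt D z.1 z.2) ∧
      T = .node r.lab (zs.map Prod.snd) := by
  cases h with
  | mk zs h1 h2 h3 => exact ⟨_, zs, h1, h2, h3, rfl⟩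

theorem TreeAt.lab_eq {D : List Rec} {j : ℕ} {T : Tr} {r : Rec} (h : TreeAt D j T) (hr : At D j r) :
    T.lab = r.lab := by
  obtain ⟨r', zs, h1, h2, h3, rfl⟩ := h.inv
  rw [h1.unique hr]; rfl

theorem exists_of_forall₂_left {α β : Type} {R : α → β → Prop} {l : List α} {l' : List β}
    (h : List.Forall₂ R l l') {x : α} (hx : x ∈ l) : ∃ y ∈ l', R x y := by
  induction h with
  | nil => simp at hx
  | cons h _ ih =>
    obtain rfl | hx := List.mem_cons.1 hx
    · exact ⟨_, by simp, h⟩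
    · obtain ⟨y, hy, hR⟩ := ih hx
      exact ⟨y, by simp [hy], hR⟩

theorem exists_of_forall₂_right {α β : Type} {R : α → β → Prop} {l : List α} {l' : List β}
    (h : List.Forall₂ R l l') {y : β} (hy : y ∈ l') : ∃ x ∈ l, R x y :=
  exists_of_forall₂_left h.flip hy

section Soundness

variable {rs : List (Label × RegularExpression Label)} {N : ℕ} {D : List Rec}

theorem Valid.step (hD : Valid rs N D) {j : ℕ} {r : Rec} (h : At D j r) :
    ∃ D', D' <:+ D ∧ D'.length = j ∧ Step rs N D' r := by
  obtain ⟨D₁, D₂, rfl, hj⟩ := h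
  induction D₁ with
  | nil =>
    cases hD with
    | cons _ h => exact ⟨D₂, List.suffix_cons _ _, hj, h⟩
  | cons r' D₁ ih =>
    cases hD with
    | cons h _ =>
      obtain ⟨D', h1, h2⟩ := ih h
      exact ⟨D', h1.trans (List.suffix_cons _ _), h2⟩

/-- References lead to smaller numbers, so the unfolding terminates. -/
theorem Valid.exists_treeAt (hD : Valid rs N D) : ∀ (j : ℕ) (r : Rec), At D j r →
    ∃ T, TreeAt D j T := by
  intro j
  induction j using Nat.strong_induction_on with
  | _ j ih =>
    intro r hr
    obtain ⟨D', h1, rfl, ρ, h, n, h2, h3, h4, w, h5, h6⟩ := hD.step hr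
    have : ∀ i ∈ r.ch, ∃ T, TreeAt D i T := by
      intro i hi
      obtain ⟨a, -, r', hr', -⟩ := exists_of_forall₂_right h6 hi
      exact ih i hr'.lt r' (hr'.mono h1)
    have : Nonempty Tr := ⟨.node [] []⟩
    choose! f hf using ‹∀ i ∈ r.ch, ∃ T, TreeAt D i T›
    have hz := TreeAt.mk (D := D) (r.ch.map fun i => (i, f i)) hr
      (by simp [Function.comp_def]) (by simpa using hf)
    exact ⟨_, hz⟩

/-- Local checks suffice: all children of a record carry the reduced goal, which fails there by
induction, and their labels form a word generated by the rule of the record. -/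
theorem Valid.conf_failS (hD : Valid rs N D) : ∀ (T : Tr) (j : ℕ), TreeAt D j T →
    T.Conf rs ∧ ∀ r, At D j r → FailS r.goal T := by
  refine Tr.ind fun a ts ih j hT => ?_
  obtain ⟨r, zs, h1, h2, h3, hr⟩ := hT.inv
  obtain ⟨rfl, rfl⟩ := Tr.node.inj hr
  obtain ⟨D', g1, -, ρ, h, n, g2, g3, -, w, g4, g5⟩ := hD.step h1
  have hlab : (zs.map Prod.snd).map Tr.lab = w := by
    rw [← h2, List.forall₂_map_right_iff] at g5
    clear h2 hT ih hr
    have h3' := h3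
    clear h3
    clear g4
    induction g5 with
    | nil => rfl
    | @cons a z w zs hz _ ih =>
      obtain ⟨r', hr', hl, -⟩ := hz
      simp only [List.map_cons, List.cons.injEq]
      exact ⟨((h3' z (by simp)).lab_eq (hr'.mono g1)).trans hl,
        ih fun z hz => h3' z (by simp [hz])⟩
  have hch : ∀ c ∈ zs.map Prod.snd, c.Conf rs ∧ FailS h c := by
    intro c hc
    obtain ⟨z, hz, rfl⟩ := List.mem_map.1 hc
    obtain ⟨hc1, hc2⟩ := ih _ hc z.1 (h3 z hz)
    have : z.1 ∈ r.ch := h2 ▸ List.mem_map_of_mem hz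
    obtain ⟨a, -, r', hr', -, rfl⟩ := exists_of_forall₂_right g5 this
    exact ⟨hc1, hc2 r' (hr'.mono g1)⟩
  refine ⟨.node g2 (hlab ▸ g4.mem) fun c hc => (hch c hc).1, fun r' hr' => ?_⟩
  rw [← h1.unique hr']
  exact .node g3 fun c hc => (hch c hc).2

end Soundness

/-! ### Existence of small databases -/

section Small

variable {rs : List (Label × RegularExpression Label)} {N : ℕ} {Q : List Sym}

/-- The database has a record for every conforming tree and every goal that fails in it. -/
def Covers (rs : List (Label × RegularExpression Label)) (Q : List Sym) (D : List Rec) : Prop :=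
  ∀ (T : Tr) (g : List Sym), T.Conf rs → FailS g T → IsGoal Q g →
    ∃ r ∈ D, r.lab = T.lab ∧ r.goal = g

/-- Distinct keys are distinct pairs of a label that has a rule and an element of `goalList Q`. -/
theorem length_le_of_nodup_keys {D : List Rec} (hD : Valid rs N D)
    (hn : (D.map fun r => (r.lab, r.goal)).Nodup) (hg : ∀ r ∈ D, IsGoal Q r.goal) :
    D.length ≤ rs.length * (2 * Q.length + 3) := by
  have h : (D.map fun r => (r.lab, r.goal)) ⊆ (rs.map Prod.fst) ×ˢ goalList Q := by
    intro z hz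
    obtain ⟨r, hr, rfl⟩ := List.mem_map.1 hz
    obtain ⟨j, hj⟩ := exists_at_of_mem hr
    obtain ⟨D', -, -, ρ, h, n, h2, -⟩ := hD.step hj
    exact List.mem_product.2 ⟨List.mem_map_of_mem (f := Prod.fst) h2, (hg r hr).mem⟩
  have := (List.subperm_of_subset hn h).length_le
  simpa [List.length_product, length_goalList] using this

/-- A valid database with distinct keys that misses a realisable pair can be enlarged: in a smallest
tree with a missing pair, the pairs needed for the children are present, so a record can be formed.
Since distinct keys bound the length, this cannot go on forever. The proof is by contradiction, with
databases of every length. -/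
theorem exists_covers (hN : ∀ ρ ∈ rs, (encRegex ρ.2).length ≤ N) :
    ∃ D, Valid rs N D ∧ (∀ r ∈ D, IsGoal Q r.goal) ∧
      D.length ≤ rs.length * (2 * Q.length + 3) ∧ Covers rs Q D := by
  by_contra hc
  have key : ∀ k : ℕ, ∃ D, Valid rs N D ∧ (D.map fun r => (r.lab, r.goal)).Nodup ∧
      (∀ r ∈ D, IsGoal Q r.goal) ∧ D.length = k := by
    intro k
    induction k with
    | zero => exact ⟨[], .nil, by simp, by simp, rfl⟩
    | succ k ih =>
      obtain ⟨D, h1, h2, h3, h4⟩ := ih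
      by_contra hk
      refine hc ⟨D, h1, h3, length_le_of_nodup_keys h1 h2 h3, ?_⟩
      refine Tr.ind fun a ts ih g hT hf hg => ?_
      by_contra hr
      cases hf with
      | @node _ _ _ h hred hch =>
        cases hT with
        | @node _ ρ _ hρ hw hts =>
          -- No child has to be kept here, so nothing is marked.
          obtain ⟨ys, n, g1, -, g3, g4, -⟩ := exists_regGen Tr.lab (fun _ => false) ρ ts hw
          have : ∀ c ∈ ys, ∃ j, ∃ r, At D j r ∧ r.lab = c.lab ∧ r.goal = h := by
            intro c hc
            have hc := g1.subset hc
            obtain ⟨r, hr, h5, h6⟩ := ih c hc h (hts c hc) (hch c hc) (hred.isGoal hg)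
            obtain ⟨j, hj⟩ := exists_at_of_mem hr
            exact ⟨j, r, hj, h5, h6⟩
          choose! f hf using this
          refine hk ⟨⟨a, g, ys.map f⟩ :: D, .cons h1 ⟨ρ, h, n, hρ, hred,
            (g4 (by simp)).trans (hN _ hρ), _, g3, ?_⟩, ?_, ?_, by simp [h4]⟩
          · rw [List.forall₂_map_left_iff, List.forall₂_map_right_iff, List.forall₂_same]
            exact hf
          · simp only [List.map_cons, List.nodup_cons, h2, and_true]
            intro hm
            obtain ⟨r, hr', h7⟩ := List.mem_map.1 hm
            simp only [Prod.mk.injEq] at h7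
            exact hr ⟨r, hr', h7⟩
          · exact List.forall_mem_cons.2 ⟨hg, h3⟩
  obtain ⟨D, h1, h2, h3, h4⟩ := key (rs.length * (2 * Q.length + 3) + 1)
  have := length_le_of_nodup_keys h1 h2 h3
  omega

-- Distributing satisfied paths to the children.

/-- The sum of the weights of several sequences of location paths. -/
def totalWeight (P : List (List XPath)) : ℕ := (P.map weights).sum

@[simp] theorem totalWeight_nil : totalWeight [] = 0 := rfl
@[simp] theorem totalWeight_cons (L : List XPath) (P : List (List XPath)) :
    totalWeight (L :: P) = weights L + totalWeight P := by simp [totalWeight]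
@[simp] theorem totalWeight_append (P P' : List (List XPath)) :
    totalWeight (P ++ P') = totalWeight P + totalWeight P' := by simp [totalWeight]

theorem totalWeight_singletons (es : List XPath) : totalWeight (es.map fun e => [e]) =
    weights es := by
  induction es with
  | nil => rfl
  | cons e es ih => simp [ih, weights]

/-- What has to be satisfied at a tree can be reduced to what has to be satisfied at its
children. -/
theorem exists_child_goals (S : Tr) (P : List (List XPath)) (hP : ∀ L ∈ P, Sat L S) :
    ∃ R : List (List XPath), (∀ L ∈ R, ∃ c ∈ S.ch, Sat L c) ∧ totalWeight R ≤ totalWeight P ∧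
      R.length ≤ totalWeight P ∧ (0 < totalWeight P → totalWeight R < totalWeight P) ∧
      ∀ S' : Tr, S'.lab = S.lab → (∀ L ∈ R, ∃ c ∈ S'.ch, Sat L c) → ∀ L ∈ P, Sat L S' := by
  match P with
  | [] => exact ⟨[], by simp⟩
  | [] :: P =>
    obtain ⟨R, h1, h2, h3, h4, h5⟩ := exists_child_goals S P fun L hL => hP L (by simp [hL])
    refine ⟨R, h1, by simpa [weights] using h2, by simpa [weights] using h3,
      by simpa [weights] using h4, fun S' hS' hR => ?_⟩
    exact List.forall_mem_cons.2 ⟨trivial, h5 S' hS' hR⟩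
  | (.comp p q :: L) :: P =>
    obtain ⟨R, h1, h2, h3, h4, h5⟩ := exists_child_goals S ((p :: q :: L) :: P) (by
      refine List.forall_mem_cons.2 ⟨sat_comp.1 (hP _ (by simp)), fun L hL => hP L (by simp [hL])⟩)
    simp only [totalWeight_cons, weights, weight] at h2 h3 h4 ⊢
    refine ⟨R, h1, by omega, by omega, by omega, fun S' hS' hR => ?_⟩
    obtain ⟨h6, h7⟩ := List.forall_mem_cons.1 (h5 S' hS' hR)
    exact List.forall_mem_cons.2 ⟨sat_comp.2 h6, h7⟩
  | (.step .self a es :: L) :: P =>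
    obtain ⟨h6, h7⟩ := List.forall_mem_cons.1 hP
    obtain ⟨h8, h9, h10⟩ := sat_self.1 h6
    obtain ⟨R, h1, h2, h3, h4, h5⟩ := exists_child_goals S ((es.map fun e => [e]) ++ L :: P) (by
      simp only [List.forall_mem_append, List.forall_mem_cons, List.forall_mem_map]
      exact ⟨allT_iff.1 h9, h10, h7⟩)
    simp only [totalWeight_cons, totalWeight_append, totalWeight_singletons, weights, weight]
      at h2 h3 h4 ⊢
    refine ⟨R, h1, by omega, by omega, by omega, fun S' hS' hR => ?_⟩
    have h11 := h5 S' hS' hR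
    simp only [List.forall_mem_append, List.forall_mem_cons, List.forall_mem_map] at h11
    exact List.forall_mem_cons.2 ⟨sat_self.2 ⟨hS'.trans h8, allT_iff.2 h11.1, h11.2.1⟩, h11.2.2⟩
  | (.step .child a es :: L) :: P =>
    obtain ⟨h6, h7⟩ := List.forall_mem_cons.1 hP
    obtain ⟨R, h1, h2, h3, h4, h5⟩ := exists_child_goals S P h7
    -- The child step of weight 2 becomes a self step of weight 1 at a child. This is why child
    -- steps count twice: the total weight decreases strictly, and the number of sequences passed on
    -- is still bounded by the weight.
    refine ⟨(.step .self a es :: L) :: R, List.forall_mem_cons.2 ⟨sat_child.1 h6, h1⟩, ?_⟩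
    simp only [totalWeight_cons, weights, weight, List.length_cons]
    refine ⟨by omega, by omega, by omega, fun S' hS' hR => ?_⟩
    obtain ⟨h8, h9⟩ := List.forall_mem_cons.1 hR
    exact List.forall_mem_cons.2 ⟨sat_child.2 h8, h5 S' hS' h9⟩
-- Removing an empty sequence does not change the weight, whence the second component.
termination_by (totalWeight P, P.length)
decreasing_by
  · simp [Prod.lex_def, weights]
  · simp [Prod.lex_def, weights, weight]
    omega
  · simp [Prod.lex_def, weights, weight, totalWeight_singletons]
    omega
  · simp [Prod.lex_def, weights, weight]

theorem weights_eq_zero {L : List XPath} (h : weights L = 0) : L = [] := by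
  match L with
  | [] => rfl
  | .step .self _ _ :: _ => simp [weights, weight] at h
  | .step .child _ _ :: _ => simp [weights, weight] at h
  | .comp _ _ :: _ => simp [weights, weight] at h

/-- For different `y` the classes of `R` are disjoint; one class is split off at a time. -/
theorem sum_totalWeight_filter_le (f : List XPath → ℕ) (ys : List ℕ) (hy : ys.Nodup) :
    ∀ R : List (List XPath),
      (ys.map fun y => totalWeight (R.filter fun L => f L = y)).sum ≤ totalWeight R := by
  induction ys with
  | nil => simp
  | cons y ys ih =>
    intro R
    obtain ⟨h1, h2⟩ := List.nodup_cons.1 hy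
    have h3 := ih h2 (R.filter fun L => f L ≠ y)
    have h4 : (ys.map fun y' => totalWeight ((R.filter fun L => f L ≠ y).filter fun L => f L =
      y')) =
        ys.map fun y' => totalWeight (R.filter fun L => f L = y') := by
      refine List.map_congr_left fun y' hy' => ?_
      rw [List.filter_filter]
      congr 1
      refine List.filter_congr fun L _ => ?_
      by_cases hL : f L = y'
      · have : y' ≠ y := fun h => h1 (h ▸ hy')
        simp [hL, this]
      · simp [hL]
    have h5 : totalWeight R = totalWeight (R.filter fun L => f L = y) +
        totalWeight (R.filter fun L => f L ≠ y) := by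
      clear h3 h4
      induction R with
      | nil => rfl
      | cons L R ihR => by_cases hL : f L = y <;> simp [hL] at ihR ⊢ <;> omega
    rw [h4] at h3
    simp only [List.map_cons, List.sum_cons]
    omega

/-- From a database that covers everything, a database is obtained that describes a tree which
satisfies given sequences of location paths, by adding few records. -/
theorem Covers.exists_model {D₀ : List Rec} {W M : ℕ} (h₀ : Covers rs Q D₀)
    (hM : ∀ ρ ∈ rs, (encRegex ρ.2).length ≤ M) (hN : M * (2 * W + 1) ≤ N) :
    ∀ (T : Tr) (g : List Sym), T.Conf rs → FailS g T → IsGoal Q g → ∀ P : List (List XPath),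
      (∀ L ∈ P, Sat L T) → totalWeight P ≤ W → ∀ D, D₀ <:+ D → Valid rs N D →
      (∀ r ∈ D, IsGoal Q r.goal) → ∃ D', D <:+ D' ∧ Valid rs N D' ∧ (∀ r ∈ D', IsGoal Q r.goal) ∧
        D'.length ≤ D.length + totalWeight P ∧ ∃ j r T', At D' j r ∧ r.lab = T.lab ∧ r.goal = g ∧
        TreeAt D' j T' ∧ (∀ L ∈ P, Sat L T') ∧ (0 < totalWeight P → D'.length = j + 1) := by
  refine Tr.ind fun a ts ih g hT hf hg P hP hPW D hD hv hDg => ?_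
  -- Without weight only empty sequences are left, so a shared record serves, and nothing is added
  -- to the database.
  obtain h0 | h0 := Nat.eq_zero_or_pos (totalWeight P)
  · obtain ⟨r, hr, h1, h2⟩ := h₀ _ g hT hf hg
    obtain ⟨j, hj⟩ := exists_at_of_mem hr
    obtain ⟨T', hT'⟩ := hv.exists_treeAt j r (hj.mono hD)
    refine ⟨D, List.suffix_rfl, hv, hDg, by omega, j, r, T', hj.mono hD, h1, h2, hT',
      fun L hL => ?_, by omega⟩
    have : weights L = 0 := by
      have := List.le_sum_of_mem (List.mem_map_of_mem (f := weights) hL)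
      simp only [totalWeight] at h0
      omega
    rw [weights_eq_zero this]
    trivial
  · obtain ⟨R, h1, h2, h3, h4, h5⟩ := exists_child_goals _ P hP
    have h4 := h4 h0
    -- Children are addressed by position, because different children may be equal as trees. The
    -- default is never used below `ts.length`.
    let c : ℕ → Tr := fun i => ts.getD i (.node [] [])
    have hc : ∀ i < ts.length, c i ∈ ts := by
      intro i hi
      simp only [c, List.getD_eq_getElem?_getD, List.getElem?_eq_getElem hi, Option.getD_some]
      exact List.getElem_mem hi
    have hmap : (List.range ts.length).map (fun i => (c i).lab) = ts.map Tr.lab := by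
      refine List.ext_getElem (by simp) fun i h1 h2 => ?_
      simp only [List.length_map] at h2
      simp [c, List.getElem?_eq_getElem h2]
    have : ∀ L ∈ R, ∃ i < ts.length, Sat L (c i) := by
      intro L hL
      obtain ⟨t, ht, hs⟩ := h1 L hL
      obtain ⟨i, hi, rfl⟩ := List.getElem_of_mem ht
      have hi : i < ts.length := hi
      exact ⟨i, hi, by simpa [c, List.getElem?_eq_getElem hi, Tr.ch] using hs⟩
    -- The position `f L` is the child made responsible for `L`. Exactly these positions are marked
    -- when the child word is shortened.
    choose! f hf1 hf2 using this
    cases hf with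
    | @node _ _ _ h hred hch =>
      cases hT with
      | @node _ ρ _ hρ hw hts =>
        rw [← hmap] at hw
        obtain ⟨ys, n, g1, g2, g3, g4, g5⟩ := exists_regGen (fun i => (c i).lab)
          (fun i => decide (i ∈ R.map f)) ρ (List.range ts.length) hw
        have hys : ys.Nodup := g1.nodup List.nodup_range
        -- Without marks `M` steps suffice. Otherwise there are at most `R.length`, hence at most
        -- `W` marks, at a cost of at most `2 * M` each.
        have hn : n ≤ N := by
          refine le_trans ?_ hN
          have hρM := hM _ hρ
          simp only at hρM
          obtain h6 | h6 := Nat.eq_zero_or_pos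
            ((List.range ts.length).countP (fun i => decide (i ∈ R.map f)))
          · have := g4 h6; nlinarith
          · have h7 := g5 h6
            have h8 : (List.range ts.length).countP (fun i => decide (i ∈ R.map f)) ≤ W := by
              rw [List.countP_eq_length_filter]
              refine le_trans (List.subperm_of_subset (l₂ := R.map f)
                (List.nodup_range.filter _) ?_).length_le ?_
              · intro i hi
                simpa using (List.mem_filter.1 hi).2
              · rw [List.length_map]; omega
            have := Nat.mul_le_mul hρM h8
            nlinarith
        -- The remaining children are treated one after the other, each starting from the database
        -- left by the previous one. A child receives the sequences assigned to it; without any, it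
        -- costs no record. Numbers and trees obtained earlier survive the extension.
        have key : ∀ zs : List ℕ, zs ⊆ ys → ∀ D, D₀ <:+ D → Valid rs N D →
            (∀ r ∈ D, IsGoal Q r.goal) → ∃ D', D <:+ D' ∧ Valid rs N D' ∧
            (∀ r ∈ D', IsGoal Q r.goal) ∧ D'.length ≤ D.length +
              (zs.map fun y => totalWeight (R.filter fun L => f L = y)).sum ∧
            ∃ us : List (ℕ × Tr), List.Forall₂ (fun y u => (∃ r, At D' u.1 r ∧ r.lab = (c y).lab ∧
              r.goal = h) ∧ TreeAt D' u.1 u.2 ∧ ∀ L ∈ R, f L = y → Sat L u.2) zs us := by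
          intro zs
          induction zs with
          | nil =>
            intro _ D _ hv hDg
            exact ⟨D, List.suffix_rfl, hv, hDg, by simp, [], .nil⟩
          | cons y zs ihz =>
            intro hz D hD hv hDg
            obtain ⟨hz1, hz2⟩ := List.cons_subset.1 hz
            obtain ⟨D₁, k1, k2, k3, k4, us, k5⟩ := ihz hz2 D hD hv hDg
            have hy : y < ts.length := List.mem_range.1 (g1.subset hz1)
            obtain ⟨D₂, m1, m2, m3, m4, j, r, T', m5, m6, m7, m8, m9, -⟩ :=
              ih (c y) (hc y hy) h (hts _ (hc y hy)) (hch _ (hc y hy)) (hred.isGoal hg)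
              (R.filter fun L => f L = y) (by
                intro L hL
                simp only [List.mem_filter, decide_eq_true_eq] at hL
                exact hL.2 ▸ hf2 L hL.1) (by
                have := sum_totalWeight_filter_le f [y] (by simp) R
                simp only [List.map_cons, List.map_nil, List.sum_cons, List.sum_nil] at this
                omega) D₁ (hD.trans k1) k2 k3
            refine ⟨D₂, k1.trans m1, m2, m3, ?_, (j, T') :: us, .cons ⟨⟨r, m5, m6, m7⟩, m8,
              fun L hL hLy => m9 L (by simp [hL, hLy])⟩ (k5.imp ?_)⟩
            · simp only [List.map_cons, List.sum_cons]; omega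
            · rintro y u ⟨⟨r, q1, q2⟩, q3, q4⟩
              exact ⟨⟨r, q1.mono m1, q2⟩, q3.mono m1, q4⟩
        obtain ⟨D', k1, k2, k3, k4, us, k5⟩ := key ys (fun _ h => h) D hD hv hDg
        have k6 := sum_totalWeight_filter_le f ys hys R
        have hstep : Step rs N D' ⟨a, g, us.map Prod.fst⟩ := by
          refine ⟨ρ, h, n, hρ, hred, hn, _, g3, ?_⟩
          rw [List.forall₂_map_left_iff, List.forall₂_map_right_iff]
          exact k5.imp fun _ _ h => h.1
        have hsuf : D' <:+ ⟨a, g, us.map Prod.fst⟩ :: D' := List.suffix_cons _ _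
        -- The children have added at most `totalWeight R` records. This is less than `totalWeight
        -- P`, so there is room for one more, which describes the vertex itself and is put in front.
        refine ⟨⟨a, g, us.map Prod.fst⟩ :: D', k1.trans hsuf, .cons k2 hstep,
          List.forall_mem_cons.2 ⟨hg, k3⟩, by simp only [List.length_cons]; omega,
          D'.length, _, .node a (us.map Prod.snd), at_head _ _, rfl, rfl,
          .mk (r := ⟨a, g, us.map Prod.fst⟩) us (at_head _ _) rfl fun u hu => ?_,
          h5 _ rfl fun L hL => ?_, by simp⟩
        · obtain ⟨y, -, -, hu', -⟩ := exists_of_forall₂_right k5 hu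
          exact hu'.mono hsuf
        · have hy : f L ∈ ys := g2 _ (List.mem_range.2 (hf1 L hL))
            (by simpa using ⟨L, hL, rfl⟩)
          obtain ⟨u, hu, -, -, hu'⟩ := exists_of_forall₂_left k5 hy
          exact ⟨u.2, List.mem_map_of_mem hu, hu' L hL rfl⟩

end Small

/-- A counterexample to containment is described by a small database. -/
theorem exists_valid_of_not_containedIn {d : DTD} {p q : XPath} {M N : ℕ}
    (hM : ∀ ρ ∈ d.rules, (encRegex ρ.2).length ≤ M) (hN : M * (2 * weight p + 1) ≤ N)
    (h : ¬ ContainedIn d p q) :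
    ∃ D r T S, Valid d.rules N (r :: D) ∧ (∀ r' ∈ r :: D, IsGoal (encXPath q) r'.goal) ∧
      (r :: D).length ≤ d.rules.length * (2 * (encXPath q).length + 3) + weight p ∧
      r.lab = d.start ∧ r.goal = encXPath q ∧ TreeAt (r :: D) D.length T ∧ SemT p T S := by
  obtain ⟨T, h1, h2, h3, h4⟩ := not_containedIn_iff.1 h
  obtain ⟨D₀, k1, k2, k3, k4⟩ := exists_covers (rs := d.rules) (N := N) (Q := encXPath q)
    fun ρ hρ => (hM ρ hρ).trans (le_trans (by nlinarith) hN)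
  have hf : FailS (encXPath q) T := by
    simpa using failS_of_not_sat T (L := [q]) (w := []) (by rwa [sat_singleton])
  -- Positive weight ensures that the record of the root is the first one of the database, where the
  -- program expects it.
  have hw : 0 < weight p := by
    by_contra hw
    simpa using weights_eq_zero (L := [p]) (by simp [weights]; omega)
  obtain ⟨D, m1, m2, m3, m4, j, r, T', m5, m6, m7, m8, m9, m10⟩ :=
    k4.exists_model (W := weight p) hM hN T _ h2 hf (.inr (.inl List.suffix_rfl)) [[p]]
      (by simpa [sat_singleton] using h3) (by simp [weights]) D₀ List.suffix_rfl k1 k2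
  have m10 := m10 (by simpa [weights] using hw)
  obtain ⟨D₁, D₂, rfl, rfl⟩ := m5
  have : D₁ = [] := by
    simp only [List.length_append, List.length_cons] at m10
    exact List.length_eq_zero_iff.1 (by omega)
  subst this
  obtain ⟨S, hS⟩ := sat_singleton.1 (m9 [p] (by simp))
  refine ⟨D₂, r, T', S, m2, m3, ?_, m6.trans h1, m7, m8, hS⟩
  simp [weights] at m4 ⊢
  omega

/-- A database can only describe a counterexample to containment. -/
theorem not_containedIn_of_valid {d : DTD} {p q : XPath} {N : ℕ} {D : List Rec} {r : Rec} {T S : Tr}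
    (hD : Valid d.rules N (r :: D)) (hr : r.lab = d.start) (hg : r.goal = encXPath q)
    (hT : TreeAt (r :: D) D.length T) (hS : SemT p T S) : ¬ ContainedIn d p q := by
  obtain ⟨h1, h2⟩ := hD.conf_failS T _ hT
  refine not_containedIn_iff.2 ⟨T, (hT.lab_eq (at_head _ _)).trans hr, h1, ⟨S, hS⟩, ?_⟩
  rw [← sat_singleton]
  have := h2 r (at_head _ _)
  rw [hg] at this
  exact FailS.not_sat T term_nil (by simpa using this)

end XPathDTD

/-! ## What the procedures of the program do -/

namespace XPathDTD

open StackMachine Reg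

variable {l l₁ l₂ : List I} {s s₁ s' : Reg → List Sym} {k k' N j M : ℕ}

/-- The instructions can be executed with at most `k` calls. -/
def Run (l : List I) (s : Reg → List Sym) (k : ℕ) (s' : Reg → List Sym) : Prop :=
  ∃ n ≤ k, Exec prog l s n s'

theorem Run.mono (h : Run l s k s') (hk : k ≤ k') : Run l s k' s' := by
  obtain ⟨n, hn, h⟩ := h
  exact ⟨n, hn.trans hk, h⟩

/-- From here on, the lemmas `exec_…` on the procedures describe what every successful execution
does and serve soundness, while the lemmas `run_…` provide one execution with a bound on its calls
and serve completeness. -/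
theorem run_call {f : Pr} {b : List I} (hb : b ∈ prog f) (h : Run (b ++ l) s k s') :
    Run (call f :: l) s (k + 1) s' := by
  obtain ⟨n, hn, h⟩ := h
  exact ⟨n + 1, by omega, .call hb h⟩

theorem Run.append (h₁ : Run l₁ s k s₁) (h₂ : Run l₂ s₁ k' s') :
    Run (l₁ ++ l₂) s (k + k') s' := by
  obtain ⟨n, hn, h₁⟩ := h₁
  obtain ⟨n', hn', h₂⟩ := h₂
  exact ⟨n + n', by omega, exec_append_iff.2 ⟨n, n', s₁, rfl, h₁, h₂⟩⟩

theorem Run.cons {i : I} (h₁ : Run [i] s k s₁) (h₂ : Run l s₁ k' s') :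
    Run (i :: l) s (k + k') s' := h₁.append h₂

/-! ### The database on its stack -/

/-- The part of the encoding of a record after its number. -/
def recTail (r : Rec) : List Sym := encLabel r.lab ++ (r.goal ++ endg :: r.ch.flatMap uid)

/-- The encoding of a database. -/
def encDB : List Rec → List Sym
  | [] => []
  | r :: db => mark :: (uid db.length ++ (recTail r ++ encDB db))

/-- All goals in the database consist of admissible symbols. -/
def GoodDB (db : List Rec) : Prop := ∀ r ∈ db, ∀ c ∈ r.goal, c ∈ goalSyms

theorem GoodDB.of_cons {r : Rec} {db : List Rec} (h : GoodDB (r :: db)) : GoodDB db :=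
  fun r hr => h r (List.mem_cons_of_mem _ hr)

theorem notMem_uid {c : Sym} (h1 : c ≠ idU) (h2 : c ≠ idE) (i : ℕ) : c ∉ uid i := by
  simp only [uid, List.mem_append, List.mem_replicate, List.mem_singleton]
  tauto

/-- The delimiters of the database are symbols of regular expressions, which do not occur in labels
or goals. This holds because goals are guessed over `goalSyms` only. -/
theorem mark_notMem_recTail {r : Rec} (h : ∀ c ∈ r.goal, c ∈ goalSyms) : mark ∉ recTail r := by
  simp only [recTail, List.mem_append, List.mem_cons, List.mem_flatMap]
  rintro (h1 | h1 | h1 | ⟨i, -, h1⟩)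
  · simpa [goalSyms] using mem_goalSyms_label h1
  · simpa [goalSyms] using h _ h1
  · simp at h1
  · exact notMem_uid (by simp) (by simp) i h1

theorem eq_append_of_notMem {c : Sym} {u v w y : List Sym} (hc : c ∉ v)
    (h : v ++ w = u ++ c :: y) : ∃ u', u = v ++ u' ∧ w = u' ++ c :: y := by
  rcases List.append_eq_append_iff.1 h with ⟨u', rfl, h'⟩ | ⟨v', rfl, h'⟩
  · exact ⟨u', rfl, h'⟩
  · cases v' with
    | nil => exact ⟨[], by simp, by simpa using h'.symm⟩
    | cons c' v' =>
      simp only [List.cons_append, List.cons.injEq] at h'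
      exact absurd (by simp [h'.1]) hc

/-- The symbol `mark` occurs only in front of records, so a guessed position that shows it is the
beginning of a record. -/
theorem encDB_eq_append {db : List Rec} (hD : GoodDB db) {u w : List Sym}
    (h : encDB db = u ++ mark :: w) : ∃ db₁ r db₂, db = db₁ ++ r :: db₂ ∧
      w = uid db₂.length ++ (recTail r ++ encDB db₂) := by
  induction db generalizing u with
  | nil => simp [encDB] at h
  | cons r db ih =>
    cases u with
    | nil =>
      simp only [encDB, List.nil_append, List.cons.injEq, true_and] at h
      exact ⟨[], r, db, rfl, h.symm⟩
    | cons c u =>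
      simp only [encDB, List.cons_append, List.cons.injEq] at h
      obtain ⟨u', -, h⟩ := eq_append_of_notMem (notMem_uid (by simp) (by simp) _) h.2
      obtain ⟨u'', -, h⟩ := eq_append_of_notMem (mark_notMem_recTail (hD r (by simp))) h
      obtain ⟨db₁, r', db₂, rfl, h'⟩ := ih hD.of_cons h
      exact ⟨r :: db₁, r', db₂, rfl, h'⟩

theorem exists_encDB_append (db₁ : List Rec) (r : Rec) (db₂ : List Rec) :
    ∃ u, encDB (db₁ ++ r :: db₂) = u ++ mark :: (uid db₂.length ++ (recTail r ++ encDB db₂)) := by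
  induction db₁ with
  | nil => exact ⟨[], rfl⟩
  | cons r' db₁ ih =>
    obtain ⟨u, hu⟩ := ih
    exact ⟨mark :: (uid (db₁ ++ r :: db₂).length ++ (recTail r' ++ u)), by simp [encDB, hu]⟩

theorem encDB_eq_nil_or (db : List Rec) : encDB db = [] ∨ ∃ w, encDB db = mark :: w := by
  cases db <;> simp [encDB]

variable {x c w b g h n : List Sym} {db : List Rec}

/-- A position in a copy of the database is guessed. The symbol `mark` forces it to be the beginning
of a record, and comparing numbers forces this record to be the one asked for. -/
theorem exec_look (hD : GoodDB db)
    (hx : Exec prog (look ++ l) (st x (encDB db) c [] [] w [] b g h (uid j ++ n)) N s') :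
    ∃ db₁ r db₂ m, db = db₁ ++ r :: db₂ ∧ db₂.length = j ∧ m ≤ N ∧ Exec prog l
      (st x (encDB db) c [] [] w (recTail r ++ encDB db₂) b g h (uid j ++ n)) m s' := by
  simp only [look, List.append_assoc, List.cons_append, List.nil_append, exec_copy, exec_drop,
    exec_pop_iff, exec_eqId, exec_clear, ne_eq, reduceCtorEq, not_false_eq_true, st_D, st_T, st_E,
    st_N, st_V, update_st_E, update_st_V, List.append_nil, true_and] at hx
  obtain ⟨m₁, rfl, u, _, m₂, h1, rfl, v, rfl, m₃, rfl, i, r, r', m₄, rfl, h2, rfl, m₅, rfl,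
    hx⟩ := hx
  obtain ⟨db₁, r₁, db₂, rfl, h3⟩ := encDB_eq_append hD h1
  obtain ⟨rfl, rfl⟩ := uid_append_inj.1 h3
  obtain ⟨rfl, rfl⟩ := uid_append_inj.1 h2
  exact ⟨db₁, r₁, db₂, m₅, rfl, rfl, by omega, hx⟩

theorem run_look {db₁ db₂ : List Rec} {r : Rec} (hj : db₂.length = j)
    (h1 : (encDB (db₁ ++ r :: db₂)).length ≤ M) (h2 : (uid j ++ n).length ≤ M)
    (hx : Run l (st x (encDB (db₁ ++ r :: db₂)) c [] [] w (recTail r ++ encDB db₂) b g h (uid j ++ n))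
      k s') :
    Run (look ++ l) (st x (encDB (db₁ ++ r :: db₂)) c [] [] w [] b g h (uid j ++ n))
      (k + 8 * (M + 1)) s' := by
  obtain ⟨m, hm, hx⟩ := hx
  obtain ⟨u, hu⟩ := exists_encDB_append db₁ r db₂
  subst hj
  simp only [Run, look, List.append_assoc, List.cons_append, List.nil_append, exec_copy, exec_drop,
    exec_pop_iff, exec_eqId, exec_clear, ne_eq, reduceCtorEq, not_false_eq_true, st_D, st_T, st_E,
    st_N, st_V, update_st_E, update_st_V, List.append_nil, true_and]
  refine ⟨_, ?_, _, rfl, u, _, _, hu, rfl, _, rfl, _, rfl, db₂.length, _, _, _, rfl, rfl, rfl, _,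
    rfl, hx⟩
  have := congrArg List.length hu
  simp only [List.length_append, length_uid, List.length_cons] at *
  omega

theorem exec_dupId (hx : Exec prog (dupId ++ l) (st x (encDB db) c [] [] w [] b g h (uid j ++ n))
    N s') : ∃ m ≤ N, Exec prog l (st x (encDB db) c [] [] w [] b g h (uid j ++ (uid j ++ n))) m s' := by
  simp only [dupId, List.append_assoc, List.cons_append, List.nil_append, exec_mvUs, exec_push_iff,
    exec_copy, exec_mvAll, ne_eq, reduceCtorEq, not_false_eq_true, st_T,
    st_N, st_V, update_st_V, update_st_N, List.append_nil, true_and] at hx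
  obtain ⟨i, r, m₁, h1, rfl, m₂, rfl, m₃, rfl, hx⟩ := hx
  obtain ⟨rfl, rfl⟩ := uid_append_inj.1 h1
  refine ⟨m₃, by omega, ?_⟩
  simpa [uid] using hx

theorem run_dupId (hj : j + 1 ≤ M)
    (hx : Run l (st x (encDB db) c [] [] w [] b g h (uid j ++ (uid j ++ n))) k s') :
    Run (dupId ++ l) (st x (encDB db) c [] [] w [] b g h (uid j ++ n)) (k + 8 * (M + 1)) s' := by
  obtain ⟨m, hm, hx⟩ := hx
  simp only [Run, dupId, List.append_assoc, List.cons_append, List.nil_append, exec_mvUs,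
    exec_push_iff, exec_copy, exec_mvAll, ne_eq, reduceCtorEq, not_false_eq_true, st_T,
    st_N, st_V, update_st_V, update_st_N, List.append_nil, true_and]
  refine ⟨_, ?_, j, n, _, rfl, rfl, _, rfl, m, rfl, by simpa [uid] using hx⟩
  simp only [List.length_replicate]
  omega

theorem exec_dropIds : Exec prog (call .dropIds :: l) s N s' ↔ ∃ (js : List ℕ) (r : List Sym) (m :
    ℕ), s E = js.flatMap uid ++ r ∧
    N = (js.flatMap uid).length + js.length + 1 + m ∧
      Exec prog l (Function.update s E r) m s' := by
  constructor
  · intro hx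
    induction N using Nat.strong_induction_on generalizing s with
    | _ N ih =>
      simp only [exec_call_iff, prog, List.mem_cons, List.not_mem_nil, or_false] at hx
      obtain ⟨m, rfl, _, rfl | rfl, hx⟩ := hx
      · exact ⟨[], s E, m, rfl, by simp; omega, by simpa using hx⟩
      · simp only [List.cons_append, List.nil_append, exec_dropId] at hx
        obtain ⟨i, r, m, h1, rfl, hx⟩ := hx
        obtain ⟨js, r', m', h2, rfl, hx'⟩ := ih m (by omega) hx
        simp only [Function.update_self] at h2
        subst h2
        exact ⟨i :: js, r', m', by simp [h1], by simp [length_uid]; omega, by simpa using hx'⟩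
  · rintro ⟨js, r, m, h1, rfl, hx⟩
    induction js generalizing s with
    | nil =>
      simp only [List.flatMap_nil, List.nil_append] at h1
      subst h1
      rw [exec_call_iff]
      exact ⟨m, by simp; omega, [], by simp [prog], by simpa using hx⟩
    | cons i js ih =>
      rw [exec_call_iff]
      refine ⟨_, ?_, [call (.dropId E), call .dropIds], by simp [prog], exec_dropId.2
        ⟨i, js.flatMap uid ++ r, _, by simp [h1], rfl, ih (by simp) (by simpa using hx)⟩⟩
      simp [length_uid]; omega

/-- Behind the list of children the database is exhausted or continues with `mark`, which starts no
number. So skipping an arbitrary number of entries cannot run past the list. -/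
theorem uid_prefix {ch js : List ℕ} {i : ℕ} {R r : List Sym} (hR : R = [] ∨ ∃ w, R = mark :: w)
    (h : ch.flatMap uid ++ R = js.flatMap uid ++ (uid i ++ r)) : i ∈ ch := by
  induction js generalizing ch with
  | nil =>
    cases ch with
    | nil => obtain rfl | ⟨w, rfl⟩ := hR <;> cases i <;> simp [uid, List.replicate_succ] at h
    | cons i' ch =>
      simp only [List.flatMap_cons, List.append_assoc, List.flatMap_nil, List.nil_append] at h
      simp [(uid_append_inj.1 h).1]
  | cons j js ih =>
    cases ch with
    | nil => obtain rfl | ⟨w, rfl⟩ := hR <;> cases j <;> simp [uid, List.replicate_succ] at h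
    | cons i' ch =>
      simp only [List.flatMap_cons, List.append_assoc] at h
      exact List.mem_cons_of_mem _ (ih (uid_append_inj.1 h).2)

theorem goal_endg_inj {g g' r r' : List Sym} (hg : ∀ c ∈ g, c ∈ goalSyms)
    (hg' : ∀ c ∈ g', c ∈ goalSyms) (h : g ++ endg :: r = g' ++ endg :: r') : g = g' ∧ r = r' := by
  have hn : ∀ {g : List Sym}, (∀ c ∈ g, c ∈ goalSyms) → endg ∉ g := fun hg h => by
    simpa [goalSyms] using hg _ h
  obtain ⟨u, rfl, h1⟩ := eq_append_of_notMem (hn hg) h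
  cases u with
  | nil => simpa using h1
  | cons c u =>
    simp only [List.cons_append, List.cons.injEq] at h1
    exact absurd (by simp [h1.1]) (hn hg')

/-! ### Walking through the database -/

theorem exec_goChild (hD : GoodDB db) (hx : Exec prog (call .goChild :: l)
    (st x (encDB db) c [] [] w [] b g h (uid j ++ n)) N s') : ∃ r i m, At db j r ∧ i ∈ r.ch ∧ m ≤
    N ∧
      Exec prog l (st x (encDB db) c [] [] w [] b g h (uid i ++ n)) m s' := by
  simp only [exec_call_iff, prog, List.mem_singleton, exists_eq_left, List.append_assoc] at hx
  obtain ⟨m, rfl, hx⟩ := hx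
  obtain ⟨db₁, r, db₂, m₁, rfl, rfl, h1, hx⟩ := exec_look hD hx
  simp only [List.cons_append, List.nil_append, recTail, List.append_assoc] at hx
  rw [exec_skip_of (reads_label r.lab) rfl] at hx
  simp only [exec_dropGoal, exec_pop_iff, exec_dropIds, exec_dropId, exec_moveId, exec_clear, st_E,
    st_N, update_st_E, update_st_N] at hx
  obtain ⟨m₂, rfl, g', _, m₃, hg', h2, rfl, r', rfl, js, _, m₄, rfl, rfl, i, r'', m₅, h3, rfl, i',
    r₃,
    m₆, rfl, rfl, m₇, rfl, hx⟩ := hx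
  obtain ⟨rfl, rfl⟩ := uid_append_inj.1 h3
  have hg := hD r (by simp)
  obtain ⟨rfl, h4⟩ := goal_endg_inj hg hg' h2
  exact ⟨r, i', m₇, ⟨db₁, db₂, rfl, rfl⟩, uid_prefix (encDB_eq_nil_or db₂) h4, by omega, hx⟩

theorem length_le_flatMap_uid (js : List ℕ) : js.length ≤ (js.flatMap uid).length := by
  induction js with
  | nil => simp
  | cons i js ih => simp [length_uid]; omega

theorem run_goChild (hD : GoodDB db) {r : Rec} (hr : At db j r) {i : ℕ} (hi : i ∈ r.ch)
    (h1 : (encDB db).length ≤ M) (h2 : (uid j ++ n).length ≤ M)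
    (hx : Run l (st x (encDB db) c [] [] w [] b g h (uid i ++ n)) k s') :
    Run (call .goChild :: l) (st x (encDB db) c [] [] w [] b g h (uid j ++ n))
      (k + 20 * (M + 1)) s' := by
  obtain ⟨m, hm, hx⟩ := hx
  obtain ⟨db₁, db₂, rfl, rfl⟩ := hr
  obtain ⟨u, hu⟩ := exists_encDB_append db₁ r db₂
  obtain ⟨j₁, j₂, hj⟩ := List.append_of_mem hi
  refine (run_call (k := k + 6 * (M + 1) + 8 * (M + 1)) List.mem_cons_self ?_).mono (by omega)
  simp only [List.append_assoc]
  refine run_look rfl h1 h2 ?_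
  simp only [Run, recTail, List.cons_append, List.nil_append, List.append_assoc]
  simp only [exec_skip, exec_dropGoal, exec_pop_iff, exec_dropIds, exec_dropId, exec_moveId,
    exec_clear, st_E,
    st_N, update_st_E, update_st_N]
  refine ⟨_, ?_, _, _, _, rfl, reads_label _, rfl, r.goal, _, _, hD r (by simp), rfl, rfl, _, rfl,
    j₁,
    uid i ++ (j₂.flatMap uid ++ encDB db₂), _, by simp [hj], rfl, _, _, _, rfl, rfl, i, _, _, rfl,
    rfl, m, rfl, hx⟩
  have := congrArg List.length hu
  have := length_le_flatMap_uid j₁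
  simp only [recTail, List.length_append, length_uid, List.length_cons, hj, List.flatMap_append,
    List.flatMap_cons] at *
  omega

end XPathDTD

namespace XPathDTD

open StackMachine Reg

variable {l : List I} {s s' : Reg → List Sym} {k N j M : ℕ} {x c w b g h n d v : List Sym}
  {db : List Rec}

/-! ### Evaluating a location path on the database -/

/-- One strong induction on the number of calls covers the mutual recursion of `walk`, `test` and
`fils`. The program moves between numbers of records, and the claim is made for any tree described
by the current one. The numbers in `n`, below the current one, belong to vertices to which enclosing
filters will return. -/
theorem exec_walk_fils (hD : GoodDB db) (N : ℕ) :
    (∀ (p : XPath) (j : ℕ) (r n : List Sym) (l : List I), Exec prog (call .walk :: l)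
        (st x (encDB db) c [] [] w [] b (encXPath p ++ r) h (uid j ++ n)) N s' →
      ∃ j' m, m < N ∧ (∀ T, TreeAt db j T → ∃ T', TreeAt db j' T' ∧ SemT p T T') ∧
        Exec prog l (st x (encDB db) c [] [] w [] b r h (uid j' ++ n)) m s') ∧
    (∀ (es : List XPath) (j : ℕ) (r n : List Sym) (l : List I), Exec prog (call .fils :: l)
        (st x (encDB db) c [] [] w [] b (encFilters es ++ r) h (uid j ++ n)) N s' →
      ∃ m, m < N ∧ (∀ T, TreeAt db j T → AllT es T) ∧
        Exec prog l (st x (encDB db) c [] [] w [] b r h (uid j ++ n)) m s') := by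
  induction N using Nat.strong_induction_on with
  | _ N ih =>
    have htest : ∀ m < N, ∀ (a : Label) (es : List XPath) (j : ℕ) (r n : List Sym) (l : List I),
        Exec prog (call .test :: l) (st x (encDB db) c [] [] w [] b
          (encLabel a ++ (encFilters es ++ r)) h (uid j ++ n)) m s' →
        ∃ m', m' < N ∧ (∀ T, TreeAt db j T → T.lab = a ∧ AllT es T) ∧
          Exec prog l (st x (encDB db) c [] [] w [] b r h (uid j ++ n)) m' s' := by
      intro m hm a es j r n l hx
      simp only [exec_call_iff (f := Pr.test), prog, List.mem_singleton, exists_eq_left,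
        List.append_assoc] at hx
      obtain ⟨m, rfl, hx⟩ := hx
      obtain ⟨D₁, rec, D₂, m₁, rfl, rfl, h1, hx⟩ := exec_look hD hx
      simp only [List.cons_append, List.nil_append, recTail, List.append_assoc, exec_eqLab, ne_eq,
        reduceCtorEq, not_false_eq_true, st_G, st_E, update_st_G, update_st_E, exec_clear] at hx
      obtain ⟨a', _, _, m₂, h2, h3, rfl, m₃, rfl, hx⟩ := hx
      obtain ⟨rfl, rfl⟩ := encLabel_inj h2
      obtain ⟨h4, -⟩ := encLabel_inj h3
      obtain ⟨m₄, h5, h6, hx⟩ := (ih m₃ (by omega)).2 _ _ _ _ _ hx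
      refine ⟨m₄, by omega, fun T hT => ⟨?_, h6 T hT⟩, hx⟩
      rw [hT.lab_eq ⟨D₁, D₂, rfl, rfl⟩, h4]
    constructor
    · intro p j r n l hx
      rw [exec_call_iff] at hx
      obtain ⟨m, rfl, e, he, hx⟩ := hx
      simp only [prog, List.mem_cons, List.not_mem_nil, or_false] at he
      match p with
      | .comp p q =>
        obtain rfl | rfl | rfl := he <;>
        simp only [List.cons_append, List.nil_append, exec_pop_iff, st_G, encXPath,
          List.append_assoc, List.cons.injEq, reduceCtorEq, false_and, exists_false, true_and,
          exists_eq_left', update_st_G] at hx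
        obtain ⟨j₁, m₁, h1, h2, hx⟩ := (ih m (by omega)).1 _ _ _ _ _ hx
        obtain ⟨j₂, m₂, h3, h4, hx⟩ := (ih m₁ (by omega)).1 _ _ _ _ _ hx
        refine ⟨j₂, m₂, by omega, fun T hT => ?_, hx⟩
        obtain ⟨T₁, hT₁, h5⟩ := h2 T hT
        obtain ⟨T₂, hT₂, h6⟩ := h4 T₁ hT₁
        refine ⟨T₂, hT₂, ?_⟩
        simp only [SemT]
        exact ⟨T₁, h5, h6⟩
      | .step .self a es =>
        obtain rfl | rfl | rfl := he <;>
        simp only [List.cons_append, List.nil_append, exec_pop_iff, st_G, encXPath, encAxis,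
          List.append_assoc, List.cons.injEq, reduceCtorEq, false_and, exists_false, true_and,
          exists_eq_left', update_st_G] at hx
        obtain ⟨m₁, h1, h2, hx⟩ := htest m (by omega) _ _ _ _ _ _ hx
        refine ⟨j, m₁, h1, fun T hT => ⟨T, hT, ?_⟩, hx⟩
        simp only [SemT]
        exact ⟨trivial, h2 T hT⟩
      | .step .child a es =>
        obtain rfl | rfl | rfl := he <;>
        simp only [List.cons_append, List.nil_append, exec_pop_iff, st_G, encXPath, encAxis,
          List.append_assoc, List.cons.injEq, reduceCtorEq, false_and, exists_false, true_and,
          exists_eq_left', update_st_G] at hx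
        obtain ⟨rec, i, m₁, hr, hi, h1, hx⟩ := exec_goChild hD hx
        obtain ⟨m₂, h2, h3, hx⟩ := htest m₁ (by omega) _ _ _ _ _ _ hx
        refine ⟨i, m₂, h2, fun T hT => ?_, hx⟩
        obtain ⟨rec', zs, h4, h5, h6, rfl⟩ := hT.inv
        rw [hr.unique h4, ← h5] at hi
        obtain ⟨z, hz, rfl⟩ := List.mem_map.1 hi
        refine ⟨z.2, h6 z hz, ?_⟩
        simp only [SemT]
        exact ⟨List.mem_map_of_mem hz, h3 _ (h6 z hz)⟩
    · intro es j r n l hx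
      rw [exec_call_iff] at hx
      obtain ⟨m, rfl, e, he, hx⟩ := hx
      simp only [prog, List.mem_cons, List.not_mem_nil, or_false] at he
      match es with
      | [] =>
        obtain rfl | rfl := he <;>
        simp only [List.cons_append, List.nil_append, exec_pop_iff, st_G, encFilters,
          List.append_assoc, List.cons.injEq, reduceCtorEq, false_and, exists_false, true_and,
          exists_eq_left', update_st_G] at hx
        exact ⟨m, by omega, fun T _ => by simp only [AllT], hx⟩
      | e :: es =>
        obtain rfl | rfl := he <;>
        simp only [List.cons_append, List.nil_append, exec_pop_iff, st_G, encFilters,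
          List.append_assoc, List.cons.injEq, reduceCtorEq, false_and, exists_false, true_and,
          exists_eq_left', update_st_G] at hx
        obtain ⟨m₁, h1, hx⟩ := exec_dupId hx
        obtain ⟨j', m₂, h2, h3, hx⟩ := (ih m₁ (by omega)).1 _ _ _ _ _ hx
        simp only [exec_dropId, st_N, update_st_N] at hx
        obtain ⟨i, r', m₃, h4, rfl, hx⟩ := hx
        obtain ⟨rfl, rfl⟩ := uid_append_inj.1 h4
        obtain ⟨m₄, h5, h6, hx⟩ := (ih m₃ (by omega)).2 _ _ _ _ _ hx
        refine ⟨m₄, by omega, fun T hT => ?_, hx⟩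
        obtain ⟨T', -, hT'⟩ := h3 T hT
        simp only [AllT]
        exact ⟨⟨T', hT'⟩, h6 T hT⟩

theorem TreeAt.lt {U : Tr} (hT : TreeAt db j U) : j < db.length := by
  obtain ⟨r, -, hr, -⟩ := hT.inv
  exact hr.lt

theorem run_test {U : Tr} {r : List Sym} (hT : TreeAt db j U) (h1 : (encDB db).length ≤ M)
    (h2 : (uid j ++ n).length ≤ M)
    (hx : Run (call .fils :: l) (st x (encDB db) c [] [] w [] b r h (uid j ++ n)) k s') :
    Run (call .test :: l) (st x (encDB db) c [] [] w [] b (encLabel U.lab ++ r) h (uid j ++ n))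
      (k + 12 * (M + 1)) s' := by
  obtain ⟨m, hm, hx⟩ := hx
  obtain ⟨rec, zs, hr, -⟩ := hT.inv
  rw [hT.lab_eq hr]
  obtain ⟨db₁, db₂, rfl, rfl⟩ := hr
  obtain ⟨u, hu⟩ := exists_encDB_append db₁ rec db₂
  refine (run_call (k := k + 3 * (M + 1) + 8 * (M + 1)) List.mem_cons_self ?_).mono (by omega)
  simp only [List.append_assoc]
  refine run_look rfl h1 h2 ?_
  simp only [Run, List.cons_append, List.nil_append, recTail, List.append_assoc, exec_eqLab, ne_eq,
    reduceCtorEq, not_false_eq_true, st_G, st_E, update_st_G, update_st_E, exec_clear]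
  refine ⟨_, ?_, rec.lab, _, _, _, rfl, rfl, rfl, m, rfl, hx⟩
  have := congrArg List.length hu
  simp only [recTail, encLabel, List.length_append, length_uid, List.length_cons, List.length_map,
    List.length_nil] at *
  omega

mutual
-- Every symbol of the path costs at most `40 * (M + 1)` calls. The hypothesis on `M` is a budget
-- for the stack `N`: entering a filter saves one more number, of length at most `db.length`, and
-- the filter is shorter than the list it is taken from, so the budget is preserved.
theorem run_walk (hD : GoodDB db) (h1 : (encDB db).length ≤ M) : ∀ (p : XPath) {j : ℕ} {U T' : Tr}
    {r n : List Sym}, SemT p U T' → TreeAt db j U →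
    n.length + (db.length + 1) * (encXPath p).length ≤ M → ∃ j', TreeAt db j' T' ∧
    Run [call .walk] (st x (encDB db) c [] [] w [] b (encXPath p ++ r) h (uid j ++ n))
      ((encXPath p).length * (40 * (M + 1))) (st x (encDB db) c [] [] w [] b r h (uid j' ++ n))
  | .comp p q, j, U, T', r, n, hs, hT, hn => by
    simp only [SemT] at hs
    obtain ⟨S, hs1, hs2⟩ := hs
    simp only [encXPath, List.length_cons, List.length_append] at hn
    obtain ⟨j₁, hT₁, hx1⟩ := run_walk hD h1 p (n := n) (r := encXPath q ++ r) hs1 hT (by nlinarith)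
    obtain ⟨j₂, hT₂, hx2⟩ := run_walk hD h1 q (n := n) (r := r) hs2 hT₁ (by nlinarith)
    refine ⟨j₂, hT₂, (run_call (b := [pop G .slash, call .walk, call .walk]) (by simp [prog])
      (k := (encXPath p).length * (40 * (M + 1)) + (encXPath q).length * (40 * (M +
      1))) ?_).mono ?_⟩
    · obtain ⟨m, hm, hx⟩ := hx1.cons hx2
      refine ⟨m, hm, ?_⟩
      simpa [encXPath, exec_pop_iff] using hx
    · simp only [encXPath, List.length_cons, List.length_append]
      nlinarith
  | .step .self a es, j, U, T', r, n, hs, hT, hn => by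
    simp only [SemT] at hs
    obtain ⟨rfl, rfl, hs⟩ := hs
    simp only [encXPath, encAxis, List.length_cons, List.length_append] at hn
    have hj := hT.lt
    have hx := run_test (b := b) (w := w) (c := c) (x := x) (h := h) (l := []) (n := n) hT h1
      (by simp only [List.length_append, length_uid]; nlinarith)
      (run_fils hD h1 es (n := n) (r := r) hs hT (by nlinarith))
    refine ⟨j, hT, (run_call (b := [pop G .self, call .test]) (by simp [prog])
      (k := (encFilters es).length * (40 * (M + 1)) + 12 * (M + 1)) ?_).mono ?_⟩
    · obtain ⟨m, hm, hx⟩ := hx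
      refine ⟨m, hm, ?_⟩
      simpa [encXPath, encAxis, exec_pop_iff] using hx
    · simp only [encXPath, List.length_cons, List.length_append]
      nlinarith
  | .step .child a es, j, U, T', r, n, hs, hT, hn => by
    simp only [SemT] at hs
    obtain ⟨hc, rfl, hs⟩ := hs
    simp only [encXPath, encAxis, List.length_cons, List.length_append] at hn
    have hj := hT.lt
    obtain ⟨rec, zs, hr, hz, hzs, rfl⟩ := hT.inv
    obtain ⟨z, hz', rfl⟩ := List.mem_map.1 hc
    have hT' := hzs z hz'
    have hi : z.1 ∈ rec.ch := hz ▸ List.mem_map_of_mem hz'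
    have hj' := hT'.lt
    have hx := run_test (b := b) (w := w) (c := c) (x := x) (h := h) (l := []) (n := n) hT' h1
      (by simp only [List.length_append, length_uid]; nlinarith)
      (run_fils hD h1 es (n := n) (r := r) hs hT' (by nlinarith))
    replace hx := run_goChild hD hr hi h1
      (by simp only [List.length_append, length_uid]; nlinarith) hx
    refine ⟨z.1, hT', (run_call (b := [pop G .child, call .goChild, call .test]) (by simp [prog])
      (k := (encFilters es).length * (40 * (M + 1)) + 12 * (M + 1) + 20 * (M + 1)) ?_).mono ?_⟩
    · obtain ⟨m, hm, hx⟩ := hx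
      refine ⟨m, hm, ?_⟩
      simpa [encXPath, encAxis, exec_pop_iff] using hx
    · simp only [encXPath, List.length_cons, List.length_append]
      nlinarith
theorem run_fils (hD : GoodDB db) (h1 : (encDB db).length ≤ M) : ∀ (es : List XPath) {j : ℕ} {U :
    Tr}
    {r n : List Sym}, AllT es U → TreeAt db j U →
    n.length + (db.length + 1) * (encFilters es).length ≤ M →
    Run [call .fils] (st x (encDB db) c [] [] w [] b (encFilters es ++ r) h (uid j ++ n))
      ((encFilters es).length * (40 * (M + 1))) (st x (encDB db) c [] [] w [] b r h (uid j ++ n))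
  | [], j, U, r, n, hs, hT, hn => by
    refine (run_call (b := [pop G .done]) (by simp [prog]) (k := 0) ?_).mono ?_
    · exact ⟨0, le_rfl, by simp [encFilters, exec_pop_iff, exec_nil_iff]⟩
    · simp only [encFilters, List.length_cons, List.length_nil]; omega
  | e :: es, j, U, r, n, hs, hT, hn => by
    simp only [AllT] at hs
    obtain ⟨⟨T', hs1⟩, hs2⟩ := hs
    simp only [encFilters, List.length_cons, List.length_append] at hn
    have hj := hT.lt
    obtain ⟨j', hT', hx1⟩ := run_walk hD h1 e (r := encFilters es ++ r) (n := uid j ++ n) hs1 hT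
      (by simp only [List.length_append, length_uid]; nlinarith)
    have hj' := hT'.lt
    have hx2 := run_fils hD h1 es (n := n) (r := r) hs2 hT (by nlinarith)
    have hx3 : Run [call (.dropId N), call .fils]
        (st x (encDB db) c [] [] w [] b (encFilters es ++ r) h (uid j' ++ (uid j ++ n)))
        ((encFilters es).length * (40 * (M + 1)) + (M + 1))
        (st x (encDB db) c [] [] w [] b r h (uid j ++ n)) := by
      obtain ⟨m, hm, hx⟩ := hx2
      simp only [Run, exec_dropId, st_N, update_st_N]
      exact ⟨_, by nlinarith, j', _, m, rfl, rfl, hx⟩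
    have hx4 := run_dupId (M := M) (by nlinarith) (hx1.cons hx3)
    refine (run_call (b := _) (List.mem_cons_of_mem _ List.mem_cons_self)
      (k := (encXPath e).length *
      (40 * (M + 1)) + ((encFilters es).length * (40 * (M + 1)) + (M + 1)) + 8 * (M +
      1)) ?_).mono ?_
    · obtain ⟨m, hm, hx⟩ := hx4
      refine ⟨m, hm, ?_⟩
      simpa [encFilters, exec_pop_iff] using hx
    · simp only [encFilters, List.length_cons, List.length_append]
      nlinarith
end

/-! ### Comparing labels -/

theorem mem_neqLab {a b : Reg} {e : List I} : e ∈ prog (.neqLab a b) ↔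
    (∃ c, e = [pop a (.bit c), pop b (.bit c), call (.neqLab a b)]) ∨
    (∃ c, e = [pop a .sep, pop b (.bit c)]) ∨
    (∃ c, e = [pop a (.bit c), pop b .sep, call (.skip .label a)]) ∨
    ∃ c, e = [pop a (.bit c), pop b (.bit !c), call (.skip .label a)] := by
  simp only [prog, List.map_cons, List.map_nil, List.mem_append, List.mem_cons, List.not_mem_nil,
    or_false, Bool.exists_bool, Bool.not_true, Bool.not_false]
  tauto

theorem update_update_update (a b : Reg) (p q r t : List Sym) :
    Function.update (Function.update (Function.update (Function.update s a p) b q) a r) b t =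
      Function.update (Function.update s a r) b t := by
  funext k
  simp only [Function.update_apply]
  split_ifs <;> simp_all

theorem encLabel_nil : encLabel [] = [.sep] := rfl

theorem encLabel_cons (e : Bool) (z : Label) : encLabel (e :: z) = .bit e :: encLabel z := rfl

/-- The rest `t` left on the second stack depends on where the labels differ. It is left unspecified
because the callers clear that stack or do not use it further. -/
theorem exec_neqLab {a b : Reg} (hab : a ≠ b) {y : Label} {r' : List Sym}
    (hb : s b = encLabel y ++ r') (hx : Exec prog (call (.neqLab a b) :: l) s N s') :
    ∃ z r t m, s a = encLabel z ++ r ∧ z ≠ y ∧ m ≤ N ∧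
      Exec prog l (Function.update (Function.update s a r) b t) m s' := by
  induction y generalizing s N with
  | nil =>
    rw [exec_call_iff] at hx
    obtain ⟨m, rfl, e, he, hx⟩ := hx
    obtain ⟨e, rfl⟩ | ⟨e, rfl⟩ | ⟨e, rfl⟩ | ⟨e, rfl⟩ := mem_neqLab.1 he <;>
    simp only [List.cons_append, List.nil_append, exec_pop_iff, Function.update_of_ne hab.symm, hb,
      encLabel_nil, List.cons.injEq, reduceCtorEq, false_and, exists_false, and_false, true_and,
      exists_eq_left'] at hx
    obtain ⟨r, h1, hx⟩ := hx
    obtain ⟨u, r₁, m₁, h2, h3, rfl, hx'⟩ := exec_skip.1 hx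
    obtain ⟨z, rfl⟩ := h3.encodes
    rw [Function.update_of_ne hab, Function.update_self] at h2
    subst h2
    refine ⟨e :: z, r₁, r', m₁, by simp [h1, encLabel_cons], by simp, by omega, ?_⟩
    convert hx' using 1
    funext k
    simp only [Function.update_apply]
    split_ifs <;> simp_all
  | cons y₁ y ih =>
    rw [exec_call_iff] at hx
    obtain ⟨m, rfl, e, he, hx⟩ := hx
    obtain ⟨e, rfl⟩ | ⟨e, rfl⟩ | ⟨e, rfl⟩ | ⟨e, rfl⟩ := mem_neqLab.1 he <;>
    simp only [List.cons_append, List.nil_append, exec_pop_iff, Function.update_of_ne hab.symm, hb,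
      encLabel_cons, List.cons.injEq, reduceCtorEq, false_and, exists_false, and_false,
      Sym.bit.injEq] at hx
    · obtain ⟨r, h1, _, ⟨rfl, rfl⟩, hx⟩ := hx
      obtain ⟨z, r₁, t, m₁, h2, h3, h4, hx⟩ := ih (by simp) hx
      rw [Function.update_of_ne hab, Function.update_self] at h2
      subst h2
      rw [update_update_update] at hx
      exact ⟨y₁ :: z, r₁, t, m₁, by simp [h1, encLabel_cons], by simpa using h3, by omega, hx⟩
    · obtain ⟨r, h1, _, ⟨rfl, rfl⟩, hx⟩ := hx
      exact ⟨[], r, _, m, by simp [h1, encLabel_nil], by simp, by omega, hx⟩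
    · obtain ⟨r, h1, _, ⟨rfl, rfl⟩, hx⟩ := hx
      obtain ⟨u, r₁, m₁, h2, h3, rfl, hx'⟩ := exec_skip.1 hx
      obtain ⟨z, rfl⟩ := h3.encodes
      rw [Function.update_of_ne hab, Function.update_self] at h2
      subst h2
      refine ⟨e :: z, r₁, encLabel y ++ r', m₁, by simp [h1, encLabel_cons], by simp, by omega, ?_⟩
      convert hx' using 1
      funext k
      simp only [Function.update_apply]
      split_ifs <;> simp_all

theorem run_neqLab {a b : Reg} (hab : a ≠ b) {z y : Label} {r r' : List Sym} (hzy : z ≠ y)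
    (ha : s a = encLabel z ++ r) (hb : s b = encLabel y ++ r') :
    ∃ t, t.length ≤ (s b).length ∧ Run [call (.neqLab a b)] s (z.length + 2)
      (Function.update (Function.update s a r) b t) := by
  induction z generalizing y s with
  | nil =>
    cases y with
    | nil => exact absurd rfl hzy
    | cons e y =>
      refine ⟨encLabel y ++ r', by simp [hb, encLabel_cons], (run_call (k := 0)
        (mem_neqLab.2 (.inr (.inl ⟨e, rfl⟩))) ⟨0, le_rfl, ?_⟩).mono (by omega)⟩
      simp [exec_pop_iff, exec_nil_iff, ha, hb, encLabel_nil, encLabel_cons, hab.symm]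
  | cons e z ih =>
    have hskip : ∀ t, Exec prog [call (.skip .label a)]
        (Function.update (Function.update s a (encLabel z ++ r)) b t) (z.length + 1)
        (Function.update (Function.update s a r) b t) := by
      intro t
      refine exec_skip.2 ⟨encLabel z, r, 0, by simp [hab], reads_label z, by simp [encLabel],
        exec_nil_iff.2 ⟨rfl, ?_⟩⟩
      funext k
      simp only [Function.update_apply]
      split_ifs <;> simp_all
    cases y with
    | nil =>
      refine ⟨r', by simp [hb, encLabel_nil], run_call (k := z.length + 1 + 1)
        (mem_neqLab.2 (.inr (.inr (.inl ⟨e, rfl⟩)))) ⟨z.length + 1, by omega, ?_⟩⟩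
      simpa [exec_pop_iff, ha, hb, encLabel_nil, encLabel_cons, hab.symm] using hskip r'
    | cons e' y =>
      by_cases he : e = e'
      · subst he
        obtain ⟨t, h1, m, hm,
          hx⟩ := ih (s := Function.update (Function.update s a (encLabel z ++ r))
          b (encLabel y ++ r')) (y := y) (by simpa using hzy) (by simp [hab]) (by simp)
        simp only [Function.update_self, List.length_append] at h1
        refine ⟨t, ?_, run_call (k := z.length + 2) (mem_neqLab.2 (.inl ⟨e, rfl⟩)) ⟨m, hm, ?_⟩⟩
        · simp [hb, encLabel_cons]; omega
        · rw [update_update_update] at hx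
          simpa [exec_pop_iff, ha, hb, encLabel_cons, hab.symm] using hx
      · refine ⟨encLabel y ++ r', by simp [hb, encLabel_cons], run_call (k := z.length + 1 + 1)
          (mem_neqLab.2 (.inr (.inr (.inr ⟨e, rfl⟩)))) ⟨z.length + 1, by omega, ?_⟩⟩
        have : e' = !e := by cases e <;> cases e' <;> simp_all
        simpa [exec_pop_iff, ha, hb, encLabel_cons, hab.symm, this] using hskip (encLabel y ++ r')

end XPathDTD

namespace XPathDTD

open StackMachine Reg

variable {l : List I} {s s' : Reg → List Sym} {k N j M : ℕ} {x c w b g h n d e : List Sym}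
  {db : List Rec}

/-! ### Searching the rules -/

/-- The search may stop anywhere, even behind the last rule. The symbol `more` required next
guarantees that it has stopped in front of a rule. -/
theorem exec_findRule {a : Reg} {ρs : List (Label × RegularExpression Label)} {r : List Sym}
    (ha : s a = encRules ρs ++ r)
    (hx : Exec prog (call (.findRule a) :: pop a .more :: l) s N s') :
    ∃ ρs₁ ρ ρs₂ m, ρs = ρs₁ ++ ρ :: ρs₂ ∧ m ≤ N ∧ Exec prog l (Function.update s a
      (encLabel ρ.1 ++ (encRegex ρ.2 ++ (encRules ρs₂ ++ r)))) m s' := by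
  induction ρs generalizing s N with
  | nil =>
    rw [exec_call_iff] at hx
    obtain ⟨m, rfl, t, ht, hx⟩ := hx
    simp only [prog, List.mem_cons, List.not_mem_nil, or_false] at ht
    obtain rfl | rfl := ht <;> simp [exec_pop_iff, ha, encRules] at hx
  | cons ρ ρs ih =>
    rw [exec_call_iff] at hx
    obtain ⟨m, rfl, t, ht, hx⟩ := hx
    simp only [prog, List.mem_cons, List.not_mem_nil, or_false] at ht
    simp only [encRules, List.cons_append, List.append_assoc] at ha
    obtain rfl | rfl := ht <;>
      simp only [List.nil_append, List.cons_append, exec_pop_iff, ha, List.cons.injEq, true_and,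
        exists_eq_left'] at hx
    · exact ⟨[], ρ, ρs, m, rfl, by omega, hx⟩
    · rw [exec_skip_of (r := encRegex ρ.2 ++ (encRules ρs ++ r)) (reads_label ρ.1) (by simp)] at hx
      obtain ⟨m₁, rfl, hx⟩ := hx
      rw [exec_skip_of (r := encRules ρs ++ r) (reads_regex ρ.2) (by simp)] at hx
      obtain ⟨m₂, rfl, hx⟩ := hx
      obtain ⟨ρs₁, ρ', ρs₂, m₃, rfl, h1, hx⟩ := ih (by simp) hx
      exact ⟨ρ :: ρs₁, ρ', ρs₂, m₃, rfl, by omega, by simpa using hx⟩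

theorem run_findRule {a : Reg} {ρs₁ ρs₂ : List (Label × RegularExpression Label)}
    {ρ : Label × RegularExpression Label} {r : List Sym}
    (ha : s a = encRules (ρs₁ ++ ρ :: ρs₂) ++ r) (hx : Run l (Function.update s a
      (encLabel ρ.1 ++ (encRegex ρ.2 ++ (encRules ρs₂ ++ r)))) k s') :
    Run (call (.findRule a) :: pop a .more :: l) s (k + (s a).length) s' := by
  induction ρs₁ generalizing s with
  | nil =>
    obtain ⟨m, hm, hx⟩ := hx
    simp only [List.nil_append, encRules, List.cons_append, List.append_assoc] at ha
    refine (run_call (b := []) (by simp [prog]) (k := k) ⟨m, hm, ?_⟩).mono (by simp [ha])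
    simpa [exec_pop_iff, ha] using hx
  | cons ρ' ρs₁ ih =>
    simp only [encRules, List.cons_append, List.append_assoc] at ha
    obtain ⟨m, hm, hx⟩ := ih (s := Function.update s a (encRules (ρs₁ ++ ρ :: ρs₂) ++ r)) (by simp)
      (by simpa using hx)
    simp only [Function.update_self, List.length_append] at hm
    refine (run_call (b := _) (List.mem_cons_of_mem _ List.mem_cons_self)
      (k := (encLabel ρ'.1).length + (encRegex ρ'.2).length + m) ⟨_, le_rfl, ?_⟩).mono ?_
    · simp only [List.cons_append, List.nil_append, exec_pop_iff, ha, List.cons.injEq, true_and,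
        exists_eq_left']
      rw [exec_skip_of (r := encRegex ρ'.2 ++ (encRules (ρs₁ ++ ρ :: ρs₂) ++ r)) (reads_label ρ'.1)
        (by simp)]
      refine ⟨_, add_assoc _ _ _, ?_⟩
      rw [exec_skip_of (r := encRules (ρs₁ ++ ρ :: ρs₂) ++ r) (reads_regex ρ'.2) (by simp)]
      exact ⟨m, rfl, by simpa using hx⟩
    · simp [ha]; omega

theorem not_mem_of_exec_notIn {y : Label} {ρs : List (Label × RegularExpression Label)}
    {r v : List Sym} (hx : Exec prog (call .notIn :: l)
      (st x d c [] (encLabel y ++ v) (encRules ρs ++ r) [] b g h n) N s') :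
    y ∉ ρs.map Prod.fst := by
  induction ρs generalizing N with
  | nil => simp
  | cons ρ ρs ih =>
    rw [exec_call_iff] at hx
    obtain ⟨m, rfl, t, ht, hx⟩ := hx
    simp only [prog, List.mem_cons, List.not_mem_nil, or_false] at ht
    obtain rfl | rfl := ht <;>
      simp only [List.nil_append, List.cons_append, List.append_assoc, exec_pop_iff, encRules, st_W,
        List.cons.injEq, reduceCtorEq, false_and, exists_false, true_and, exists_eq_left',
        update_st_W, exec_copy, ne_eq, not_false_eq_true, st_T, st_V, st_E, update_st_E] at hx
    obtain ⟨m₁, rfl, hx⟩ := hx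
    obtain ⟨z, r', t, m₂, h1, h2, h3, hx⟩ := exec_neqLab (by decide) rfl hx
    obtain ⟨rfl, rfl⟩ := encLabel_inj h1
    simp only [exec_clear, update_st_E, update_st_W, st_E] at hx
    obtain ⟨m₃, rfl, hx⟩ := hx
    rw [exec_skip_of (reads_regex ρ.2) rfl] at hx
    obtain ⟨m₄, rfl, hx⟩ := hx
    rw [update_st_W] at hx
    exact List.not_mem_cons_of_ne_of_not_mem h2.symm (ih hx)

theorem run_notIn {y : Label} {ρs : List (Label × RegularExpression Label)}
    {r v : List Sym} (hy : y ∉ ρs.map Prod.fst) (h1 : (encLabel y ++ v).length ≤ M)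
    (h2 : (encRules ρs).length ≤ M) :
    Run [call .notIn] (st x d c [] (encLabel y ++ v) (encRules ρs ++ r) [] b g h n)
      ((encRules ρs).length * (8 * (M + 1))) (st x d c [] (encLabel y ++ v) r [] b g h n) := by
  induction ρs with
  | nil =>
    refine (run_call (b := [pop W .done]) (by simp [prog]) (k := 0) ?_).mono ?_
    · exact ⟨0, le_rfl, by simp [encRules, exec_pop_iff, exec_nil_iff]⟩
    · simp [encRules]; omega
  | cons ρ ρs ih =>
    simp only [List.map_cons, List.mem_cons, not_or] at hy
    simp only [encRules, List.length_cons, List.length_append] at h2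
    have hx := ih hy.2 (by omega)
    obtain ⟨t, h3, hx1⟩ := run_neqLab (a := W) (b := E) (by decide) (z := ρ.1) (y := y)
      (Ne.symm hy.1)
      (s := st x d c [] (encLabel y ++ v) (encLabel ρ.1 ++ (encRegex ρ.2 ++ (encRules ρs ++ r)))
        (encLabel y ++ v) b g h n) rfl rfl
    simp only [update_st_E, update_st_W, st_E] at hx1 h3
    have hx2 : Run (clear E ++ [call (.skip .regex W), call .notIn])
        (st x d c [] (encLabel y ++ v) (encRegex ρ.2 ++ (encRules ρs ++ r)) t b g h n)
        ((encRules ρs).length * (8 * (M + 1)) + t.length + 1 + (encRegex ρ.2).length)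
        (st x d c [] (encLabel y ++ v) r [] b g h n) := by
      obtain ⟨m, hm, hx⟩ := hx
      simp only [Run, exec_clear, exec_skip, st_E, st_W, update_st_E, update_st_W]
      exact ⟨_, by omega, _, rfl, _, _, m, rfl, reads_regex _, rfl, hx⟩
    obtain ⟨m, hm, hx3⟩ := hx1.cons hx2
    refine (run_call (b := _) (List.mem_cons_of_mem _ List.mem_cons_self)
      (k := 2 * (encLabel y ++ v).length + 2 + m) ⟨_, le_rfl, ?_⟩).mono ?_
    · simp only [List.nil_append, List.cons_append, List.append_assoc, exec_pop_iff, encRules, st_W,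
        List.cons.injEq, true_and, exists_eq_left',
        update_st_W, exec_copy, ne_eq, reduceCtorEq, not_false_eq_true, st_T, st_V, st_E,
        update_st_E, List.append_nil]
      exact ⟨m, rfl, hx3⟩
    · have : (encLabel ρ.1).length = ρ.1.length + 1 := by simp [encLabel]
      simp only [encRules, List.length_cons, List.length_append] at *
      nlinarith

/-! ### Reducing goals -/

theorem Red.mem_goalSyms {a : Label} {f : Bool} {s h : List Sym} (hr : Red a f s h)
    (hs : ∀ c ∈ s, c ∈ goalSyms) : ∀ c ∈ h, c ∈ goalSyms := by
  induction hr with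
  | slash _ ih => exact ih fun c hc => hs c (by simp [hc])
  | neq => simp [goalSyms]
  | self _ ih => exact ih fun c hc => hs c (by simp [hc])
  | child => simp only [List.mem_cons, forall_eq_or_imp] at hs ⊢; exact ⟨by simp [goalSyms], hs.2⟩
  | noGoal => exact hs
  | pick _ ih => exact ih fun c hc => hs c (by simp [hc])
  | skip _ ih => exact ih fun c hc => hs c (by simp [hc])
  | done _ ih => exact ih fun c hc => hs c (by simp [hc])

/-- The two procedures are treated together, with the flag of `Red` telling which one is called. -/
theorem exec_reduce {a : Label} (N : ℕ) : ∀ (f : Bool) (t : List Sym) (l : List I),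
    Exec prog (call (if f then Pr.redFil else .reduce) :: l)
      (st x d c [] [] w e (encLabel a) g t n) N s' →
    ∃ h m, Red a f t h ∧ m ≤ N ∧ Exec prog l (st x d c [] [] w e (encLabel a) g h n) m s' := by
  induction N using Nat.strong_induction_on with
  | _ N ih =>
    intro f t l hx
    rw [exec_call_iff] at hx
    obtain ⟨m, rfl, i, hi, hx⟩ := hx
    have ihf := fun m' hm => ih m' hm false
    have iht := fun m' hm => ih m' hm true
    simp only [Bool.false_eq_true, if_false, if_true] at ihf iht
    cases f with
    | false =>
      simp only [Bool.false_eq_true, if_false, prog, List.mem_cons, List.not_mem_nil,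
        or_false] at hi
      obtain rfl | rfl | rfl | rfl | rfl := hi <;>
        simp only [List.nil_append, List.cons_append, List.append_assoc, exec_pop_iff,
          exec_push_iff,
          st_H, update_st_H] at hx
      · obtain ⟨t, rfl, hx⟩ := hx
        obtain ⟨h, m', h1, h2, hx⟩ := ihf m (by omega) _ _ hx
        exact ⟨h, m', .slash h1, by omega, hx⟩
      · obtain ⟨t, rfl, hx⟩ := hx
        simp only [exec_copy, ne_eq, reduceCtorEq, not_false_eq_true, st_T, st_B, st_V, update_st_V,
          List.append_nil, true_and] at hx
        obtain ⟨m₁, rfl, hx⟩ := hx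
        obtain ⟨z, r, t', m₂, h1, h2, h3, hx⟩ := exec_neqLab (y := a) (r' := []) (by decide)
          (by simp) hx
        simp only [st_H] at h1
        subst h1
        simp only [update_st_H, update_st_V, exec_clear, st_H, st_V, exec_push_iff] at hx
        obtain ⟨m₃, rfl, m₄, rfl, hx⟩ := hx
        exact ⟨_, m₄, .neq h2, by omega, hx⟩
      · obtain ⟨t, rfl, hx⟩ := hx
        obtain ⟨u, r, m₁, h1, h2, rfl, hx'⟩ := exec_skip.1 hx
        obtain ⟨z, rfl⟩ := h2.encodes
        simp only [st_H] at h1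
        subst h1
        rw [update_st_H] at hx'
        obtain ⟨h, m', h1, h2, hx⟩ := iht m₁ (by omega) _ _ hx'
        exact ⟨h, m', .self h1, by omega, hx⟩
      · obtain ⟨t, rfl, hx⟩ := hx
        exact ⟨_, m, .child, by omega, hx⟩
      · obtain ⟨t, rfl, hx⟩ := hx
        exact ⟨_, m, .noGoal, by omega, hx⟩
    | true =>
      simp only [if_true, prog, List.mem_cons, List.not_mem_nil, or_false] at hi
      obtain rfl | rfl | rfl := hi <;>
        simp only [List.nil_append, List.cons_append, exec_pop_iff,
          st_H, update_st_H] at hx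
      · obtain ⟨t, rfl, hx⟩ := hx
        obtain ⟨h, m', h1, h2, hx⟩ := ihf m (by omega) _ _ hx
        exact ⟨h, m', .pick h1, by omega, hx⟩
      · obtain ⟨t, rfl, hx⟩ := hx
        obtain ⟨u, r, m₁, h1, h2, rfl, hx'⟩ := exec_skip.1 hx
        obtain ⟨z, rfl⟩ := h2.encodes
        simp only [st_H] at h1
        subst h1
        rw [update_st_H] at hx'
        obtain ⟨h, m', h1, h2, hx⟩ := iht m₁ (by omega) _ _ hx'
        exact ⟨h, m', .skip h1, by omega, hx⟩
      · obtain ⟨t, rfl, hx⟩ := hx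
        obtain ⟨h, m', h1, h2, hx⟩ := ihf m (by omega) _ _ hx
        exact ⟨h, m', .done h1, by omega, hx⟩

theorem run_reduce {a : Label} {f : Bool} {t h : List Sym} (hr : Red a f t h) :
    Run [call (if f then Pr.redFil else .reduce)] (st x d c [] [] w e (encLabel a) g t n)
      (2 * t.length + 4 * (encLabel a).length + 8) (st x d c [] [] w e (encLabel a) g h n) := by
  induction hr with
  | @slash t h hr ih =>
    obtain ⟨m, hm, hx⟩ := ih
    refine (run_call (b := [pop H .slash, call .reduce]) (by simp [prog]) (k := m)
      ⟨m, le_rfl, by simpa [exec_pop_iff] using hx⟩).mono (by simp; omega)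
  | @neq z t hz =>
    obtain ⟨u, h1, m, hm, hx⟩ := run_neqLab (a := H) (b := V) (by decide) (z := z) (y := a) hz
      (s := st x d c [] (encLabel a) w e (encLabel a) g (encLabel z ++ t) n) (r := t) (r' := []) rfl
      (by simp)
    have hz : (encLabel z).length = z.length + 1 := by simp [encLabel]
    refine (run_call (b := _) (List.mem_cons_of_mem _ List.mem_cons_self)
      (k := 2 * (encLabel a).length + 2 + (m + (u.length + 1 + (t.length + 1 + 0))))
      ⟨_, le_rfl, ?_⟩).mono ?_
    · simp only [List.nil_append, List.cons_append, List.append_assoc, exec_pop_iff,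
        List.cons.injEq, true_and, exists_eq_left', st_H, update_st_H, st_B,
        exec_copy, ne_eq, reduceCtorEq, not_false_eq_true, st_T, st_V, update_st_V, List.append_nil]
      refine ⟨_, rfl, exec_append_iff (l₁ := [_]) (l₂ := clear V ++ (clear H ++ [push H noGoal])).2
        ⟨m, _, _, rfl, hx, ?_⟩⟩
      simp only [update_st_H, update_st_V, exec_clear, exec_push_iff, exec_nil_iff, st_H, st_V]
      exact ⟨_, rfl, _, rfl, rfl, trivial⟩
    · simp only [st_V] at h1
      simp only [List.length_cons, List.length_append]
      omega
  | @self z t h hr ih =>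
    obtain ⟨m, hm, hx⟩ := ih
    refine (run_call (b := [pop H .self, call (.skip .label H), call .redFil]) (by simp [prog])
      (k := (encLabel z).length + m) ⟨_, le_rfl, ?_⟩).mono (by simp; omega)
    simp only [List.cons_append, List.nil_append, exec_pop_iff, exec_skip, st_H,
      update_st_H, List.cons.injEq, true_and, exists_eq_left']
    exact ⟨_, t, m, rfl, reads_label z, rfl, hx⟩
  | @child t =>
    refine (run_call (b := [pop H .child, push H .self]) (by simp [prog]) (k := 0)
      ⟨0, le_rfl, by simp [exec_pop_iff, exec_push_iff, exec_nil_iff]⟩).mono (by omega)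
  | @noGoal t =>
    refine (run_call (b := [pop H noGoal, push H noGoal]) (by simp [prog]) (k := 0)
      ⟨0, le_rfl, by simp [exec_pop_iff, exec_push_iff, exec_nil_iff]⟩).mono (by omega)
  | @pick t h hr ih =>
    obtain ⟨m, hm, hx⟩ := ih
    refine (run_call (b := [pop H .more, call .reduce]) (by simp [prog]) (k := m)
      ⟨m, le_rfl, by simpa [exec_pop_iff] using hx⟩).mono (by simp; omega)
  | @skip q t h hr ih =>
    obtain ⟨m, hm, hx⟩ := ih
    refine (run_call (b := [pop H .more, call (.skip .xpath H), call .redFil]) (by simp [prog])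
      (k := (encXPath q).length + m) ⟨_, le_rfl, ?_⟩).mono (by simp; omega)
    simp only [List.cons_append, List.nil_append, exec_pop_iff, exec_skip, st_H,
      update_st_H, List.cons.injEq, true_and, exists_eq_left']
    exact ⟨_, t, m, rfl, reads_xpath q, rfl, hx⟩
  | @done t h hr ih =>
    obtain ⟨m, hm, hx⟩ := ih
    refine (run_call (b := [pop H .done, call .reduce]) (by simp [prog]) (k := m)
      ⟨m, le_rfl, by simpa [exec_pop_iff] using hx⟩).mono (by simp; omega)

/-! ### Generating the children of a vertex -/

theorem exec_clear_nil {a : Reg} : Exec prog (clear a) s k s' ↔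
    k = (s a).length + 1 ∧ s' = Function.update s a [] := by
  rw [← List.append_nil (clear a), exec_clear]
  simp [exec_nil_iff]

theorem exec_matchPre_st {k : ℕ} {a a' : Reg} {d t e h : List Sym} (haV : a ≠ V) (hbT : a' ≠ T)
    (hbV : a' ≠ V) :
    Exec prog (matchPre a a' ++ l) (st x d c t [] w e b g h n) k s' ↔ t = [] ∧
      ∃ r m, st x d c t [] w e b g h n a = st x d c t [] w e b g h n a' ++ r ∧
        k = 3 * (st x d c t [] w e b g h n a').length + 3 + m ∧
        Exec prog l (Function.update (st x d c t [] w e b g h n) a r) m s' :=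
  exec_matchPre haV hbT hbV rfl

theorem exec_pick (hD : GoodDB db) (hh : ∀ c ∈ h, c ∈ goalSyms) {a : Label} {r : List Sym}
    (hx : Exec prog (call .pick :: l)
      (st x (encDB db) c [] [] (encLabel a ++ r) [] b g h n) N s') :
    ∃ i m, (∃ rec, At db i rec ∧ rec.lab = a ∧ rec.goal = h) ∧ m < N ∧ Exec prog l
      (st x (encDB db) c [] [] r [] b g h ((uid i).reverse ++ n)) m s' := by
  simp only [exec_call_iff (f := Pr.pick), prog, List.mem_singleton, exists_eq_left,
    List.append_assoc,
    List.cons_append, List.nil_append, exec_copy, exec_drop, exec_pop_iff, exec_takeId, exec_eqLab,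
    exec_matchPre_st, exec_clear, ne_eq, reduceCtorEq, not_false_eq_true, st_D, st_T, st_E, st_W,
    st_H,
    st_N, update_st_E, update_st_N, update_st_W, List.append_nil, true_and] at hx
  obtain ⟨m₀, rfl, m₁, rfl, u, _, m₂, h1, rfl, v, rfl, i, r₁, m₃, rfl, rfl, a', r₂, _, m₄, h2,
    rfl, rfl, _,
    m₅, rfl, rfl, r₃, rfl, m₆, rfl, hx⟩ := hx
  obtain ⟨db₁, rec, db₂, rfl, h3⟩ := encDB_eq_append hD h1
  obtain ⟨rfl, h4⟩ := uid_append_inj.1 h3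
  obtain ⟨rfl, rfl⟩ := encLabel_inj h2
  simp only [recTail, List.append_assoc, List.cons_append] at h4
  obtain ⟨rfl, h5⟩ := encLabel_inj h4
  obtain ⟨rfl, -⟩ := goal_endg_inj hh (hD rec (by simp)) h5
  exact ⟨_, m₆, ⟨rec, ⟨db₁, db₂, rfl, rfl⟩, rfl, rfl⟩, by omega, hx⟩

theorem run_pick {r : List Sym} {i : ℕ} {rec : Rec} (hr : At db i rec)
    (h1 : (encDB db).length ≤ M) : Run [call .pick]
      (st x (encDB db) c [] [] (encLabel rec.lab ++ r) [] b g rec.goal n) (12 * (M + 1))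
      (st x (encDB db) c [] [] r [] b g rec.goal ((uid i).reverse ++ n)) := by
  obtain ⟨db₁, db₂, rfl, rfl⟩ := hr
  obtain ⟨u, hu⟩ := exists_encDB_append db₁ rec db₂
  simp only [Run, exec_call_iff (f := Pr.pick), prog, List.mem_singleton, exists_eq_left,
    List.append_assoc,
    List.cons_append, List.nil_append, exec_copy, exec_drop, exec_pop_iff, exec_takeId, exec_eqLab,
    exec_matchPre_st, exec_clear_nil, ne_eq, reduceCtorEq, not_false_eq_true, st_D, st_T, st_E,
    st_W, st_H,
    st_N, update_st_E, update_st_N, update_st_W, List.append_nil, true_and]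
  refine ⟨_, ?_, _, rfl, _, rfl, u, _, _, hu, rfl, _, rfl, db₂.length, _, _, rfl, rfl, rec.lab, _,
    _, _,
    rfl, by rw [recTail, List.append_assoc], rfl, _, _, by rw [List.append_assoc,
    List.cons_append], rfl, _, rfl, rfl, rfl⟩
  have := congrArg List.length hu
  simp only [recTail, encLabel, List.length_append, length_uid, List.length_cons, List.length_map,
    List.length_nil] at *
  omega

/-- The word formed by numbers in reverse order. -/
def revIds (js : List ℕ) : List Sym := (js.flatMap uid).reverse

/-- The induction is on the calls, since the star is unrolled into a larger expression. The
inequality `k + m ≤ N` bounds the steps of generation by the calls used, which yields the bound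
required in `Step`. -/
theorem exec_gen (hD : GoodDB db) (hh : ∀ c ∈ h, c ∈ goalSyms) (N : ℕ) :
    ∀ (ρ : RegularExpression Label) (r n : List Sym) (l : List I), Exec prog (call .gen :: l)
      (st x (encDB db) c [] [] (encRegex ρ ++ r) [] b g h n) N s' →
    ∃ js k m, GenD db h ρ js k ∧ k + m ≤ N ∧
      Exec prog l (st x (encDB db) c [] [] r [] b g h (revIds js ++ n)) m s' := by
  induction N using Nat.strong_induction_on with
  | _ N ih =>
    intro ρ r n l hx
    rw [exec_call_iff] at hx
    obtain ⟨m, rfl, i, hi, hx⟩ := hx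
    simp only [prog, List.mem_cons, List.not_mem_nil, or_false] at hi
    cases ρ with
    | zero =>
      obtain rfl | rfl | rfl | rfl | rfl | rfl | rfl := hi <;>
        simp [exec_pop_iff, encRegex] at hx
    | epsilon =>
      obtain rfl | rfl | rfl | rfl | rfl | rfl | rfl := hi <;>
        simp only [List.nil_append, List.cons_append, List.append_assoc, exec_pop_iff, encRegex,
          st_W,
          List.cons.injEq, reduceCtorEq, false_and, exists_false, true_and, exists_eq_left',
          update_st_W] at hx
      exact ⟨[], 1, m, ⟨[], .epsilon, .nil⟩, by omega, hx⟩
    | char a =>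
      obtain rfl | rfl | rfl | rfl | rfl | rfl | rfl := hi <;>
        simp only [List.nil_append, List.cons_append, List.append_assoc, exec_pop_iff, encRegex,
          st_W,
          List.cons.injEq, reduceCtorEq, false_and, exists_false, true_and, exists_eq_left',
          update_st_W] at hx
      obtain ⟨i, m₁, h1, h2, hx⟩ := exec_pick hD hh hx
      exact ⟨[i], 1, m₁, ⟨[a], .char, .cons h1 .nil⟩, by omega, by simpa [revIds] using hx⟩
    | plus ρ₁ ρ₂ =>
      obtain rfl | rfl | rfl | rfl | rfl | rfl | rfl := hi <;>
        simp only [List.nil_append, List.cons_append, List.append_assoc, exec_pop_iff, encRegex,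
          st_W,
          List.cons.injEq, reduceCtorEq, false_and, exists_false, true_and, exists_eq_left',
          update_st_W] at hx
      · obtain ⟨js, k, m₁, ⟨u, h1, h2⟩, h3, hx⟩ := ih m (by omega) _ _ _ _ hx
        rw [exec_skip_of (reads_regex ρ₂) rfl] at hx
        obtain ⟨m₂, rfl, hx⟩ := hx
        rw [update_st_W] at hx
        exact ⟨js, k + 1, m₂, ⟨u, h1.plus_left, h2⟩, by omega, hx⟩
      · rw [exec_skip_of (reads_regex ρ₁) rfl] at hx
        obtain ⟨m₂, rfl, hx⟩ := hx
        rw [update_st_W] at hx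
        obtain ⟨js, k, m₁, ⟨u, h1, h2⟩, h3, hx⟩ := ih m₂ (by omega) _ _ _ _ hx
        exact ⟨js, k + 1, m₁, ⟨u, h1.plus_right, h2⟩, by omega, hx⟩
    | comp ρ₁ ρ₂ =>
      obtain rfl | rfl | rfl | rfl | rfl | rfl | rfl := hi <;>
        simp only [List.nil_append, List.cons_append, List.append_assoc, exec_pop_iff, encRegex,
          st_W,
          List.cons.injEq, reduceCtorEq, false_and, exists_false, true_and, exists_eq_left',
          update_st_W] at hx
      obtain ⟨js, k, m₁, ⟨u, h1, h2⟩, h3, hx⟩ := ih m (by omega) _ _ _ _ hx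
      obtain ⟨js', k', m₂, ⟨u', h4, h5⟩, h6, hx⟩ := ih m₁ (by omega) _ _ _ _ hx
      exact ⟨js ++ js', k + k' + 1, m₂, ⟨u ++ u', h1.comp h4, List.rel_append h2 h5⟩, by omega,
        by simpa [revIds] using hx⟩
    | star ρ =>
      obtain rfl | rfl | rfl | rfl | rfl | rfl | rfl := hi <;>
        simp only [List.nil_append, List.cons_append, List.append_assoc, exec_pop_iff, encRegex,
          st_W,
          List.cons.injEq, reduceCtorEq, false_and, exists_false, true_and, exists_eq_left',
          update_st_W] at hx
      · rw [exec_skip_of (reads_regex ρ) rfl] at hx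
        obtain ⟨m₂, rfl, hx⟩ := hx
        rw [update_st_W] at hx
        exact ⟨[], 1, m₂, ⟨[], .star_nil, .nil⟩, by omega, hx⟩
      · rw [exec_empty_iff, exec_take_of (by decide) (reads_regex ρ) rfl] at hx
        obtain ⟨-, m₁, rfl, hx⟩ := hx
        simp only [update_st_W, update_st_T, st_T, List.append_nil, exec_mv2, ne_eq, reduceCtorEq,
          not_false_eq_true, exec_empty_iff, exec_push_iff, exec_mvAll, st_W, st_V,
          update_st_V] at hx
        obtain ⟨u, _, m₂, h1, rfl, rfl, m₃, rfl, m₄, rfl, hx⟩ := hx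
        rw [List.append_nil] at h1
        rw [← h1] at hx
        simp only [List.append_nil, List.reverse_reverse] at hx
        obtain ⟨js, k, m₅, ⟨u, h1, h2⟩, h3, hx⟩ := ih m₄ (by omega) _ _ _ _ hx
        obtain ⟨js', k', m₆, ⟨u', h4, h5⟩, h6, hx⟩ := ih m₅ (by omega) (.star ρ) r _ _
          (by simpa [encRegex] using hx)
        exact ⟨js ++ js', k + k' + 1, m₆, ⟨u ++ u', h1.star_append h4, List.rel_append h2 h5⟩,
          by omega, by simpa [revIds] using hx⟩

theorem forall₂_append_left {α β : Type} {R : α → β → Prop} {u v : List α} {js : List β}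
    (h : List.Forall₂ R (u ++ v) js) :
    ∃ js₁ js₂, js = js₁ ++ js₂ ∧ List.Forall₂ R u js₁ ∧ List.Forall₂ R v js₂ := by
  have h' := h.length_eq
  rw [← List.take_append_drop u.length js] at h
  refine ⟨_, _, (List.take_append_drop u.length js).symm, ?_, ?_⟩
  · simpa using List.forall₂_take u.length h
  · simpa using List.forall₂_drop u.length h

/-- Induction on the derivation: each of its steps causes one search of the database or some
skipping and copying of subexpressions, which costs at most `20 * (M + 1)` calls. -/
theorem run_gen (h1 : (encDB db).length ≤ M) {ρ : RegularExpression Label} {u : List Label}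
    (hg : RegGen ρ u k) : ∀ {js : List ℕ} {r n : List Sym}, (encRegex ρ).length ≤ M →
    List.Forall₂ (fun a j => ∃ r, At db j r ∧ r.lab = a ∧ r.goal = h) u js →
    Run [call .gen] (st x (encDB db) c [] [] (encRegex ρ ++ r) [] b g h n) (k * (20 * (M + 1)))
      (st x (encDB db) c [] [] r [] b g h (revIds js ++ n)) := by
  induction hg with
  | epsilon =>
    intro js r n hM hj
    cases hj
    refine (run_call (b := [pop W .epsilon]) (by simp [prog]) (k := 0) ⟨0, le_rfl, ?_⟩).mono
      (by omega)
    simp [exec_pop_iff, exec_nil_iff, encRegex, revIds]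
  | @char a =>
    intro js r n hM hj
    cases hj with
    | @cons _ i _ js hi hj =>
      cases hj
      obtain ⟨rec, hi, rfl, rfl⟩ := hi
      obtain ⟨m, hm, hx⟩ := run_pick (x := x) (c := c) (b := b) (g := g) (n := n) (r := r) hi h1
      refine (run_call (b := [pop W .char, call .pick]) (by simp [prog]) (k := m)
        ⟨m, le_rfl, ?_⟩).mono (by omega)
      simpa [exec_pop_iff, encRegex, revIds] using hx
  | @plus_left ρ₁ ρ₂ u k hg ih =>
    intro js r n hM hj
    simp only [encRegex, List.length_cons, List.length_append] at hM
    obtain ⟨m, hm, hx⟩ := ih (r := encRegex ρ₂ ++ r) (n := n) (by omega) hj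
    refine (run_call (b := [pop W .plus, call .gen, call (.skip .regex W)]) (by simp [prog])
      (k := m + ((encRegex ρ₂).length + 0)) ⟨_, le_rfl, ?_⟩).mono (by nlinarith)
    simp only [List.nil_append, List.cons_append, List.append_assoc, exec_pop_iff, encRegex, st_W,
      List.cons.injEq, true_and, exists_eq_left', update_st_W]
    refine exec_append_iff (l₁ := [_]).2 ⟨_, _, _, rfl, hx, ?_⟩
    rw [exec_skip_of (reads_regex ρ₂) rfl]
    exact ⟨0, rfl, exec_nil_iff.2 ⟨rfl, by simp⟩⟩
  | @plus_right ρ₁ ρ₂ u k hg ih =>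
    intro js r n hM hj
    simp only [encRegex, List.length_cons, List.length_append] at hM
    obtain ⟨m, hm, hx⟩ := ih (r := r) (n := n) (by omega) hj
    refine (run_call (b := [pop W .plus, call (.skip .regex W), call .gen]) (by simp [prog])
      (k := (encRegex ρ₁).length + m) ⟨_, le_rfl, ?_⟩).mono (by nlinarith)
    simp only [List.nil_append, List.cons_append, List.append_assoc, exec_pop_iff, encRegex, st_W,
      List.cons.injEq, true_and, exists_eq_left', update_st_W]
    rw [exec_skip_of (reads_regex ρ₁) rfl]
    exact ⟨m, rfl, by rwa [update_st_W]⟩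
  | @comp ρ₁ ρ₂ u v k₁ k₂ _ _ ih1 ih2 =>
    intro js r n hM hj
    simp only [encRegex, List.length_cons, List.length_append] at hM
    obtain ⟨j₁, j₂, rfl, hj1, hj2⟩ := forall₂_append_left hj
    have hx1 := ih1 (r := encRegex ρ₂ ++ r) (n := n) (by omega) hj1
    obtain ⟨m, hm, hx⟩ := hx1.cons (ih2 (r := r) (by omega) hj2)
    refine (run_call (b := [pop W .cat, call .gen, call .gen]) (by simp [prog])
      (k := m) ⟨_, le_rfl, ?_⟩).mono (by nlinarith)
    simpa [exec_pop_iff, encRegex, revIds] using hx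
  | @star_nil ρ =>
    intro js r n hM hj
    cases hj
    simp only [encRegex, List.length_cons] at hM
    refine (run_call (b := [pop W .star, call (.skip .regex W)]) (by simp [prog])
      (k := (encRegex ρ).length + 0) ⟨_, le_rfl, ?_⟩).mono (by omega)
    simp only [List.nil_append, List.cons_append, exec_pop_iff, encRegex, st_W,
      List.cons.injEq, true_and, exists_eq_left', update_st_W]
    rw [exec_skip_of (reads_regex ρ) rfl]
    exact ⟨0, rfl, exec_nil_iff.2 ⟨rfl, by simp [revIds]⟩⟩
  | @star_append ρ u v k₁ k₂ _ _ ih1 ih2 =>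
    intro js r n hM hj
    have hM' := hM
    simp only [encRegex, List.length_cons] at hM
    obtain ⟨j₁, j₂, rfl, hj1, hj2⟩ := forall₂_append_left hj
    have hx1 := ih1 (r := encRegex (.star ρ) ++ r) (n := n) (by omega) hj1
    obtain ⟨m, hm, hx⟩ := hx1.cons (ih2 (r := r) hM' hj2)
    set q := (encRegex ρ).length with hq
    refine (run_call (b := [pop W .star, tst T, call (.take .regex W T), call (.mv2 T W V), tst T,
      push W .star] ++
          mvAll V T ++ mvAll T W ++ [call .gen, call .gen]) (by simp [prog])
      (k := q + (q + 1 + (q + 1 + (q + 1 + m)))) ⟨_, le_rfl, ?_⟩).mono (by nlinarith)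
    simp only [List.nil_append, List.cons_append, List.append_assoc, exec_pop_iff, encRegex, st_W,
      List.cons.injEq, true_and, exists_eq_left', update_st_W]
    rw [exec_empty_iff, exec_take_of (by decide) (reads_regex ρ) rfl]
    refine ⟨rfl, _, rfl, ?_⟩
    simp only [update_st_W, update_st_T, st_T, List.append_nil, exec_mv2, ne_eq, reduceCtorEq,
      not_false_eq_true, exec_empty_iff, exec_push_iff, exec_mvAll, st_W, st_V, update_st_V]
    refine ⟨_, [], _, by rw [List.append_nil], by rw [List.length_reverse], rfl, _,
      (by simp [hq] : _ = _ + (q + 1 + m)), m, by simp [hq], ?_⟩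
    simpa [revIds, encRegex] using hx

end XPathDTD

namespace XPathDTD

open StackMachine Reg

variable {l : List I} {s s' : Reg → List Sym} {k N j M : ℕ} {x y c w b g h n d e v : List Sym}
  {db : List Rec} {rs : List (Label × RegularExpression Label)} {a₀ : Label}

/-! ### Building the database -/

/-- The stacks between two rounds of the construction of the database. -/
abbrev dbState (x : List Sym) (db : List Rec) : Reg → List Sym :=
  st x (encDB db) (List.replicate db.length idU) [] [] [] [] [] [] [] []

theorem bits_append_sep (a : Label) (r : List Sym) : bits a ++ Sym.sep :: r = encLabel a ++ r := by
  simp [bits, encLabel]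

theorem encDB_cons (r : Rec) (db : List Rec) : encDB (r :: db) =
    mark :: (List.replicate db.length idU ++ idE :: (encLabel r.lab ++ (r.goal ++ endg ::
      (r.ch.flatMap uid ++ encDB db)))) := by
  simp [encDB, uid, recTail]

theorem exec_addRec (hD : GoodDB db) (hx : Exec prog (call .addRec :: l)
    (dbState (encLabel a₀ ++ (encRules rs ++ y)) db) N s') :
    ∃ r m, Step rs N db r ∧ (∀ c ∈ r.goal, c ∈ goalSyms) ∧ m < N ∧
      Exec prog l (dbState (encLabel a₀ ++ (encRules rs ++ y)) (r :: db)) m s' := by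
  rw [exec_call_iff] at hx
  simp only [prog, List.mem_singleton, exists_eq_left, List.append_assoc, List.cons_append,
    List.nil_append, exec_push_iff, st_B, update_st_B, exec_guessLabel, exec_copy, ne_eq,
    reduceCtorEq, not_false_eq_true, st_T, st_W, update_st_W, st_X, true_and, List.append_nil] at hx
  obtain ⟨m, rfl, a, m, rfl, m, rfl, hx⟩ := hx
  rw [exec_skip_of (reads_label a₀) rfl] at hx
  obtain ⟨m, rfl, hx⟩ := hx
  rw [update_st_W] at hx
  obtain ⟨rs₁, ρ, rs₂, m, rfl, hm, hx⟩ := exec_findRule rfl hx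
  simp only [exec_matchPre_st, ne_eq, reduceCtorEq, not_false_eq_true, update_st_W, st_W, st_B,
    true_and, exec_guessGoal, st_G, update_st_G, exec_copy, st_T, st_H, update_st_H,
    List.append_nil, bits_append_sep] at hx
  obtain ⟨r, m, h1, rfl, t, m, ht, rfl, m, rfl, hx⟩ := hx
  obtain ⟨rfl, rfl⟩ := encLabel_inj h1
  obtain ⟨h, m, h2, hm1, hx⟩ := exec_reduce _ false _ _ hx
  have hh := h2.mem_goalSyms ht
  obtain ⟨js, k, m, h3, hm2, hx⟩ := exec_gen hD hh _ _ _ _ _ hx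
  simp only [exec_clear, update_st_W, update_st_H, exec_mvAll, exec_prepend, exec_push_iff,
    exec_copy,
    ne_eq, reduceCtorEq, not_false_eq_true, exec_clear, st_N, st_D, update_st_N, update_st_D,
    st_G, st_B, st_C, update_st_B, update_st_C, update_st_G, st_T, st_W, st_H, List.append_nil,
    true_and, revIds, List.reverse_reverse] at hx
  obtain ⟨m, rfl, m, rfl, m, rfl, m, rfl, m, rfl, m, rfl, hx⟩ := hx
  refine ⟨⟨ρ.1, t, js⟩, m, ⟨ρ.2, h, k, by simp, h2, by omega, h3⟩, ht, by omega, ?_⟩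
  rw [dbState, encDB_cons]
  exact hx


theorem Red.length_le {a : Label} {f : Bool} {t h : List Sym} (hr : Red a f t h) :
    h.length ≤ t.length + 1 := by
  induction hr <;> simp at * <;> omega

theorem length_encRules_append (rs₁ rs₂ : List (Label × RegularExpression Label)) :
    (encRules (rs₁ ++ rs₂)).length + 1 = (encRules rs₁).length + (encRules rs₂).length := by
  induction rs₁ with
  | nil => simp [encRules]; omega
  | cons ρ rs₁ ih => simp [encRules] at ih ⊢; omega

/-- All guesses are made according to the given record. The generation of the children accounts for
`G` units of `20 * (M + 1)`; the other work, a few passes over short stacks, fits into the two extra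
units. -/
theorem run_addRec {r : Rec} {G M : ℕ} (hr : Step rs G db r) (hg : ∀ c ∈ r.goal, c ∈ goalSyms)
    (h1 : (encDB (r :: db)).length ≤ M)
    (h2 : (encLabel a₀ ++ (encRules rs ++ y)).length ≤ M) :
    Run [call .addRec] (dbState (encLabel a₀ ++ (encRules rs ++ y)) db) ((G + 2) * (20 * (M + 1)))
      (dbState (encLabel a₀ ++ (encRules rs ++ y)) (r :: db)) := by
  obtain ⟨a, t, js⟩ := r
  obtain ⟨ρ, h, k, hρ, hr, hk, u, hu, hj⟩ := hr
  dsimp only at *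
  obtain ⟨rs₁, rs₂, rfl⟩ := List.append_of_mem hρ
  have h3 := h1
  simp only [encDB, recTail, List.length_cons, List.length_append, length_uid] at h3
  have h4 := length_encRules_append rs₁ ((a, ρ) :: rs₂)
  simp only [encRules, List.length_cons, List.length_append] at h4 h2
  have h5 := hr.length_le
  have h6 : (encLabel a).length = a.length + 1 := by simp [encLabel]
  obtain ⟨m₁, hm1, hx1⟩ := run_reduce (x := encLabel a₀ ++ (encRules (rs₁ ++ (a, ρ) :: rs₂) ++ y))
    (d := encDB db) (c := List.replicate db.length idU) (w := encRegex ρ ++ (encRules rs₂ ++ y))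
    (e := []) (g := t) (n := []) hr
  obtain ⟨m₂, hm2, hx2⟩ := run_gen (x := encLabel a₀ ++ (encRules (rs₁ ++ (a, ρ) :: rs₂) ++ y))
    (c := List.replicate db.length idU) (b := encLabel a) (g := t) (h := h) (n := [])
    (r := encRules rs₂ ++ y) (M := M) (db := db) (by omega) hu (by omega) hj
  have hx3 : Run (clear W ++ (clear H ++ (mvAll Reg.N Reg.D ++ push D endg :: (prepend Reg.G D ++
        (prepend B D ++ push D idE :: (copy C D ++ [push D mark, push C idU]))))))
      (st (encLabel a₀ ++ (encRules (rs₁ ++ (a, ρ) :: rs₂) ++ y)) (encDB db)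
        (List.replicate db.length idU) [] [] (encRules rs₂ ++ y) [] (encLabel a) t h
        (revIds js ++ [])) (9 * (M + 1))
      (dbState (encLabel a₀ ++ (encRules (rs₁ ++ (a, ρ) :: rs₂) ++ y)) (⟨a, t, js⟩ :: db)) := by
    rw [dbState, encDB_cons]
    simp only [Run, exec_clear, update_st_W, update_st_H, exec_mvAll, exec_prepend, exec_push_iff,
      exec_copy, ne_eq, reduceCtorEq, not_false_eq_true, exec_clear, st_N, st_D, update_st_N,
      update_st_D, st_G, st_B, st_C, update_st_B, update_st_C, update_st_G, st_T, st_W, st_H,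
      List.append_nil, true_and, revIds, List.reverse_reverse, List.length_reverse]
    refine ⟨_, ?_, _, rfl, _, rfl, _, rfl, _, rfl, _, rfl, 0, rfl, exec_nil_iff.2 ⟨rfl, rfl⟩⟩
    simp only [List.length_append, List.length_replicate]
    omega
  obtain ⟨m₃, hm3, hx3⟩ := hx3
  have hx4 := exec_append_iff.2 ⟨_, _, _, rfl, hx1, exec_append_iff.2 ⟨_, _, _, rfl, hx2, hx3⟩⟩
  simp only [Bool.false_eq_true, if_false, List.cons_append, List.nil_append] at hx4
  have hx5 := run_findRule (a := W) (ρs₁ := rs₁) (ρs₂ := rs₂) (ρ := (a, ρ)) (r := y)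
    (s := st (encLabel a₀ ++ (encRules (rs₁ ++ (a, ρ) :: rs₂) ++ y)) (encDB db)
      (List.replicate db.length idU) [] [] (encRules (rs₁ ++ (a, ρ) :: rs₂) ++ y) [] (encLabel a)
      [] [] []) (k := 3 * (encLabel a).length + 3 + (t.length + 1 + (2 * t.length + 2 + (m₁ +
      (m₂ + m₃)))))
    (l := matchPre W B ++ (call .guessGoal :: (copy Reg.G H ++ (call .reduce :: call .gen ::
      (clear W ++ (clear H ++ (mvAll Reg.N Reg.D ++ push D endg :: (prepend Reg.G D ++
        (prepend B D ++ push D idE :: (copy C D ++ [push D mark, push C idU]))))))))))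
    (s' := dbState (encLabel a₀ ++ (encRules (rs₁ ++ (a, ρ) :: rs₂) ++ y)) (⟨a, t, js⟩ :: db)) rfl
    ⟨_, le_rfl, by
      simp only [exec_matchPre_st, ne_eq, reduceCtorEq, not_false_eq_true, update_st_W, st_W, st_B,
        true_and, exec_guessGoal, st_G, update_st_G, exec_copy, st_T, st_H, update_st_H,
        List.append_nil]
      exact ⟨_, _, rfl, rfl, t, _, hg, rfl, _, rfl, hx4⟩⟩
  obtain ⟨m₄, hm4, hx5⟩ := hx5
  refine ⟨a.length + 1 + (2 * (encLabel a₀ ++ (encRules (rs₁ ++ (a, ρ) :: rs₂) ++ y)).length + 2 +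
    ((encLabel a₀).length + m₄)) + 1, ?_, ?_⟩
  · simp only [st_W, List.length_append] at hm4 ⊢
    have : k * (20 * (M + 1)) ≤ G * (20 * (M + 1)) := by gcongr
    rw [add_mul]
    omega
  · rw [exec_call_iff]
    simp only [prog, List.mem_singleton, exists_eq_left, List.append_assoc, List.cons_append,
      List.nil_append, exec_push_iff, st_B, update_st_B, exec_guessLabel, exec_copy, ne_eq,
      reduceCtorEq, not_false_eq_true, st_T, st_W, update_st_W, st_X, true_and, List.append_nil]
    refine ⟨_, rfl, a, _, rfl, _, rfl, ?_⟩
    rw [exec_skip_of (reads_label a₀) rfl]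
    refine ⟨_, rfl, ?_⟩
    rw [update_st_W]
    exact hx5

/-- No bound on the generation steps is known in advance, so it is quantified existentially and
enlarged with every record. It matters only for the running time, not for soundness. -/
theorem exec_build (hD : GoodDB db) (hV : ∃ G, Valid rs G db) (hx : Exec prog (call .build :: l)
    (dbState (encLabel a₀ ++ (encRules rs ++ y)) db) N s') :
    ∃ db' m, GoodDB db' ∧ (∃ G, Valid rs G db') ∧
      Exec prog l (dbState (encLabel a₀ ++ (encRules rs ++ y)) db') m s' := by
  induction N using Nat.strong_induction_on generalizing db with
  | _ N ih =>
    rw [exec_call_iff] at hx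
    obtain ⟨m, rfl, i, hi, hx⟩ := hx
    simp only [prog, List.mem_cons, List.not_mem_nil, or_false] at hi
    obtain rfl | rfl := hi
    · exact ⟨db, m, hD, hV, hx⟩
    · obtain ⟨r, m', h1, h2, h3, hx⟩ := exec_addRec hD hx
      obtain ⟨G, hV⟩ := hV
      exact ih m' (by omega) (List.forall_mem_cons.2 ⟨h2, hD⟩)
        ⟨max G (m + 1), .cons (hV.mono (le_max_left _ _)) (h1.mono (by omega))⟩ hx

theorem length_encDB_le (r : Rec) (db : List Rec) :
    (encDB db).length ≤ (encDB (r :: db)).length := by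
  simp only [encDB, List.length_cons, List.length_append]
  omega

/-- The hypothesis `hx` continues from the complete database. The induction moves records from the
database that is already there to the part that is still to be built. -/
theorem run_build {G : ℕ} (hV : Valid rs G db) (hD : GoodDB db) (h1 : (encDB db).length ≤ M)
    (h2 : (encLabel a₀ ++ (encRules rs ++ y)).length ≤ M)
    (hx : Run (call .build :: l) (dbState (encLabel a₀ ++ (encRules rs ++ y)) db) k s') :
    Run (call .build :: l) (dbState (encLabel a₀ ++ (encRules rs ++ y)) [])
      (db.length * ((G + 2) * (20 * (M + 1)) + 1) + k) s' := by
  induction hV generalizing k with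
  | nil => exact hx.mono (by simp)
  | @cons D r hV hr ih =>
    refine (ih hD.of_cons ((length_encDB_le r D).trans h1) (run_call (b := [call .addRec,
      call .build])
      (by simp [prog]) ((run_addRec hr (hD r (by simp)) h1 h2).cons hx))).mono ?_
    generalize (G + 2) * (20 * (M + 1)) = A
    rw [List.length_cons, add_mul]
    omega

/-- No position is guessed here: the record on top of the database has to be the root, with the
start symbol as label and the word for `q` as goal. The rest is the evaluation of `p`. -/
theorem exec_finish {p q : XPath} (hD : GoodDB db) (hx : Exec prog (call .finish :: l)
    (dbState (encLabel a₀ ++ (encRules rs ++ (encXPath p ++ encXPath q))) db) N s') :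
    ∃ D r, db = r :: D ∧ r.lab = a₀ ∧ r.goal = encXPath q ∧
      ∀ T, TreeAt db D.length T → ∃ S, SemT p T S := by
  rw [exec_call_iff] at hx
  simp only [prog, List.mem_singleton, exists_eq_left, List.append_assoc, List.cons_append,
    List.nil_append, exec_copy, exec_pop_iff, exec_moveId, exec_eqLab, ne_eq,
    reduceCtorEq, not_false_eq_true, st_T, st_W, update_st_W, st_X, true_and, List.append_nil,
    st_D, st_E, update_st_E, st_N, update_st_N] at hx
  obtain ⟨m, rfl, m, rfl, t, h1, i, t', m, rfl, rfl, m, rfl, a, t, t'', m, h2, h3, rfl, hx⟩ := hx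
  cases db with
  | nil => simp [encDB] at h1
  | cons r D =>
    simp only [encDB, recTail, List.cons.injEq, true_and, List.append_assoc, List.cons_append] at h1
    obtain ⟨rfl, rfl⟩ := uid_append_inj.1 h1
    obtain ⟨rfl, rfl⟩ := encLabel_inj h2
    obtain ⟨h4, rfl⟩ := encLabel_inj h3
    rw [exec_skip_of (reads_rules rs) rfl] at hx
    obtain ⟨m, rfl, hx⟩ := hx
    simp only [exec_copy, ne_eq, reduceCtorEq, not_false_eq_true, update_st_W, st_T, st_W, st_G,
      true_and, update_st_G] at hx
    obtain ⟨m, rfl, hx⟩ := hx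
    rw [exec_skip_of (r := encXPath q) (reads_xpath p) rfl] at hx
    obtain ⟨m, rfl, hx⟩ := hx
    simp only [update_st_W, exec_matchPre_st, ne_eq, reduceCtorEq, not_false_eq_true, st_E, st_W,
      true_and, exec_pop_iff, update_st_E, exec_clear, List.append_nil] at hx
    obtain ⟨t, m, h5, rfl, t, rfl, m, rfl, m, rfl, hx⟩ := hx
    obtain ⟨h6, -⟩ := goal_endg_inj (hD r (by simp)) (fun _ => mem_goalSyms) h5
    obtain ⟨j', m', -, h7, -⟩ := (exec_walk_fils hD _).1 p D.length (encXPath q) [] l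
      (by rw [List.append_nil]; exact hx)
    refine ⟨D, r, rfl, h4, h6, fun T hT => ?_⟩
    obtain ⟨T', -, h8⟩ := h7 T hT
    exact ⟨T', h8⟩

theorem run_finish {p q : XPath} {r : Rec} {U S : Tr} (hD : GoodDB (r :: db)) (hr : r.goal =
    encXPath q)
    (hU : TreeAt (r :: db) db.length U) (hS : SemT p U S)
    (h1 : (encDB (r :: db)).length ≤ M)
    (h2 : (encLabel r.lab ++ (encRules rs ++ (encXPath p ++ encXPath q))).length ≤ M)
    (h3 : (db.length + 2) * (encXPath p).length ≤ M) :
    ∃ s', Run [call .finish]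
      (dbState (encLabel r.lab ++ (encRules rs ++ (encXPath p ++ encXPath q))) (r :: db))
      ((M + 1) * (40 * (M + 1))) s' := by
  obtain ⟨j, -, m₁, hm,
    hx⟩ := run_walk (x := encLabel r.lab ++ (encRules rs ++ (encXPath p ++ encXPath q)))
    (c := List.replicate (r :: db).length idU) (w := []) (b := []) (h := []) (n := [])
    (r := encXPath q) hD h1 p hS hU (by simpa using h3)
  refine ⟨st (encLabel r.lab ++ (encRules rs ++ (encXPath p ++ encXPath q))) (encDB (r :: db))
    (List.replicate (r :: db).length idU) [] [] [] [] [] (encXPath q) [] (uid j),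
    2 * (encDB (r :: db)).length + 2 + (db.length + 1 +
    (2 * (encLabel r.lab ++ (encRules rs ++ (encXPath p ++ encXPath q))).length + 2 +
    (r.lab.length + 1 +
     ((encRules rs).length + (2 * (encXPath p ++ encXPath q).length + 2 + ((encXPath p).length +
      (3 * (encXPath q).length + 3 + ((r.ch.flatMap uid ++ encDB db).length + 1 +
        ((encXPath q).length + 1 + m₁))))))))) + 1, ?_, ?_⟩
  · have h4 : ((encXPath p).length + 1) * (40 * (M + 1)) ≤ (M + 1) * (40 * (M + 1)) := by
      refine Nat.mul_le_mul_right _ ?_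
      simp only [List.length_append] at h2
      omega
    rw [add_mul] at h4
    have h6 : (encLabel r.lab).length = r.lab.length + 1 := by simp [encLabel]
    simp only [encDB, recTail, List.length_append, List.length_cons, length_uid] at h1 h2 ⊢
    omega
  · rw [List.append_nil, List.append_nil] at hx
    rw [exec_call_iff]
    simp only [prog, List.mem_singleton, exists_eq_left, List.append_assoc, List.cons_append,
      List.nil_append, exec_copy, exec_pop_iff, exec_moveId, exec_eqLab, ne_eq,
      reduceCtorEq, not_false_eq_true, st_T, st_W, update_st_W, st_X, true_and, List.append_nil,
      st_D, st_E, update_st_E, st_N, update_st_N]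
    refine ⟨_, rfl, _, rfl, _, rfl, db.length, _, _, rfl, rfl, _, rfl, r.lab, _, _, _, rfl,
      by rw [recTail, List.append_assoc], rfl, ?_⟩
    rw [exec_skip_of (reads_rules rs) rfl]
    refine ⟨_, rfl, ?_⟩
    simp only [exec_copy, ne_eq, reduceCtorEq, not_false_eq_true, update_st_W, st_T, st_W, st_G,
      true_and, update_st_G]
    refine ⟨_, rfl, ?_⟩
    rw [exec_skip_of (r := encXPath q) (reads_xpath p) rfl]
    refine ⟨_, rfl, ?_⟩
    simp only [update_st_W, exec_matchPre_st, ne_eq, reduceCtorEq, not_false_eq_true, st_E, st_W,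
      true_and, exec_pop_iff, update_st_E, exec_clear, List.append_nil]
    exact ⟨_, _, by rw [hr, List.append_assoc, List.cons_append], rfl, _, rfl, _, rfl, _, rfl, hx⟩

end XPathDTD

namespace XPathDTD

open StackMachine Reg

variable {l : List I} {s s' : Reg → List Sym} {k N j M : ℕ} {x y c w b g h n d e v : List Sym}

/-! ### The letters of the regular expressions in the input -/

/-- The symbol `char` is used for nothing but to announce a letter, so an occurrence lies in front
of a letter of `r` or beyond `r`. This allows the program to find letters without parsing the
expressions. -/
theorem encRegex_append_eq {r : RegularExpression Label} {u v y : List Sym}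
    (h : encRegex r ++ y = u ++ Sym.char :: v) :
    (∃ b ∈ letters r, ∃ v', v = encLabel b ++ v') ∨ ∃ u', y = u' ++ Sym.char :: v := by
  induction r generalizing u y with
  | zero =>
    right
    cases u <;> simp [encRegex] at h
    exact ⟨_, h.2⟩
  | epsilon =>
    right
    cases u <;> simp [encRegex] at h
    exact ⟨_, h.2⟩
  | char a =>
    cases u with
    | nil =>
      simp only [encRegex, List.cons_append, List.nil_append, List.cons.injEq, true_and] at h
      exact .inl ⟨a, by simp [letters], y, h.symm⟩
    | cons c u =>
      simp only [encRegex, List.cons_append, List.cons.injEq] at h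
      obtain ⟨u', -, h'⟩ := eq_append_of_notMem (fun hc => by
        simpa [goalSyms] using mem_goalSyms_label hc) h.2
      exact .inr ⟨u', h'⟩
  | plus r₁ r₂ ih₁ ih₂ =>
    cases u with
    | nil => simp [encRegex] at h
    | cons c u =>
      simp only [encRegex, List.cons_append, List.append_assoc, List.cons.injEq] at h
      obtain ⟨b, hb, h⟩ | ⟨u', h⟩ := ih₁ h.2
      · exact .inl ⟨b, by simp [letters, hb], h⟩
      · obtain ⟨b, hb, h⟩ | ⟨u', h⟩ := ih₂ h
        · exact .inl ⟨b, by simp [letters, hb], h⟩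
        · exact .inr ⟨u', h⟩
  | comp r₁ r₂ ih₁ ih₂ =>
    cases u with
    | nil => simp [encRegex] at h
    | cons c u =>
      simp only [encRegex, List.cons_append, List.append_assoc, List.cons.injEq] at h
      obtain ⟨b, hb, h⟩ | ⟨u', h⟩ := ih₁ h.2
      · exact .inl ⟨b, by simp [letters, hb], h⟩
      · obtain ⟨b, hb, h⟩ | ⟨u', h⟩ := ih₂ h
        · exact .inl ⟨b, by simp [letters, hb], h⟩
        · exact .inr ⟨u', h⟩
  | star r ih =>
    cases u with
    | nil => simp [encRegex] at h
    | cons c u =>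
      simp only [encRegex, List.cons_append, List.cons.injEq] at h
      obtain ⟨b, hb, h⟩ | ⟨u', h⟩ := ih h.2
      · exact .inl ⟨b, by simp [letters, hb], h⟩
      · exact .inr ⟨u', h⟩

theorem encRules_append_eq {rs : List (Label × RegularExpression Label)} {u v y : List Sym}
    (h : encRules rs ++ y = u ++ Sym.char :: v) :
    (∃ ρ ∈ rs, ∃ b ∈ letters ρ.2, ∃ v', v = encLabel b ++ v') ∨ ∃ u', y = u' ++ Sym.char :: v := by
  induction rs generalizing u with
  | nil =>
    right
    cases u <;> simp [encRules] at h
    exact ⟨_, h.2⟩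
  | cons ρ rs ih =>
    cases u with
    | nil => simp [encRules] at h
    | cons c u =>
      simp only [encRules, List.cons_append, List.append_assoc, List.cons.injEq] at h
      obtain ⟨u', -, h'⟩ := eq_append_of_notMem (fun hc => by
        simpa [goalSyms] using mem_goalSyms_label hc) h.2
      obtain ⟨b, hb, h⟩ | ⟨u', h⟩ := encRegex_append_eq h'
      · exact .inl ⟨ρ, by simp, b, hb, h⟩
      · obtain ⟨ρ', hρ, h⟩ | ⟨u', h⟩ := ih h
        · exact .inl ⟨ρ', by simp [hρ], h⟩
        · exact .inr ⟨u', h⟩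

/-- Wherever the symbol `char` occurs in the input, it is followed by a letter of some rule. -/
theorem encRaw_eq_append {a : Label} {rs : List (Label × RegularExpression Label)} {p q : XPath}
    {u v : List Sym} (h : encRaw a rs p q = u ++ Sym.char :: v) :
    ∃ ρ ∈ rs, ∃ b ∈ letters ρ.2, ∃ v', v = encLabel b ++ v' := by
  simp only [encRaw, List.append_assoc] at h
  obtain ⟨u', -, h⟩ := eq_append_of_notMem (fun hc => by
    simpa [goalSyms] using mem_goalSyms_label hc) h
  obtain h | ⟨u', h⟩ := encRules_append_eq h
  · exact h
  · have : Sym.char ∈ encXPath p ++ encXPath q := by simp [h]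
    rw [List.mem_append] at this
    rcases this with h | h <;> simpa [goalSyms] using mem_goalSyms h

theorem exists_encRegex_eq {r : RegularExpression Label} {b : Label} (hb : b ∈ letters r) :
    ∃ u v, encRegex r = u ++ Sym.char :: (encLabel b ++ v) := by
  induction r with
  | zero => simp [letters] at hb
  | epsilon => simp [letters] at hb
  | char a =>
    obtain rfl : b = a := by simpa [letters] using hb
    exact ⟨[], [], by simp [encRegex]⟩
  | plus r₁ r₂ ih₁ ih₂ =>
    rw [letters, List.mem_append] at hb
    obtain hb | hb := hb
    · obtain ⟨u, v, h⟩ := ih₁ hb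
      exact ⟨.plus :: u, v ++ encRegex r₂, by simp [encRegex, h]⟩
    · obtain ⟨u, v, h⟩ := ih₂ hb
      exact ⟨.plus :: (encRegex r₁ ++ u), v, by simp [encRegex, h]⟩
  | comp r₁ r₂ ih₁ ih₂ =>
    rw [letters, List.mem_append] at hb
    obtain hb | hb := hb
    · obtain ⟨u, v, h⟩ := ih₁ hb
      exact ⟨.cat :: u, v ++ encRegex r₂, by simp [encRegex, h]⟩
    · obtain ⟨u, v, h⟩ := ih₂ hb
      exact ⟨.cat :: (encRegex r₁ ++ u), v, by simp [encRegex, h]⟩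
  | star r ih =>
    obtain ⟨u, v, h⟩ := ih hb
    exact ⟨.star :: u, v, by simp [encRegex, h]⟩

theorem exists_encRaw_eq {a b : Label} {rs : List (Label × RegularExpression Label)} (p q : XPath)
    {ρ : Label × RegularExpression Label} (hρ : ρ ∈ rs) (hb : b ∈ letters ρ.2) :
    ∃ u v, encRaw a rs p q = u ++ Sym.char :: (encLabel b ++ v) := by
  obtain ⟨u, v, h⟩ := exists_encRegex_eq hb
  have key : ∃ u' v', encRules rs = u' ++ encRegex ρ.2 ++ v' := by
    induction rs with
    | nil => simp at hρ
    | cons ρ' rs ih =>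
      rw [List.mem_cons] at hρ
      obtain rfl | hρ := hρ
      · exact ⟨.more :: encLabel ρ.1, encRules rs, by simp [encRules]⟩
      · obtain ⟨u', v', h⟩ := ih hρ
        exact ⟨.more :: (encLabel ρ'.1 ++ encRegex ρ'.2 ++ u'), v', by simp [encRules, h]⟩
  obtain ⟨u', v', h'⟩ := key
  exact ⟨encLabel a ++ (u' ++ u), v ++ v' ++ (encXPath p ++ encXPath q), by simp [encRaw, h', h]⟩

/-! ### The whole program -/

/-- The initial stacks of the decision procedure. -/
abbrev startState (x : List Sym) : Reg → List Sym := st x [] [] [] [] [] [] [] [] [] []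

theorem mem_decideInput {i : List I} : i ∈ prog .decideInput ↔
    (∃ z ∈ splits [.label, .rules, .xpath, .xpath],
      i = (z.1.map fun m => call (.skip m X)) ++ [call (.bad z.2 X)]) ∨
    (∃ c, i = [call (.skip .label X), call (.skip .rules X), call (.skip .xpath X),
        call (.skip .xpath X), pop X c]) ∨
    i = copy X W ++ [call (.skip .label W), call (.findRule W), pop W .more] ++ copy W E ++
        [call (.skip .label E), call (.skip .regex E), call (.findRule E), pop E .more,
          call (.eqLab W E)] ∨
    i = copy X V ++ copy X W ++ [call (.skip .label W), call .notIn] ∨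
    i = copy X V ++ [call (.drop V), pop V .char] ++ copy X W ++
          [call (.skip .label W), call .notIn] ∨
    i = [call .build, call .finish] := by
  simp only [prog, List.mem_append, List.mem_map, mem_syms, true_and, List.mem_cons,
    List.not_mem_nil, or_false, or_assoc, @eq_comm _ _ i]

/-- On a genuine instance only the last branch can succeed. The others contradict, in turn, the
syntactic form, the end of the word, and the conditions `nodup`, `start_mem` and `closed` of the
DTD. In the last branch, the database unfolds to a counterexample. -/
theorem not_containedIn_of_exec {d : DTD} {p q : XPath}
    (hx : Exec prog [call .decideInput] (startState (encInstance d p q)) N s') :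
    ¬ ContainedIn d p q := by
  rw [exec_call_iff] at hx
  obtain ⟨m, rfl, i, hi, hx⟩ := hx
  have hr := reads_instance_iff.2 ⟨d.start, d.rules, p, q, rfl⟩
  have he : encInstance d p q =
    encLabel d.start ++ (encRules d.rules ++ (encXPath p ++ encXPath q)) := by
    simp [encInstance]
  rw [mem_decideInput] at hi
  obtain ⟨z, hz, rfl⟩ | ⟨c, rfl⟩ | rfl | rfl | rfl | rfl := hi
  · exfalso
    rw [List.append_assoc, exec_skips] at hx
    obtain ⟨v, r, m, h1, h2, rfl, hx⟩ := hx
    obtain ⟨t, ht⟩ := mem_splits.1 hz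
    obtain ⟨v', w, h3, h4, h5⟩ := hr.split ht
    obtain ⟨u, u', rfl, h6, h7⟩ := h5.cons_split
    obtain ⟨rfl, rfl⟩ := h4.unique h2 (h3.symm.trans h1)
    exact not_reads_of_exec_bad hx ⟨u, u', by simp, h6⟩
  · exfalso
    rw [he] at hx
    simp only [List.cons_append] at hx
    rw [exec_skip_of (reads_label d.start) rfl] at hx
    obtain ⟨m, rfl, hx⟩ := hx
    rw [update_st_X, exec_skip_of (reads_rules d.rules) rfl] at hx
    obtain ⟨m, rfl, hx⟩ := hx
    rw [update_st_X, exec_skip_of (reads_xpath p) rfl] at hx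
    obtain ⟨m, rfl, hx⟩ := hx
    rw [update_st_X, exec_skip_of (r := []) (reads_xpath q) (by simp)] at hx
    obtain ⟨m, rfl, hx⟩ := hx
    simp [exec_pop_iff] at hx
  · exfalso
    simp only [List.append_assoc, exec_copy, ne_eq, reduceCtorEq, not_false_eq_true, st_T, st_X,
      st_W, update_st_W, true_and, List.append_nil, List.cons_append, List.nil_append] at hx
    rw [he] at hx
    obtain ⟨m, rfl, hx⟩ := hx
    rw [exec_skip_of (reads_label d.start) rfl] at hx
    obtain ⟨m, rfl, hx⟩ := hx
    rw [update_st_W] at hx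
    obtain ⟨rs₁, ρ, rs₂, m, h1, -, hx⟩ := exec_findRule rfl hx
    simp only [update_st_W, exec_copy, ne_eq, reduceCtorEq, not_false_eq_true, st_T,
      st_W, st_E, true_and, List.append_nil, update_st_E] at hx
    obtain ⟨m, rfl, hx⟩ := hx
    rw [exec_skip_of (reads_label ρ.1) rfl] at hx
    obtain ⟨m, rfl, hx⟩ := hx
    rw [update_st_E, exec_skip_of (reads_regex ρ.2) rfl] at hx
    obtain ⟨m, rfl, hx⟩ := hx
    rw [update_st_E] at hx
    obtain ⟨rs₃, ρ', rs₄, m, rfl, -, hx⟩ := exec_findRule rfl hx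
    simp only [update_st_E, exec_eqLab, ne_eq, reduceCtorEq, not_false_eq_true, st_W, st_E] at hx
    obtain ⟨a, t, t', m, h2, h3, rfl, hx⟩ := hx
    obtain ⟨rfl, -⟩ := encLabel_inj h2
    obtain ⟨h4, -⟩ := encLabel_inj h3
    have := d.nodup
    simp [h1, List.nodup_append, h4] at this
  · exfalso
    simp only [List.append_assoc, exec_copy, ne_eq, reduceCtorEq, not_false_eq_true, st_T, st_X,
      st_V, st_W, update_st_V, update_st_W, true_and, List.append_nil] at hx
    rw [he] at hx
    obtain ⟨m, rfl, m, rfl, hx⟩ := hx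
    rw [exec_skip_of (reads_label d.start) rfl] at hx
    obtain ⟨m, rfl, hx⟩ := hx
    rw [update_st_W] at hx
    exact not_mem_of_exec_notIn hx d.start_mem
  · exfalso
    simp only [List.append_assoc, exec_copy, ne_eq, reduceCtorEq, not_false_eq_true, st_T, st_X,
      st_V, st_W, update_st_V, update_st_W, true_and, List.append_nil, List.cons_append,
      List.nil_append,
      exec_drop, exec_pop_iff] at hx
    obtain ⟨m, rfl, u, r, m, h1, rfl, r, rfl, m, rfl, hx⟩ := hx
    obtain ⟨ρ, hρ, b, hb, v', rfl⟩ := encRaw_eq_append h1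
    rw [he] at hx
    rw [exec_skip_of (reads_label d.start) rfl] at hx
    obtain ⟨m, rfl, hx⟩ := hx
    rw [update_st_W] at hx
    exact not_mem_of_exec_notIn hx (d.closed ρ hρ b hb)
  · rw [he] at hx
    obtain ⟨db, m, hD, ⟨G, hV⟩, hx⟩ := exec_build (db := []) (by simp [GoodDB]) ⟨0, .nil⟩ hx
    obtain ⟨D, r, rfl, h1, h2, h3⟩ := exec_finish hD hx
    obtain ⟨T, hT⟩ := hV.exists_treeAt _ _ (at_head D r)
    obtain ⟨S, hS⟩ := h3 T hT
    exact not_containedIn_of_valid hV h1 h2 hT hS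

end XPathDTD

namespace XPathDTD

open StackMachine Reg

variable {l : List I} {s s' : Reg → List Sym} {k j M N : ℕ} {x y c w b g h n d e v : List Sym}
  {db : List Rec} {rs : List (Label × RegularExpression Label)}

/-! ### The running time -/

section Bounds

variable {R : Type} [CommSemiring R]

/-- A bound on the number of steps in which a word of a regular language is guessed, in terms of the
length of the input. -/
def genBound (m : R) : R := m * (4 * m + 1)
/-- A bound on the number of records. -/
def recBound (m : R) : R := m * (2 * m + 3) + 2 * m
/-- A bound on the sizes of the stacks. -/
def sizeBound (m : R) : R :=
  recBound m * (recBound m + 2 * m + 5 + genBound m * (recBound m + 1)) + (recBound m + 3) * m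
/-- A bound on the number of calls. -/
def costBound (m : R) : R :=
  recBound m * ((genBound m + 2) * (20 * (sizeBound m + 1)) + 1) +
    (sizeBound m + 1) * (50 * (sizeBound m + 1)) + m * (8 * (m + 1)) + 20 * m + 20

/-- The bounds are defined over any commutative semiring so that the same expressions yield a
polynomial and its values. -/
theorem eval_costBound (m : ℕ) :
    (costBound (Polynomial.X : Polynomial ℕ)).eval m = costBound m := by
  simp [costBound, sizeBound, recBound, genBound]

end Bounds

-- Sizes of databases and the cost of the branches.

theorem length_flatMap_uid_le {js : List ℕ} {K : ℕ} (h : ∀ j ∈ js, j ≤ K) :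
    (js.flatMap uid).length ≤ js.length * (K + 1) := by
  induction js with
  | nil => simp
  | cons j js ih =>
    have h1 := ih fun i hi => h i (List.mem_cons_of_mem _ hi)
    have h2 := h j List.mem_cons_self
    simp only [List.flatMap_cons, List.length_append, length_uid, List.length_cons, add_mul]
    omega

/-- A record consists of two markers, its own number of length at most `K`, a label of length at
most `m`, a goal of length at most `m + 1`, and at most `G` numbers of length at most `K + 1`. -/
theorem length_encDB_le_mul {K m G : ℕ} (hV : Valid rs G db) (hK : db.length ≤ K)
    (h1 : ∀ ρ ∈ rs, (encLabel ρ.1).length ≤ m) (h2 : ∀ r ∈ db, r.goal.length ≤ m + 1) :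
    (encDB db).length ≤ db.length * (K + 2 * m + 5 + G * (K + 1)) := by
  induction hV with
  | nil => simp [encDB]
  | @cons D r hV hr ih =>
    rw [List.length_cons] at hK
    have h3 := ih (by omega) fun r hr => h2 r (List.mem_cons_of_mem _ hr)
    have h4 := h2 r List.mem_cons_self
    obtain ⟨ρ, h, k, hρ, -, hk, u, hu, hj⟩ := hr
    have h5 : (encLabel r.lab).length ≤ m := h1 _ hρ
    have h6 : r.ch.length ≤ G := by rw [← hj.length_eq]; exact hu.length_le.trans hk
    have h7 := length_flatMap_uid_le (js := r.ch) (K := K) fun j hj' => by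
      obtain ⟨_, -, _, h8, -⟩ := exists_of_forall₂_right hj hj'
      have := h8.lt
      omega
    have h8 := Nat.mul_le_mul_right (K + 1) h6
    simp only [encDB, recTail, List.length_append, length_uid, List.length_cons]
    generalize G * (K + 1) = A at *
    rw [add_mul]
    omega

theorem length_encRules_of_mem {ρ : Label × RegularExpression Label} (hρ : ρ ∈ rs) :
    (encLabel ρ.1).length + (encRegex ρ.2).length ≤ (encRules rs).length := by
  obtain ⟨rs₁, rs₂, rfl⟩ := List.append_of_mem hρ
  have := length_encRules_append rs₁ (ρ :: rs₂)
  have h' : 0 < (encRules rs₁).length := by cases rs₁ <;> simp [encRules]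
  simp only [encRules, List.length_cons, List.length_append] at *
  omega

theorem length_le_encRules (rs : List (Label × RegularExpression Label)) :
    rs.length ≤ (encRules rs).length := by
  induction rs with
  | nil => simp
  | cons ρ rs ih => simp [encRules]; omega

theorem run_decideInput_of_not_containedIn {a : DTD} {p q : XPath} {m : ℕ} (hpq :
    ¬ ContainedIn a p q)
    (hm : (encInstance a p q).length ≤ m) :
    ∃ s', Run [call .decideInput] (startState (encInstance a p q)) (costBound m) s' := by
  have he : encInstance a p q =
      encLabel a.start ++ (encRules a.rules ++ (encXPath p ++ encXPath q)) := by simp [encInstance]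
  rw [he] at hm ⊢
  have hm' := hm
  simp only [List.length_append] at hm'
  have hw := weight_le p
  -- The regular expressions are parts of the input, and `weight p` is at most `2 * m`. So `genBound
  -- m` dominates `M * (2 * W + 1)` for `M = m` and `W = weight p`.
  obtain ⟨D, r, T, S, h1, h2, h3, h4, h5, h6, h7⟩ := exists_valid_of_not_containedIn (M := m)
    (N := genBound m) (fun ρ hρ => by have := length_encRules_of_mem hρ; omega)
    (by rw [genBound]; exact Nat.mul_le_mul_left _ (by omega)) hpq
  have hD : GoodDB (r :: D) := fun r' hr' => (h2 r' hr').mem_goalSyms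
  have hK : (r :: D).length ≤ recBound m := by
    refine h3.trans ?_
    have := length_le_encRules a.rules
    exact Nat.add_le_add (Nat.mul_le_mul (by omega) (by omega)) (by omega)
  have hM1 := length_encDB_le_mul (m := m) h1 hK
    (fun ρ hρ => by have := length_encRules_of_mem hρ; omega)
    (fun r' hr' => by have := (h2 r' hr').length_le; omega)
  have hM : (encDB (r :: D)).length ≤ sizeBound m :=
    (hM1.trans (Nat.mul_le_mul_right _ hK)).trans (Nat.le_add_right _ _)
  have hmM : m ≤ sizeBound m := by
    rw [sizeBound, add_mul]
    omega
  -- This is the room that `run_walk` needs for saved numbers; it is the last summand of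
  -- `sizeBound`.
  have hpM : (D.length + 2) * (encXPath p).length ≤ sizeBound m := by
    refine (Nat.mul_le_mul (n₂ := recBound m + 3) (m₂ := m) ?_
      (by omega)).trans (Nat.le_add_left _ _)
    rw [List.length_cons] at hK
    omega
  rw [← h4] at hm ⊢
  obtain ⟨s', hx⟩ := run_finish (rs := a.rules) (M := sizeBound m) hD h5 h6 h7 hM (hm.trans hmM) hpM
  have hx := run_build h1 hD hM (hm.trans hmM) (run_call (b := []) (by simp [prog]) hx)
  refine ⟨s', (run_call (b := [call .build, call .finish])
    (mem_decideInput.2 (by tauto)) hx).mono ?_⟩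
  have := Nat.mul_le_mul_right ((genBound m + 2) * (20 * (sizeBound m + 1)) + 1) hK
  have h8 : (sizeBound m + 1) * (40 * (sizeBound m + 1)) ≤
    (sizeBound m + 1) * (50 * (sizeBound m + 1)) := by gcongr; omega
  rw [costBound]
  omega

theorem exists_of_not_nodup (h : ¬ (rs.map Prod.fst).Nodup) : ∃ rs₁ ρ rs₂ ρ' rs₃,
    rs = rs₁ ++ ρ :: (rs₂ ++ ρ' :: rs₃) ∧ ρ.1 = ρ'.1 := by
  induction rs with
  | nil => simp at h
  | cons ρ rs ih =>
    rw [List.map_cons, List.nodup_cons, not_and_or, not_not, List.mem_map] at h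
    obtain ⟨ρ', h1, h2⟩ | h := h
    · obtain ⟨rs₂, rs₃, rfl⟩ := List.append_of_mem h1
      exact ⟨[], ρ, rs₂, ρ', rs₃, rfl, h2.symm⟩
    · obtain ⟨rs₁, ρ₁, rs₂, ρ', rs₃, rfl, h2⟩ := ih h
      exact ⟨ρ :: rs₁, ρ₁, rs₂, ρ', rs₃, rfl, h2⟩


/-- A word outside the language has one of six defects, and for each of them the corresponding
branch succeeds: it has no prefix of the right form, it is too long, a label has two rules, the
start symbol has none, some letter has none, or it is an instance with a counterexample. -/
theorem run_decideInput {x : List Sym} (hx : x ∉ dtdContainment) :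
    ∃ s', Run [call .decideInput] (startState x) (costBound x.length) s' := by
  by_cases hr : ∃ v r, x = v ++ r ∧ Reads [.label, .rules, .xpath, .xpath] v
  swap
  · obtain ⟨z, hz, v, r, rfl, h1, h2⟩ := exists_split_of_not_reads hr
    obtain ⟨k, hk, s', hx⟩ := exec_bad_of_not_reads (s := startState r) (a := X) (c := z.2) r.length
      le_rfl h2
    refine ⟨s', (run_call (k := v.length + k) (mem_decideInput.2 (.inl ⟨z, hz, rfl⟩))
      ⟨_, le_rfl, ?_⟩).mono ?_⟩
    · rw [List.append_assoc, exec_skips]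
      exact ⟨v, r, k, rfl, h1, rfl, by rwa [update_st_X]⟩
    · replace hk : k ≤ r.length + 1 := hk
      rw [costBound, List.length_append]
      omega
  obtain ⟨v, r, rfl, hr⟩ := hr
  obtain ⟨a, rs, p, q, rfl⟩ := reads_instance_iff.1 hr
  have he : ∀ r, encRaw a rs p q ++ r =
      encLabel a ++ (encRules rs ++ (encXPath p ++ (encXPath q ++ r))) := by simp [encRaw]
  have he' := he []
  simp only [List.append_nil] at he'
  cases r with
  | cons c r =>
    refine ⟨startState r, (run_call (mem_decideInput.2 (.inr (.inl ⟨c,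
      rfl⟩))) ⟨(encLabel a).length +
      ((encRules rs).length + ((encXPath p).length + ((encXPath q).length + 0))), le_rfl,
      ?_⟩).mono ?_⟩
    · rw [he]
      simp only [List.cons_append]
      rw [exec_skip_of (reads_label a) rfl]
      refine ⟨_, rfl, ?_⟩
      rw [update_st_X, exec_skip_of (reads_rules rs) rfl]
      refine ⟨_, rfl, ?_⟩
      rw [update_st_X, exec_skip_of (reads_xpath p) rfl]
      refine ⟨_, rfl, ?_⟩
      rw [update_st_X, exec_skip_of (reads_xpath q) rfl]
      simp [exec_pop_iff, exec_nil_iff]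
    · rw [he, costBound]
      simp only [List.length_append]
      omega
  | nil =>
  rw [List.append_nil] at hx ⊢
  have hl : (encRaw a rs p q).length = (encLabel a).length + ((encRules rs).length +
      ((encXPath p).length + (encXPath q).length)) := by
    simp [encRaw]
  by_cases hd : (rs.map Prod.fst).Nodup
  swap
  · obtain ⟨rs₁, ρ, rs₂, ρ', rs₃, h1, h2⟩ := exists_of_not_nodup hd
    have hl1 := length_encRules_append rs₁ (ρ :: (rs₂ ++ ρ' :: rs₃))
    rw [← h1] at hl1
    simp only [encRules, List.length_cons, List.length_append] at hl1
    have h6 : (encLabel ρ.1).length = ρ.1.length + 1 := by simp [encLabel]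
    set y := encXPath p ++ encXPath q with hy
    have hl2 := length_encRules_append rs₂ (ρ' :: rs₃)
    have hx1 : Run [call (.eqLab W E)] (Function.update (st (encRaw a rs p q) [] [] [] []
        (encLabel ρ.1 ++ (encRegex ρ.2 ++ (encRules (rs₂ ++ ρ' :: rs₃) ++ y)))
        (encRules (rs₂ ++ ρ' :: rs₃) ++ y) [] [] [] []) E
        (encLabel ρ'.1 ++ (encRegex ρ'.2 ++ (encRules rs₃ ++ y)))) (ρ.1.length + 1)
        (st (encRaw a rs p q) [] [] [] [] (encRegex ρ.2 ++ (encRules (rs₂ ++ ρ' :: rs₃) ++ y))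
        (encRegex ρ'.2 ++ (encRules rs₃ ++ y)) [] [] [] []) := by
      refine ⟨_, le_rfl, ?_⟩
      simp only [exec_eqLab (show W ≠ E by decide), update_st_E, st_W, st_E]
      exact ⟨ρ.1, _, _, 0, rfl, by rw [h2], rfl, by simp [exec_nil_iff]⟩
    obtain ⟨k₁, hk1, hx1⟩ := run_findRule rfl hx1
    have hx2 : Run (copy W E ++ [call (.skip .label E), call (.skip .regex E), call (.findRule E),
        pop E .more, call (.eqLab W E)]) (Function.update (st (encRaw a rs p q) [] [] [] []
        (encRules (rs₁ ++ ρ :: (rs₂ ++ ρ' :: rs₃)) ++ y) [] [] [] [] []) W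
        (encLabel ρ.1 ++ (encRegex ρ.2 ++ (encRules (rs₂ ++ ρ' :: rs₃) ++ y))))
        (2 * (encLabel ρ.1 ++ (encRegex ρ.2 ++ (encRules (rs₂ ++ ρ' :: rs₃) ++ y))).length + 2 +
          ((encLabel ρ.1).length + ((encRegex ρ.2).length + k₁)))
        (st (encRaw a rs p q) [] [] [] [] (encRegex ρ.2 ++ (encRules (rs₂ ++ ρ' :: rs₃) ++ y))
        (encRegex ρ'.2 ++ (encRules rs₃ ++ y)) [] [] [] []) := by
      refine ⟨_, le_rfl, ?_⟩
      simp only [update_st_W, exec_copy, ne_eq, reduceCtorEq, not_false_eq_true, st_T,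
        st_W, st_E, true_and, List.append_nil, update_st_E]
      refine ⟨_, rfl, ?_⟩
      rw [exec_skip_of (reads_label ρ.1) rfl]
      refine ⟨_, rfl, ?_⟩
      rw [update_st_E, exec_skip_of (reads_regex ρ.2) rfl]
      refine ⟨_, rfl, ?_⟩
      rw [update_st_E]
      exact hx1
    obtain ⟨k₂, hk2, hx2⟩ := run_findRule rfl hx2
    refine ⟨st (encRaw a rs p q) [] [] [] [] (encRegex ρ.2 ++ (encRules (rs₂ ++ ρ' :: rs₃) ++ y))
        (encRegex ρ'.2 ++ (encRules rs₃ ++ y)) [] [] [] [],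
      (run_call (mem_decideInput.2 (.inr (.inr (.inl rfl))))
      ⟨2 * (encRaw a rs p q).length + 2 + ((encLabel a).length + k₂), le_rfl, ?_⟩).mono ?_⟩
    · simp only [List.append_assoc, exec_copy, ne_eq, reduceCtorEq, not_false_eq_true, st_T, st_X,
        st_W, update_st_W, true_and, List.append_nil, List.cons_append, List.nil_append]
      refine ⟨_, rfl, ?_⟩
      rw [exec_skip_of (r := encRules (rs₁ ++ ρ :: (rs₂ ++ ρ' :: rs₃)) ++ y) (reads_label a)
        (by rw [st_W, he', h1])]
      refine ⟨_, rfl, ?_⟩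
      rw [update_st_W]
      exact hx2
    · simp only [st_W, st_E, List.length_append, ← h1] at hk1 hk2
      rw [costBound]
      simp only [hy, List.length_append] at hk1 hk2
      omega
  by_cases ha : a ∈ rs.map Prod.fst
  swap
  · obtain ⟨k, hk, hx⟩ := run_notIn (x := encRaw a rs p q) (d := []) (c := []) (b := []) (g := [])
      (h := []) (n := []) (M := (encRaw a rs p q).length) (r := encXPath p ++ encXPath q)
      (v := encRules rs ++ (encXPath p ++ encXPath q)) ha (by simp [hl]) (by omega)
    refine ⟨st (encRaw a rs p q) [] [] [] (encLabel a ++ (encRules rs ++ (encXPath p ++ encXPath q)))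
        (encXPath p ++ encXPath q) [] [] [] [] [],
      (run_call (mem_decideInput.2 (.inr (.inr (.inr (.inl rfl)))))
      ⟨2 * (encRaw a rs p q).length + 2 + (2 * (encRaw a rs p q).length + 2 +
        ((encLabel a).length + k)), le_rfl, ?_⟩).mono ?_⟩
    · simp only [List.append_assoc, exec_copy, ne_eq, reduceCtorEq, not_false_eq_true, st_T, st_X,
        st_V, st_W, update_st_V, update_st_W, true_and, List.append_nil
        ]
      refine ⟨_, rfl, _, rfl, ?_⟩
      rw [exec_skip_of (r := encRules rs ++ (encXPath p ++ encXPath q)) (reads_label a)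
        (by simp [he'])]
      refine ⟨_, rfl, ?_⟩
      rw [update_st_W]
      rw [← he'] at hx ⊢
      exact hx
    · have h8 : (encRules rs).length * (8 * ((encRaw a rs p q).length + 1)) ≤
          (encRaw a rs p q).length * (8 * ((encRaw a rs p q).length + 1)) :=
        Nat.mul_le_mul_right _ (by omega)
      rw [costBound]
      omega
  by_cases hc : ∀ ρ ∈ rs, ∀ b ∈ letters ρ.2, b ∈ rs.map Prod.fst
  swap
  · simp only [not_forall] at hc
    obtain ⟨ρ, hρ, b, hb, hc⟩ := hc
    obtain ⟨u, v, huv⟩ := exists_encRaw_eq (a := a) p q hρ hb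
    have hl' := congrArg List.length huv
    simp only [List.length_append, List.length_cons] at hl'
    obtain ⟨k, hk, hx⟩ := run_notIn (x := encRaw a rs p q) (d := []) (c := []) (b := []) (g := [])
      (h := []) (n := []) (M := (encRaw a rs p q).length) (r := encXPath p ++ encXPath q)
      (v := v) hc (by rw [List.length_append]; omega) (by omega)
    refine ⟨st (encRaw a rs p q) [] [] [] (encLabel b ++ v)
      (encXPath p ++ encXPath q) [] [] [] [] [],
      (run_call (mem_decideInput.2 (.inr (.inr (.inr (.inr (.inl rfl))))))
      ⟨2 * (encRaw a rs p q).length + 2 + (u.length + 1 + (2 * (encRaw a rs p q).length + 2 +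
        ((encLabel a).length + k))), le_rfl, ?_⟩).mono ?_⟩
    · simp only [List.append_assoc, exec_copy, ne_eq, reduceCtorEq, not_false_eq_true, st_T, st_X,
        st_V, st_W, update_st_V, update_st_W, true_and, List.append_nil, List.cons_append,
        List.nil_append, exec_drop, exec_pop_iff]
      refine ⟨_, rfl, u, _, _, huv, rfl, _, rfl, _, rfl, ?_⟩
      rw [exec_skip_of (r := encRules rs ++ (encXPath p ++ encXPath q)) (reads_label a)
        (by simp [he'])]
      refine ⟨_, rfl, ?_⟩
      rw [update_st_W]
      exact hx
    · have h8 : (encRules rs).length * (8 * ((encRaw a rs p q).length + 1)) ≤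
          (encRaw a rs p q).length * (8 * ((encRaw a rs p q).length + 1)) :=
        Nat.mul_le_mul_right _ (by omega)
      rw [costBound]
      omega
  exact run_decideInput_of_not_containedIn (a := ⟨a, rs, hd, ha, hc⟩)
    (fun h => hx ⟨⟨a, rs, hd, ha, hc⟩, p, q, rfl, h⟩) le_rfl

instance : Inhabited Sym := ⟨.sep⟩

/-- The compiled machine delivers the input reversed on `T`; moving it to `X` restores the order. -/
theorem exec_main {x : List Sym} : Exec prog [call .main]
      (Function.update (fun _ => []) T x.reverse) k s' ↔ ∃ m, k = x.length + 1 + 1 + m ∧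
        Exec prog [call .decideInput] (startState x) m s' := by
  have hs : Function.update (fun _ => []) T x.reverse =
    st [] [] [] x.reverse [] [] [] [] [] [] [] := by rw [eq_st (Function.update _ _ _)]; simp
  rw [exec_call_iff (f := Pr.main), hs]
  simp only [prog, List.mem_singleton, exists_eq_left, List.cons_append, List.nil_append]
  simp only [exec_mv (show T ≠ X by decide), exec_empty_iff, update_st_T, update_st_X, st_T, st_X,
    List.append_nil]
  constructor
  · rintro ⟨m, rfl, u, r, m, h, rfl, rfl, hx⟩
    rw [List.append_nil] at h
    subst h
    rw [List.reverse_reverse] at hx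
    exact ⟨m, by rw [List.length_reverse]; omega, hx⟩
  · rintro ⟨m, rfl, hx⟩
    exact ⟨x.length + 1 + m, by omega, x.reverse, [], m, by simp, by simp, rfl, by simpa using hx⟩

theorem inNP_compl_dtdContainment : InNP dtdContainmentᶜ := by
  -- The summands added to `costBound` pay for the initial reversal of the input.
  refine inNP_of_exec prog .main T (costBound Polynomial.X + Polynomial.X + 2) _ ?_ ?_
  · rintro x n s' hx ⟨d, p, q, rfl, h⟩
    obtain ⟨m, -, hx⟩ := exec_main.1 hx
    exact not_containedIn_of_exec hx h
  · intro x hx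
    obtain ⟨s', m, hm, hx⟩ := run_decideInput hx
    refine ⟨_, ?_, s', exec_main.2 ⟨m, rfl, hx⟩⟩
    simp only [Polynomial.eval_add, eval_costBound, Polynomial.eval_X, Polynomial.eval_ofNat]
    omega

end XPathDTD

/-- Containment relative to a DTD of `XP(/, [])`-expressions is in coNP. -/
theorem theorem4p2 : XPathDTD.InCoNP XPathDTD.dtdContainment :=
  XPathDTD.inNP_compl_dtdContainment
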